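/- Let $S\in\{\tfrac12,1,\tfrac32,\dots\}$. On $\mathscr H_L=\bigotimes_{x=1}^{L}\mathbb C^{2S+1}$ consider the ferromagnetic nearest-neighbour Heisenberg Hamiltonian $$H_L=\sum_{x=1}^{L-1}\bigl(S^2-\vec S_x\cdot\vec S_{x+1}\bigr),$$ where $\vec S_x=(S^1_x,S^2_x,S^3_x)$ denotes the spin operators of the spin-$S$ (that is, the irreducible $(2S+1)$-dimensional) representation of $SU(2)$, acting on the $x$-th tensor factor. For $\beta>0$ let $$f_L(\beta,S)=-\frac1{\beta L}\ln\operatorname{Tr}e^{-\beta H_L}.$$ Then for every $\beta>0$ the thermodynamic limit $f(\beta,S)=\lim_{L\to\infty}f_L(\beta,S)$ exists, and for fixed $S$, $$\lim_{\beta\to\infty}f(\beta,S)\,S^{1/2}\,\beta^{3/2}=C_1:=\frac1{2\pi}\int_{\mathbb R}\ln\bigl(1-e^{-p^2}\bigr)\,dp=\frac{-\zeta(3/2)}{2\sqrt\pi},$$ where the integral converges absolutely. -/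

import Mathlib

open Filter Topology MeasureTheory

noncomputable section

namespace HeisenbergChain

/-- The raising operator `S⁺` in the spin-`N/2` representation of `SU(2)`, in the orthonormal
basis `|n⟩`, `0 ≤ n ≤ N`, of eigenvectors of `S³`:
`S⁺ |n⟩ = √((n + 1) (N - n)) |n + 1⟩`. -/
def spinPlus (N : ℕ) : Matrix (Fin (N + 1)) (Fin (N + 1)) ℂ :=
  Matrix.of fun m n =>
    if (m : ℕ) = (n : ℕ) + 1 then ((Real.sqrt (((n : ℝ) + 1) * ((N : ℝ) - (n : ℝ))) : ℝ) : ℂ)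
    else 0

/-- The lowering operator `S⁻`, the adjoint of `S⁺`. -/
def spinMinus (N : ℕ) : Matrix (Fin (N + 1)) (Fin (N + 1)) ℂ :=
  (spinPlus N).conjTranspose

/-- The three components of the spin operator `(S¹, S², S³)` for spin `N/2`, indexed by `Fin 3`:
`S¹ = (S⁺ + S⁻)/2`, `S² = (S⁺ - S⁻)/(2i)`, and `S³ |n⟩ = (n - N/2) |n⟩`. -/
def spinMatrix (N : ℕ) : Fin 3 → Matrix (Fin (N + 1)) (Fin (N + 1)) ℂ :=
  ![(1 / 2 : ℂ) • (spinPlus N + spinMinus N),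
    (1 / (2 * Complex.I)) • (spinPlus N - spinMinus N),
    Matrix.diagonal fun n => (n : ℂ) - (N : ℂ) / 2]

/-- Product basis of the Hilbert space `⨂_{x=1}^L ℂ^{N+1}` of a chain with `L` sites: one basis
index for each site. Operators on that space are matrices over this index type. -/
abbrev Config (N L : ℕ) : Type := Fin L → Fin (N + 1)

/-- The operator on `⨂_{x=1}^L ℂ^{N+1}` that acts as `A` on the tensor factor `x` and as the
identity on all other factors. -/
def siteOp (N L : ℕ) (A : Matrix (Fin (N + 1)) (Fin (N + 1)) ℂ) (x : Fin L) :
    Matrix (Config N L) (Config N L) ℂ :=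
  Matrix.of fun s t => if ∀ y, y ≠ x → s y = t y then A (s x) (t x) else 0

/-- The scalar product of spin operators `S⃗_x · S⃗_y = ∑_a S^a_x S^a_y`. -/
def spinDot (N L : ℕ) (x y : Fin L) : Matrix (Config N L) (Config N L) ℂ :=
  ∑ a : Fin 3, siteOp N L (spinMatrix N a) x * siteOp N L (spinMatrix N a) y

/-- The ferromagnetic Heisenberg Hamiltonian with spin `S = N/2` on a chain of `L` sites,
`H_L = ∑_{x=1}^{L-1} (S² - S⃗_x · S⃗_{x+1})` (the sites are numbered from `0` here). -/
def hamiltonian (N L : ℕ) : Matrix (Config N L) (Config N L) ℂ :=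
  ∑ x : Fin (L - 1),
    (((N : ℂ) / 2) ^ 2 • (1 : Matrix (Config N L) (Config N L) ℂ)
      - spinDot N L ⟨(x : ℕ), by omega⟩ ⟨(x : ℕ) + 1, by omega⟩)

/-- The partition function `Tr e^{-β H_L}`. The trace is a real number, since `H_L` is
self-adjoint. -/
def partitionFunction (N L : ℕ) (β : ℝ) : ℝ :=
  (Matrix.trace (NormedSpace.exp (-(β : ℂ) • hamiltonian N L))).re

/-- The specific free energy `f_L(β, S) = -(β L)⁻¹ ln Tr e^{-β H_L}` for spin `S = N/2`. -/
def finiteFreeEnergy (N L : ℕ) (β : ℝ) : ℝ :=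
  -(1 / (β * (L : ℝ))) * Real.log (partitionFunction N L β)

/-- The free energy `f(β, S) = lim_{L → ∞} f_L(β, S)` in the thermodynamic limit, for spin
`S = N/2`. -/
def freeEnergy (N : ℕ) (β : ℝ) : ℝ :=
  limUnder atTop fun L : ℕ => finiteFreeEnergy N L β

/-- The constant `C₁ = (2π)⁻¹ ∫_ℝ ln (1 - e^{-p²}) dp`. -/
def C₁ : ℝ :=
  1 / (2 * Real.pi) * ∫ p : ℝ, Real.log (1 - Real.exp (-p ^ 2))

end HeisenbergChain

end

/-! Read the basis index at a site as a number of particles; the state without particles has energy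
zero. After division by the square root of `weight`, each bond term becomes the Dirichlet form of a
reversible hopping process (`qf_bond`), and one particle moves by a lattice Laplacian with
dispersion `S · 2 (1 - cos p) ≈ S p²`. At low temperature the relevant states are dilute, the
particles behave like free bosons, and `√β` times the pressure `lim L⁻¹ ln Z` tends to `-(2π)⁻¹ ∫ ln
(1 - e^{-S p²}) dp = -C₁ / √S`. The free energy is `-pressure / β`.

Finite boxes suffice. Bond terms are nonnegative, so cutting a bond raises the trace and `ln Z` is
subadditive. They vanish between empty sites, so traces over configurations with empty ends are
supermultiplicative. Hence one box bounds the limit from above (`pressure_le`) and from below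
(`le_pressure`). Traces are compared by counting dimensions of spectral subspaces
(`sum_le_sum_of_card_le`, `sum_exp_le_heatTrace`).

Lower bound (`eventually_lt_pressure`): in a box of length about `A √β`, fill finitely many sine
modes with boundedly many bosons. The particle number stays bounded while the box grows, so
coincidences cost little norm (`le_sqNorm_chainTrial`), and the energy form is at most that of free
bosons (`qf_chainTrial_le`).

Upper bound (`eventually_pressure_lt`): take a box somewhat longer than `√β`. (a) The total lowering
operator commutes with the Hamiltonian, and a lowest weight state with `n` particles has energy at
least `n N / (8 L²)`: the sum of all pair terms is a Casimir operator, and a distant pair term is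
controlled by the nearest neighbour terms in between (`qf_bond_le_of_dist`). Up to a factor `N L +
1`, only sectors with few particles count. (b) Replace each spin by `N` symmetrised spins one half.
At small energy, displacing one particle changes the state little; averaging over displacements
shows that two particles are rarely close (`sum_not_isDilute_le_energy`). (c) A hard-core
configuration of `n` particles on `m + n` sites is an occupation of the `m + 1` gaps between holes.
This turns the dilute part of a state into a symmetric function on a path, with no larger energy,
and path modes diagonalise the form (`finrank_lowParticleSpace_le_card`). (d) Energies above a
cutoff are handled by a crude bound for shorter blocks (`partitionFunction_le_of_short`). -/

set_option linter.unusedSectionVars false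

noncomputable section

namespace HeisenbergChain

open Matrix

/-! ### Spectral counting and variational bounds for traces of exponentials. -/

section Spectral

variable {ι κ : Type*} [Fintype ι] [Fintype κ] [DecidableEq ι] [DecidableEq κ]

/-- The squared Euclidean norm. -/
def sqNorm {ι : Type*} [Fintype ι] (v : ι → ℂ) : ℝ := ∑ i, ‖v i‖ ^ 2

/-- The (real part of the) quadratic form of a matrix. -/
def qf {ι : Type*} [Fintype ι] (A : Matrix ι ι ℂ) (v : ι → ℂ) : ℝ := (star v ⬝ᵥ (A *ᵥ v)).re

/-- `Tr e^{-β A}`. -/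
def heatTrace {ι : Type*} [Fintype ι] [DecidableEq ι] (β : ℝ) (A : Matrix ι ι ℂ) : ℝ :=
  (Matrix.trace (NormedSpace.exp (-(β : ℂ) • A))).re

theorem sqNorm_nonneg {ι : Type*} [Fintype ι] (v : ι → ℂ) : 0 ≤ sqNorm v :=
  Finset.sum_nonneg fun _ _ => sq_nonneg _

theorem sqNorm_pos {ι : Type*} [Fintype ι] {v : ι → ℂ} (hv : v ≠ 0) : 0 < sqNorm v := by
  obtain ⟨i, hi⟩ := Function.ne_iff.mp hv
  exact Finset.sum_pos' (fun _ _ => sq_nonneg _) ⟨i, Finset.mem_univ _, by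
    have : 0 < ‖v i‖ := norm_pos_iff.mpr hi
    positivity⟩

theorem sqNorm_eq_dotProduct {ι : Type*} [Fintype ι] (v : ι → ℂ) :
    ((sqNorm v : ℝ) : ℂ) = star v ⬝ᵥ v := by
  simp only [sqNorm, dotProduct, Complex.ofReal_sum, Pi.star_apply, RCLike.star_def]
  exact Finset.sum_congr rfl fun i _ => by rw [Complex.conj_mul', Complex.ofReal_pow]

theorem sqNorm_eq_re {ι : Type*} [Fintype ι] (v : ι → ℂ) : sqNorm v = (star v ⬝ᵥ v).re := by
  rw [← sqNorm_eq_dotProduct, Complex.ofReal_re]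

theorem sqNorm_mulVec {A : Matrix κ ι ℂ} (hA : Aᴴ * A = 1) (v : ι → ℂ) :
    sqNorm (A *ᵥ v) = sqNorm v := by
  rw [sqNorm_eq_re, sqNorm_eq_re, star_mulVec, ← dotProduct_mulVec, mulVec_mulVec, hA, one_mulVec]

theorem eigenvectorUnitary_mul_star {A : Matrix ι ι ℂ} (hA : A.IsHermitian) :
    (hA.eigenvectorUnitary : Matrix ι ι ℂ) * star (hA.eigenvectorUnitary : Matrix ι ι ℂ) = 1 :=
  Unitary.coe_mul_star_self _

theorem star_mul_eigenvectorUnitary {A : Matrix ι ι ℂ} (hA : A.IsHermitian) :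
    star (hA.eigenvectorUnitary : Matrix ι ι ℂ) * (hA.eigenvectorUnitary : Matrix ι ι ℂ) = 1 :=
  Unitary.coe_star_mul_self _

/-- Coordinates in the eigenbasis of a Hermitian matrix. -/
def coord {A : Matrix ι ι ℂ} (hA : A.IsHermitian) : (ι → ℂ) →ₗ[ℂ] (ι → ℂ) :=
  Matrix.mulVecLin (star (hA.eigenvectorUnitary : Matrix ι ι ℂ))

/-- The vector with given coordinates in the eigenbasis of a Hermitian matrix. -/
def uncoord {A : Matrix ι ι ℂ} (hA : A.IsHermitian) : (ι → ℂ) →ₗ[ℂ] (ι → ℂ) :=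
  Matrix.mulVecLin (hA.eigenvectorUnitary : Matrix ι ι ℂ)

theorem coord_uncoord {A : Matrix ι ι ℂ} (hA : A.IsHermitian) (v : ι → ℂ) :
    coord hA (uncoord hA v) = v := by
  simp [coord, uncoord, mulVec_mulVec]

theorem uncoord_coord {A : Matrix ι ι ℂ} (hA : A.IsHermitian) (v : ι → ℂ) :
    uncoord hA (coord hA v) = v := by
  simp [coord, uncoord, mulVec_mulVec]

theorem sqNorm_coord {A : Matrix ι ι ℂ} (hA : A.IsHermitian) (v : ι → ℂ) :
    sqNorm (coord hA v) = sqNorm v := by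
  apply sqNorm_mulVec
  rw [← star_eq_conjTranspose, star_star]
  exact Unitary.coe_mul_star_self _

theorem eq_conj_diagonal {A : Matrix ι ι ℂ} (hA : A.IsHermitian) :
    A = (hA.eigenvectorUnitary : Matrix ι ι ℂ) * diagonal (fun i => (hA.eigenvalues i : ℂ)) *
      star (hA.eigenvectorUnitary : Matrix ι ι ℂ) := by
  conv_lhs => rw [hA.spectral_theorem]
  rw [Unitary.conjStarAlgAut_apply]
  rfl

theorem coord_mulVec {A : Matrix ι ι ℂ} (hA : A.IsHermitian) (v : ι → ℂ) (i : ι) :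
    coord hA (A *ᵥ v) i = hA.eigenvalues i * coord hA v i := by
  have h : star (hA.eigenvectorUnitary : Matrix ι ι ℂ) * A =
      diagonal (fun i => (hA.eigenvalues i : ℂ)) *
        star (hA.eigenvectorUnitary : Matrix ι ι ℂ) := by
    refine (congrArg (star (hA.eigenvectorUnitary : Matrix ι ι ℂ) * ·)
      (eq_conj_diagonal hA)).trans ?_
    simp only [← mul_assoc]
    rw [Unitary.coe_star_mul_self, one_mul]
  simp only [coord, mulVecLin_apply, mulVec_mulVec, h]
  rw [← mulVec_mulVec, mulVec_diagonal]

theorem star_dotProduct_coord {A : Matrix ι ι ℂ} (hA : A.IsHermitian) (v w : ι → ℂ) :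
    star (coord hA v) ⬝ᵥ coord hA w = star v ⬝ᵥ w := by
  simp only [coord, mulVecLin_apply]
  rw [star_mulVec, ← dotProduct_mulVec, mulVec_mulVec, ← star_eq_conjTranspose, star_star]
  simp

theorem qf_eq_sum {A : Matrix ι ι ℂ} (hA : A.IsHermitian) (v : ι → ℂ) :
    qf A v = ∑ i, hA.eigenvalues i * ‖coord hA v i‖ ^ 2 := by
  rw [qf, ← star_dotProduct_coord hA]
  simp only [dotProduct, Pi.star_apply, coord_mulVec, Complex.re_sum, RCLike.star_def]
  refine Finset.sum_congr rfl fun i _ => ?_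
  rw [mul_left_comm, Complex.conj_mul', ← Complex.ofReal_pow, ← Complex.ofReal_mul,
    Complex.ofReal_re]

theorem heatTrace_eq_sum (β : ℝ) {A : Matrix ι ι ℂ} (hA : A.IsHermitian) :
    heatTrace β A = ∑ i, Real.exp (-(β * hA.eigenvalues i)) := by
  let u : (Matrix ι ι ℂ)ˣ := ⟨hA.eigenvectorUnitary, star (hA.eigenvectorUnitary : Matrix ι ι ℂ),
    Unitary.coe_mul_star_self _, Unitary.coe_star_mul_self _⟩
  have h : (-(β : ℂ) • A) = (u : Matrix ι ι ℂ) *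
      diagonal (fun i => -(β : ℂ) * (hA.eigenvalues i : ℂ)) * ((u⁻¹ : (Matrix ι ι ℂ)ˣ) : Matrix ι ι ℂ) := by
    have h2 : diagonal (fun i => -(β : ℂ) * (hA.eigenvalues i : ℂ)) =
        -(β : ℂ) • diagonal (fun i => (hA.eigenvalues i : ℂ)) := by
      rw [← diagonal_smul]; rfl
    rw [h2, Matrix.mul_smul, Matrix.smul_mul]
    congr 1
    exact eq_conj_diagonal hA
  rw [heatTrace, h, Matrix.exp_units_conj, Matrix.trace_mul_comm, ← mul_assoc, Units.inv_mul,
    one_mul, Matrix.exp_diagonal, Matrix.trace_diagonal, Complex.re_sum]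
  refine Finset.sum_congr rfl fun i _ => ?_
  rw [Pi.coe_exp, ← Complex.exp_eq_exp_ℂ, ← Complex.ofReal_neg, ← Complex.ofReal_mul,
    Complex.exp_ofReal_re, neg_mul]

/-- The span of the eigenvectors with eigenvalue at most `t`. -/
def lowSpace {A : Matrix ι ι ℂ} (hA : A.IsHermitian) (t : ℝ) : Submodule ℂ (ι → ℂ) where
  carrier := {v | ∀ i, t < hA.eigenvalues i → coord hA v i = 0}
  add_mem' := fun {v w} hv hw i hi => by
    rw [map_add, Pi.add_apply, hv i hi, hw i hi, add_zero]
  zero_mem' := fun i _ => by rw [map_zero, Pi.zero_apply]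
  smul_mem' := fun c v hv i hi => by
    rw [map_smul, Pi.smul_apply, hv i hi, smul_zero]

theorem finrank_lowSpace {A : Matrix ι ι ℂ} (hA : A.IsHermitian) (t : ℝ) :
    Module.finrank ℂ (lowSpace hA t) = (Finset.univ.filter fun i => hA.eigenvalues i ≤ t).card := by
  classical
  let e : lowSpace hA t ≃ₗ[ℂ] ({i // hA.eigenvalues i ≤ t} → ℂ) :=
    { toFun := fun v i => coord hA v.1 i.1
      map_add' := fun v w => by ext i; simp
      map_smul' := fun c v => by ext i; simp
      invFun := fun u => ⟨uncoord hA fun i => if h : hA.eigenvalues i ≤ t then u ⟨i, h⟩ else 0, by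
        intro i hi
        rw [coord_uncoord, dif_neg (not_le.mpr hi)]⟩
      left_inv := fun v => by
        apply Subtype.ext
        conv_rhs => rw [← uncoord_coord hA v.1]
        change uncoord hA _ = uncoord hA _
        congr 1
        funext i
        by_cases h : hA.eigenvalues i ≤ t
        · simp [h]
        · simp [h, v.2 i (not_le.mp h)]
      right_inv := fun u => by
        ext i
        simp [coord_uncoord, i.2] }
  rw [LinearEquiv.finrank_eq e, Module.finrank_fintype_fun_eq_card, Fintype.card_subtype]

theorem qf_le_of_mem_lowSpace {A : Matrix ι ι ℂ} (hA : A.IsHermitian) {t : ℝ} {v : ι → ℂ}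
    (hv : v ∈ lowSpace hA t) : qf A v ≤ t * sqNorm v := by
  rw [qf_eq_sum hA, ← sqNorm_coord hA v, sqNorm, Finset.mul_sum]
  refine Finset.sum_le_sum fun i _ => ?_
  by_cases h : hA.eigenvalues i ≤ t
  · exact mul_le_mul_of_nonneg_right h (sq_nonneg _)
  · simp [hv i (not_le.mp h)]

/-- Matrix elements of `B` between eigenvectors of different eigenvalues vanish. Applied to the
total lowering operator and to the projections to fixed particle number. -/
theorem mem_lowSpace_mulVec {A B : Matrix ι ι ℂ} (hA : A.IsHermitian) (hAB : A * B = B * A) {t : ℝ}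
    {v : ι → ℂ} (hv : v ∈ lowSpace hA t) : B *ᵥ v ∈ lowSpace hA t := by
  have key : ∀ i j, hA.eigenvalues i ≠ hA.eigenvalues j →
      coord hA (B *ᵥ uncoord hA (Pi.single j 1)) i = 0 := by
    intro i j hij
    have h1 : A *ᵥ uncoord hA (Pi.single j 1) =
        (hA.eigenvalues j : ℂ) • uncoord hA (Pi.single j 1) := by
      rw [← uncoord_coord hA (A *ᵥ _), ← map_smul]
      congr 1
      ext k
      rw [coord_mulVec, coord_uncoord]
      by_cases hk : k = j
      · subst hk; simp
      · simp [hk]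
    have h2 := coord_mulVec hA (B *ᵥ uncoord hA (Pi.single j 1)) i
    rw [mulVec_mulVec, hAB, ← mulVec_mulVec, h1, mulVec_smul, map_smul, Pi.smul_apply,
      smul_eq_mul, ← sub_eq_zero, ← sub_mul] at h2
    rcases mul_eq_zero.mp h2 with h | h
    · exfalso
      apply hij
      rw [sub_eq_zero] at h
      exact_mod_cast h.symm
    · exact h
  intro i hi
  have hexp : v = ∑ j, coord hA v j • uncoord hA (Pi.single j 1) := by
    conv_lhs => rw [← uncoord_coord hA v]
    conv_lhs => rw [pi_eq_sum_univ' (coord hA v)]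
    rw [map_sum]
    refine Finset.sum_congr rfl fun j _ => ?_
    rw [map_smul]
  have h3 : B *ᵥ v = ∑ j, coord hA v j • (B *ᵥ uncoord hA (Pi.single j 1)) := by
    conv_lhs => rw [hexp]
    rw [← mulVecLin_apply, map_sum]
    simp
  rw [h3, map_sum, Finset.sum_apply]
  refine Finset.sum_eq_zero fun j _ => ?_
  rw [map_smul, Pi.smul_apply, smul_eq_mul]
  by_cases hj : hA.eigenvalues j ≤ t
  · rw [key i j (by linarith [lt_of_le_of_lt hj hi] |> ne_of_gt), mul_zero]
  · rw [hv j (not_le.mp hj), zero_mul]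

omit [DecidableEq κ] in
/-- Dimension counting: a space on which a diagonal form is at most `s` after an injective map
has dimension at most the number of diagonal entries `≤ s`. -/
theorem finrank_le_card_of_form_le {V : Type*} [AddCommGroup V] [Module ℂ V]
    [FiniteDimensional ℂ V] (b : κ → ℝ) (s : ℝ) (J : V →ₗ[ℂ] (κ → ℂ))
    (hJ : ∀ w, w ≠ 0 → J w ≠ 0 ∧ ∑ j, b j * ‖J w j‖ ^ 2 ≤ s * ∑ j, ‖J w j‖ ^ 2) :
    Module.finrank ℂ V ≤ (Finset.univ.filter fun j => b j ≤ s).card := by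
  classical
  let R : V →ₗ[ℂ] ({j // b j ≤ s} → ℂ) :=
    { toFun := fun v j => J v j.1
      map_add' := fun v w => by ext i; simp
      map_smul' := fun c v => by ext i; simp }
  -- If `R w = 0`, then `J w` lives where `b j > s`, so its form strictly exceeds `s` times its
  -- squared norm unless `J w = 0`.
  have hinj : Function.Injective R := by
    rw [← LinearMap.ker_eq_bot, LinearMap.ker_eq_bot']
    intro w hw
    by_contra hne
    obtain ⟨h1, h2⟩ := hJ w hne
    obtain ⟨j, hj⟩ := Function.ne_iff.mp h1
    have hz : ∀ j, b j ≤ s → J w j = 0 := fun j h => congrFun hw ⟨j, h⟩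
    have : s * ∑ j, ‖J w j‖ ^ 2 < ∑ j, b j * ‖J w j‖ ^ 2 := by
      rw [Finset.mul_sum]
      refine Finset.sum_lt_sum (fun i _ => ?_) ⟨j, Finset.mem_univ _, ?_⟩
      · by_cases h : b i ≤ s
        · simp [hz i h]
        · exact mul_le_mul_of_nonneg_right (not_le.mp h).le (sq_nonneg _)
      · have hb : s < b j := by
          by_contra hcon
          exact hj (hz j (not_lt.mp hcon))
        have : 0 < ‖J w j‖ := norm_pos_iff.mpr hj
        exact mul_lt_mul_of_pos_right hb (by positivity)
    linarith
  have := LinearMap.finrank_le_finrank_of_injective hinj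
  rwa [Module.finrank_fintype_fun_eq_card, Fintype.card_subtype] at this

/-- Comparison of counting functions up to `E` gives comparison of sums of decreasing functions. -/
theorem sum_le_sum_of_card_le (a : ι → ℝ) (b : κ → ℝ) (E : ℝ) (g : ℝ → ℝ) (hg : Antitone g)
    (hg0 : ∀ x, 0 ≤ g x)
    (h : ∀ t ≤ E, (Finset.univ.filter fun i => a i ≤ t).card ≤
      (Finset.univ.filter fun j => b j ≤ t).card) :
    ∑ i ∈ Finset.univ.filter (fun i => a i ≤ E), g (a i) ≤ ∑ j, g (b j) := by
  classical
  -- Hall's marriage theorem: the sets `T i` are nested, so a union of them is the largest one and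
  -- the count at its level suffices. The matching `f` satisfies `b (f i) ≤ a i`.
  let T : {i // a i ≤ E} → Finset κ := fun i => Finset.univ.filter fun j => b j ≤ a i.1
  have hall : ∀ s : Finset {i // a i ≤ E}, s.card ≤ (s.biUnion T).card := by
    intro s
    rcases s.eq_empty_or_nonempty with rfl | hs
    · simp
    obtain ⟨m, hm, hmax⟩ := s.exists_max_image (fun i => a i.1) hs
    calc s.card = (s.map (Function.Embedding.subtype _)).card := by simp
      _ ≤ (Finset.univ.filter fun i => a i ≤ a m.1).card := by
          apply Finset.card_le_card
          intro i hi
          simp only [Finset.mem_map, Function.Embedding.subtype_apply] at hi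
          obtain ⟨i', hi', rfl⟩ := hi
          simpa using hmax i' hi'
      _ ≤ (T m).card := h _ m.2
      _ ≤ (s.biUnion T).card := Finset.card_le_card (Finset.subset_biUnion_of_mem T hm)
  obtain ⟨f, hf, hfT⟩ := (Finset.all_card_le_biUnion_card_iff_exists_injective T).mp hall
  calc ∑ i ∈ Finset.univ.filter (fun i => a i ≤ E), g (a i)
      = ∑ i : {i // a i ≤ E}, g (a i.1) := by
        rw [← Finset.sum_subtype_eq_sum_filter]; simp
    _ ≤ ∑ i : {i // a i ≤ E}, g (b (f i)) :=
        Finset.sum_le_sum fun i _ => hg (by simpa [T] using hfT i)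
    _ = ∑ j ∈ Finset.univ.image f, g (b j) := by
        rw [Finset.sum_image fun x _ y _ hxy => hf hxy]
    _ ≤ ∑ j, g (b j) :=
        Finset.sum_le_sum_of_subset_of_nonneg (Finset.subset_univ _) fun _ _ _ => hg0 _

theorem antitone_exp_neg {β : ℝ} (hβ : 0 ≤ β) : Antitone fun x : ℝ => Real.exp (-(β * x)) :=
  fun _ _ hxy => Real.exp_le_exp.mpr (neg_le_neg (mul_le_mul_of_nonneg_left hxy hβ))

omit [DecidableEq κ] in
/-- Variational lower bound on `Tr e^{-β A}` from a nearly isometric family of trial states. -/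
theorem sum_exp_le_heatTrace {β : ℝ} (hβ : 0 ≤ β) {A : Matrix ι ι ℂ} (hA : A.IsHermitian)
    (b : κ → ℝ) (hb : ∀ j, 0 ≤ b j) {θ : ℝ} (hθ : 0 < θ) (J : (κ → ℂ) →ₗ[ℂ] (ι → ℂ))
    (hJ : ∀ v, θ * sqNorm v ≤ sqNorm (J v))
    (hq : ∀ v, qf A (J v) ≤ ∑ j, b j * ‖v j‖ ^ 2) :
    ∑ j, Real.exp (-(β * (b j / θ))) ≤ heatTrace β A := by
  classical
  rw [heatTrace_eq_sum β hA]
  obtain ⟨E, hE⟩ : ∃ E : ℝ, ∀ j, b j / θ ≤ E :=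
    ⟨∑ j, b j / θ, fun j => Finset.single_le_sum
      (f := fun j => b j / θ) (fun i _ => div_nonneg (hb i) hθ.le) (Finset.mem_univ j)⟩
  have := sum_le_sum_of_card_le (fun j => b j / θ) hA.eigenvalues E _ (antitone_exp_neg hβ)
    (fun _ => (Real.exp_pos _).le) ?_
  · rwa [Finset.filter_true_of_mem fun j _ => hE j] at this
  intro t _
  let V : Submodule ℂ (κ → ℂ) :=
    { carrier := {v | ∀ j, t < b j / θ → v j = 0}
      add_mem' := fun {v w} hv hw i hi => by rw [Pi.add_apply, hv i hi, hw i hi, add_zero]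
      zero_mem' := fun i _ => rfl
      smul_mem' := fun c v hv i hi => by rw [Pi.smul_apply, hv i hi, smul_zero] }
  let e : V ≃ₗ[ℂ] ({j // b j / θ ≤ t} → ℂ) :=
    { toFun := fun v i => v.1 i.1
      map_add' := fun v w => by ext i; simp
      map_smul' := fun c v => by ext i; simp
      invFun := fun u => ⟨fun i => if h : b i / θ ≤ t then u ⟨i, h⟩ else 0, by
        intro i hi
        exact dif_neg (not_le.mpr hi)⟩
      left_inv := fun v => by
        apply Subtype.ext
        ext i
        by_cases h : b i / θ ≤ t
        · simp [h]
        · simp [h, v.2 i (not_le.mp h)]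
      right_inv := fun u => by
        ext i
        simp [i.2] }
  have hV : Module.finrank ℂ V = (Finset.univ.filter fun j => b j / θ ≤ t).card := by
    rw [LinearEquiv.finrank_eq e, Module.finrank_fintype_fun_eq_card, Fintype.card_subtype]
  rw [← hV]
  refine finrank_le_card_of_form_le _ _ ((coord hA).comp (J.comp V.subtype)) fun w hw => ?_
  have hw' : w.1 ≠ 0 := fun h => hw (Subtype.ext h)
  have hpos := sqNorm_pos hw'
  have hn := hJ w.1
  have hq' := hq w.1
  rw [qf_eq_sum hA] at hq'
  have hs : sqNorm (coord hA (J w.1)) = sqNorm (J w.1) := sqNorm_coord hA _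
  constructor
  · intro h0
    change coord hA (J w.1) = 0 at h0
    rw [h0] at hs
    simp only [sqNorm, Pi.zero_apply, norm_zero] at hs hn hpos
    norm_num at hs
    rw [← hs] at hn
    nlinarith
  · change ∑ j, hA.eigenvalues j * ‖coord hA (J w.1) j‖ ^ 2 ≤ t * sqNorm (coord hA (J w.1))
    rw [hs]
    have ht : ∑ j, b j * ‖w.1 j‖ ^ 2 ≤ t * θ * sqNorm w.1 := by
      rw [sqNorm, Finset.mul_sum]
      refine Finset.sum_le_sum fun j _ => ?_
      by_cases h : b j / θ ≤ t
      · exact mul_le_mul_of_nonneg_right ((div_le_iff₀ hθ).mp h) (sq_nonneg _)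
      · simp [w.2 j (not_le.mp h)]
    -- Passing from `t θ ‖w‖²` to `t ‖J w‖²` requires `t ≥ 0`, which holds because the trial form is
    -- nonnegative.
    have ht0 : 0 ≤ t := by
      by_contra hneg
      have : 0 ≤ ∑ j, b j * ‖w.1 j‖ ^ 2 :=
        Finset.sum_nonneg fun j _ => mul_nonneg (hb j) (sq_nonneg _)
      have : t * θ * sqNorm w.1 < 0 := by
        have := mul_pos hθ hpos
        nlinarith
      linarith
    nlinarith

/-- The eigenvectors of `B` serve as trial states for `A`, with `θ = 1`. -/
theorem heatTrace_antitone {β : ℝ} (hβ : 0 ≤ β) {A B : Matrix ι ι ℂ} (hA : A.IsHermitian)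
    (hB : B.IsHermitian) (hA0 : ∀ v, 0 ≤ qf A v) (h : ∀ v, qf A v ≤ qf B v) :
    heatTrace β B ≤ heatTrace β A := by
  have hnn : ∀ j, 0 ≤ hB.eigenvalues j := by
    intro j
    have := (hA0 (uncoord hB (Pi.single j 1))).trans (h _)
    rw [qf_eq_sum hB, coord_uncoord] at this
    simpa [Pi.single_apply, apply_ite] using this
  rw [heatTrace_eq_sum β hB]
  have := sum_exp_le_heatTrace hβ hA hB.eigenvalues hnn one_pos (uncoord hB)
    (fun v => by rw [← sqNorm_coord hB (uncoord hB v), coord_uncoord, one_mul])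
    (fun v => (h _).trans (by rw [qf_eq_sum hB, coord_uncoord]))
  simpa using this

theorem mulVec_extend (A : Matrix ι ι ℂ) {f : κ → ι} (hf : Function.Injective f) (v : κ → ℂ) :
    qf A (Function.extend f v 0) = qf (A.submatrix f f) v := by
  have key : ∀ g : ι → ℂ, ∑ i, g i * Function.extend f v 0 i = ∑ k, g (f k) * v k := by
    intro g
    rw [← Finset.sum_subset (Finset.subset_univ (Finset.univ.image f)),
      Finset.sum_image fun x _ y _ h => hf h]
    · simp [hf.extend_apply]
    · intro i _ hi
      rw [Function.extend_apply', Pi.zero_apply, mul_zero]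
      rintro ⟨k, rfl⟩
      simp at hi
  have key2 : ∀ g : ι → ℂ, ∑ i, star (Function.extend f v 0 i) * g i = ∑ k, star (v k) * g (f k) := by
    intro g
    rw [← Finset.sum_subset (Finset.subset_univ (Finset.univ.image f)),
      Finset.sum_image fun x _ y _ h => hf h]
    · simp [hf.extend_apply]
    · intro i _ hi
      rw [Function.extend_apply', Pi.zero_apply, star_zero, zero_mul]
      rintro ⟨k, rfl⟩
      simp at hi
  simp only [qf, dotProduct, mulVec, Pi.star_apply, key, key2, submatrix_apply]

theorem sqNorm_extend {f : κ → ι} (hf : Function.Injective f) (v : κ → ℂ) :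
    sqNorm (Function.extend f v 0) = sqNorm v := by
  rw [sqNorm, ← Finset.sum_subset (Finset.subset_univ (Finset.univ.image f)),
      Finset.sum_image fun x _ y _ h => hf h]
  · simp [hf.extend_apply, sqNorm]
  · intro i _ hi
    rw [Function.extend_apply', Pi.zero_apply, norm_zero, zero_pow two_ne_zero]
    rintro ⟨k, rfl⟩
    simp at hi

/-- Extension by zero is isometric and carries the form of the compression to that of `A`; this is
Cauchy interlacing in summed form. -/
theorem heatTrace_submatrix_le {β : ℝ} (hβ : 0 ≤ β) {A : Matrix ι ι ℂ} (hA : A.IsHermitian)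
    (hA0 : ∀ v, 0 ≤ qf A v) {f : κ → ι} (hf : Function.Injective f) :
    heatTrace β (A.submatrix f f) ≤ heatTrace β A := by
  have hB : (A.submatrix f f).IsHermitian := hA.submatrix f
  have hq : ∀ v, qf A (Function.extend f v 0) = qf (A.submatrix f f) v := mulVec_extend A hf
  have hnn : ∀ j, 0 ≤ hB.eigenvalues j := by
    intro j
    have := hA0 (Function.extend f (uncoord hB (Pi.single j 1)) 0)
    rw [hq, qf_eq_sum hB, coord_uncoord] at this
    simpa [Pi.single_apply, apply_ite] using this
  let X : (κ → ℂ) →ₗ[ℂ] (ι → ℂ) :=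
    { toFun := fun v => Function.extend f v 0
      map_add' := fun v w => by
        ext i
        by_cases h : ∃ k, f k = i
        · obtain ⟨k, rfl⟩ := h
          simp [hf.extend_apply]
        · simp [Function.extend_apply' _ _ _ h]
      map_smul' := fun c v => by
        ext i
        by_cases h : ∃ k, f k = i
        · obtain ⟨k, rfl⟩ := h
          simp [hf.extend_apply]
        · simp [Function.extend_apply' _ _ _ h] }
  rw [heatTrace_eq_sum β hB]
  have := sum_exp_le_heatTrace hβ hA hB.eigenvalues hnn one_pos (X.comp (uncoord hB))
    (fun v => by
      rw [one_mul]
      change _ ≤ sqNorm (Function.extend f (uncoord hB v) 0)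
      rw [sqNorm_extend hf, ← sqNorm_coord hB (uncoord hB v), coord_uncoord])
    (fun v => by
      change qf A (Function.extend f (uncoord hB v) 0) ≤ _
      rw [hq, qf_eq_sum hB, coord_uncoord])
  simpa using this

open scoped Kronecker in
theorem heatTrace_kronecker (β : ℝ) {A : Matrix ι ι ℂ} {B : Matrix κ κ ℂ} (hA : A.IsHermitian)
    (hB : B.IsHermitian) :
    heatTrace β (A ⊗ₖ (1 : Matrix κ κ ℂ) + (1 : Matrix ι ι ℂ) ⊗ₖ B) =
      heatTrace β A * heatTrace β B := by
  let W : Matrix (ι × κ) (ι × κ) ℂ :=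
    (hA.eigenvectorUnitary : Matrix ι ι ℂ) ⊗ₖ (hB.eigenvectorUnitary : Matrix κ κ ℂ)
  let W' : Matrix (ι × κ) (ι × κ) ℂ :=
    star (hA.eigenvectorUnitary : Matrix ι ι ℂ) ⊗ₖ star (hB.eigenvectorUnitary : Matrix κ κ ℂ)
  let u : (Matrix (ι × κ) (ι × κ) ℂ)ˣ := ⟨W, W', by
      simp only [W, W', ← mul_kronecker_mul]
      rw [eigenvectorUnitary_mul_star, eigenvectorUnitary_mul_star, one_kronecker_one], by
      simp only [W, W', ← mul_kronecker_mul]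
      rw [star_mul_eigenvectorUnitary, star_mul_eigenvectorUnitary, one_kronecker_one]⟩
  have h : -(β : ℂ) • (A ⊗ₖ (1 : Matrix κ κ ℂ) + (1 : Matrix ι ι ℂ) ⊗ₖ B) = (u : Matrix _ _ ℂ) *
      diagonal (fun p : ι × κ => -(β : ℂ) * (hA.eigenvalues p.1 + hB.eigenvalues p.2 : ℂ)) *
      ((u⁻¹ : (Matrix (ι × κ) (ι × κ) ℂ)ˣ) : Matrix _ _ ℂ) := by
    have h2 : diagonal (fun p : ι × κ =>
          -(β : ℂ) * (hA.eigenvalues p.1 + hB.eigenvalues p.2 : ℂ)) =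
        -(β : ℂ) • (diagonal (fun i => (hA.eigenvalues i : ℂ)) ⊗ₖ (1 : Matrix κ κ ℂ) +
          (1 : Matrix ι ι ℂ) ⊗ₖ diagonal (fun i => (hB.eigenvalues i : ℂ))) := by
      rw [← diagonal_one, ← diagonal_one, diagonal_kronecker_diagonal,
        diagonal_kronecker_diagonal, diagonal_add, ← diagonal_smul]
      congr 1
      ext p
      simp
    rw [h2, Matrix.mul_smul, Matrix.smul_mul]
    congr 1
    change _ = W * _ * W'
    simp only [W, W', mul_add, add_mul, ← mul_kronecker_mul, mul_one]
    rw [eigenvectorUnitary_mul_star, eigenvectorUnitary_mul_star, ← eq_conj_diagonal hA, ← eq_conj_diagonal hB]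
  rw [heatTrace, h, Matrix.exp_units_conj, Matrix.trace_mul_comm, ← mul_assoc, Units.inv_mul,
    one_mul, Matrix.exp_diagonal, Matrix.trace_diagonal, Complex.re_sum, heatTrace_eq_sum β hA,
    heatTrace_eq_sum β hB, Finset.sum_mul_sum, Fintype.sum_prod_type]
  refine Finset.sum_congr rfl fun i _ => Finset.sum_congr rfl fun j _ => ?_
  rw [Pi.coe_exp, ← Complex.exp_eq_exp_ℂ, ← Complex.ofReal_neg, ← Complex.ofReal_add,
    ← Complex.ofReal_mul, Complex.exp_ofReal_re, ← Real.exp_add]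
  congr 1
  ring

theorem qf_add (A B : Matrix ι ι ℂ) (v : ι → ℂ) : qf (A + B) v = qf A v + qf B v := by
  simp [qf, add_mulVec, dotProduct_add]

theorem qf_sum {σ : Type*} (s : Finset σ) (A : σ → Matrix ι ι ℂ) (v : ι → ℂ) :
    qf (∑ i ∈ s, A i) v = ∑ i ∈ s, qf (A i) v := by
  classical
  induction s using Finset.induction_on with
  | empty => simp [qf]
  | insert a s ha ih => rw [Finset.sum_insert ha, Finset.sum_insert ha, qf_add, ih]

end Spectral
end HeisenbergChain
end

noncomputable section

namespace HeisenbergChain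

open Matrix

/-! ### Operators on one site of a chain. -/

section SiteOperators

variable {N L : ℕ}

theorem siteOp_mulVec (A : Matrix (Fin (N + 1)) (Fin (N + 1)) ℂ) (x : Fin L) (ψ : Config N L → ℂ)
    (s : Config N L) :
    (siteOp N L A x *ᵥ ψ) s = ∑ a, A (s x) a * ψ (Function.update s x a) := by
  have hinj : Function.Injective fun a => Function.update s x a := Function.update_injective s x
  simp only [mulVec, dotProduct, siteOp, of_apply]
  rw [← Finset.sum_subset (Finset.subset_univ (Finset.univ.image fun a => Function.update s x a)),
    Finset.sum_image fun a _ b _ h => hinj h]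
  · refine Finset.sum_congr rfl fun a _ => ?_
    rw [if_pos fun y hy => by rw [Function.update_of_ne hy], Function.update_self]
  · intro t _ ht
    rw [if_neg, zero_mul]
    intro h
    apply ht
    refine Finset.mem_image.mpr ⟨t x, Finset.mem_univ _, ?_⟩
    ext y
    by_cases hy : y = x
    · subst hy; simp
    · rw [Function.update_of_ne hy, h y hy]

theorem matrix_ext_mulVec {ι : Type*} [Fintype ι] [DecidableEq ι] {A B : Matrix ι ι ℂ}
    (h : ∀ v i, (A *ᵥ v) i = (B *ᵥ v) i) : A = B := by
  ext i j
  have := h (Pi.single j 1) i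
  simpa [mulVec_single_one] using this

theorem siteOp_add (A B : Matrix (Fin (N + 1)) (Fin (N + 1)) ℂ) (x : Fin L) :
    siteOp N L (A + B) x = siteOp N L A x + siteOp N L B x := by
  ext s t
  simp only [siteOp, of_apply, Matrix.add_apply]
  split_ifs <;> simp

theorem siteOp_smul (c : ℂ) (A : Matrix (Fin (N + 1)) (Fin (N + 1)) ℂ) (x : Fin L) :
    siteOp N L (c • A) x = c • siteOp N L A x := by
  ext s t
  simp only [siteOp, of_apply, Matrix.smul_apply]
  split_ifs <;> simp

theorem siteOp_sub (A B : Matrix (Fin (N + 1)) (Fin (N + 1)) ℂ) (x : Fin L) :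
    siteOp N L (A - B) x = siteOp N L A x - siteOp N L B x := by
  ext s t
  simp only [siteOp, of_apply, Matrix.sub_apply]
  split_ifs <;> simp

theorem siteOp_one (x : Fin L) : siteOp N L 1 x = 1 := by
  refine matrix_ext_mulVec fun v s => ?_
  rw [siteOp_mulVec, one_mulVec]
  simp [one_apply]

theorem siteOp_mul (A B : Matrix (Fin (N + 1)) (Fin (N + 1)) ℂ) (x : Fin L) :
    siteOp N L A x * siteOp N L B x = siteOp N L (A * B) x := by
  refine matrix_ext_mulVec fun v s => ?_
  rw [← mulVec_mulVec]
  simp only [siteOp_mulVec, Function.update_self, Function.update_idem, mul_apply, Finset.sum_mul,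
    Finset.mul_sum]
  rw [Finset.sum_comm]
  simp only [mul_assoc]

theorem siteOp_comm (A B : Matrix (Fin (N + 1)) (Fin (N + 1)) ℂ) {x y : Fin L} (hxy : x ≠ y) :
    siteOp N L A x * siteOp N L B y = siteOp N L B y * siteOp N L A x := by
  refine matrix_ext_mulVec fun v s => ?_
  rw [← mulVec_mulVec, ← mulVec_mulVec]
  simp only [siteOp_mulVec, Function.update_of_ne hxy.symm, Function.update_of_ne hxy,
    Finset.mul_sum]
  rw [Finset.sum_comm]
  refine Finset.sum_congr rfl fun a _ => Finset.sum_congr rfl fun b _ => ?_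
  rw [Function.update_comm hxy, mul_left_comm]

theorem siteOp_conjTranspose (A : Matrix (Fin (N + 1)) (Fin (N + 1)) ℂ) (x : Fin L) :
    (siteOp N L A x)ᴴ = siteOp N L Aᴴ x := by
  ext s t
  simp only [siteOp, of_apply, conjTranspose_apply]
  by_cases h : ∀ y, y ≠ x → s y = t y
  · rw [if_pos h, if_pos fun y hy => (h y hy).symm]
  · rw [if_neg h, if_neg fun h' => h fun y hy => (h' y hy).symm, star_zero]

/-- The third spin component for spin `N/2`. -/
def spinThree (N : ℕ) : Matrix (Fin (N + 1)) (Fin (N + 1)) ℂ :=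
  Matrix.diagonal fun n => (n : ℂ) - (N : ℂ) / 2

theorem spinMatrix_zero (N : ℕ) : spinMatrix N 0 = (1 / 2 : ℂ) • (spinPlus N + spinMinus N) := rfl

theorem spinMatrix_one (N : ℕ) :
    spinMatrix N 1 = (1 / (2 * Complex.I)) • (spinPlus N - spinMinus N) := rfl

theorem spinMatrix_two (N : ℕ) : spinMatrix N 2 = spinThree N := rfl

theorem spinDot_eq (x y : Fin L) :
    spinDot N L x y = siteOp N L (spinThree N) x * siteOp N L (spinThree N) y +
      (1 / 2 : ℂ) • (siteOp N L (spinPlus N) x * siteOp N L (spinMinus N) y +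
        siteOp N L (spinMinus N) x * siteOp N L (spinPlus N) y) := by
  simp only [spinDot, Fin.sum_univ_three, spinMatrix_zero, spinMatrix_one, spinMatrix_two,
    siteOp_add, siteOp_sub, siteOp_smul]
  simp only [smul_mul_smul_comm, mul_add, add_mul, mul_sub, sub_mul, smul_add, smul_sub]
  have h : (1 / (2 * Complex.I)) * (1 / (2 * Complex.I)) = (-1 / 4 : ℂ) := by
    field_simp
    rw [Complex.I_sq]
    norm_num
  rw [h]
  module

theorem spinThree_mulVec (x : Fin L) (ψ : Config N L → ℂ) (s : Config N L) :
    (siteOp N L (spinThree N) x *ᵥ ψ) s = (((s x : ℕ) : ℂ) - (N : ℂ) / 2) * ψ s := by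
  rw [siteOp_mulVec]
  simp [spinThree, diagonal_apply]

/-- The subtraction `s x - 1` is cyclic, but the square root vanishes at `s x = 0`, so the wrapped
value never contributes. This allows hops to be permutations of all configurations. -/
theorem spinPlus_mulVec (x : Fin L) (ψ : Config N L → ℂ) (s : Config N L) :
    (siteOp N L (spinPlus N) x *ᵥ ψ) s =
      (Real.sqrt (((s x : ℕ) : ℝ) * ((N : ℝ) + 1 - (s x : ℕ))) : ℝ) *
        ψ (Function.update s x (s x - 1)) := by
  rw [siteOp_mulVec]
  by_cases h0 : s x = 0
  · rw [Finset.sum_eq_zero]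
    · simp [h0]
    · intro a _
      simp [spinPlus, h0]
  · have hv : ((s x - 1 : Fin (N + 1)) : ℕ) = (s x : ℕ) - 1 := Fin.val_sub_one_of_ne_zero h0
    have hpos : 0 < (s x : ℕ) := Fin.pos_iff_ne_zero.mpr h0
    rw [Finset.sum_eq_single (s x - 1)]
    · simp only [spinPlus, of_apply, hv]
      rw [if_pos (by omega), Nat.cast_sub (by omega)]
      congr 3
      push_cast
      ring_nf
    · intro a _ ha
      simp only [spinPlus, of_apply]
      rw [if_neg, zero_mul]
      intro h
      apply ha
      ext
      rw [hv, h]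
      omega
    · simp

theorem spinMinus_mulVec (x : Fin L) (ψ : Config N L → ℂ) (s : Config N L) :
    (siteOp N L (spinMinus N) x *ᵥ ψ) s =
      (Real.sqrt ((((s x : ℕ) : ℝ) + 1) * ((N : ℝ) - (s x : ℕ))) : ℝ) *
        ψ (Function.update s x (s x + 1)) := by
  rw [siteOp_mulVec]
  by_cases h0 : s x = Fin.last N
  · rw [Finset.sum_eq_zero]
    · simp [h0]
    · intro a _
      simp only [spinMinus, spinPlus, h0, conjTranspose_apply, of_apply]
      rw [if_neg]
      · simp
      · rw [Fin.val_last]; omega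
  · have hlt : s x < Fin.last N := lt_of_le_of_ne (Fin.le_last _) h0
    have hv : ((s x + 1 : Fin (N + 1)) : ℕ) = (s x : ℕ) + 1 := Fin.val_add_one_of_lt hlt
    rw [Finset.sum_eq_single (s x + 1)]
    · simp only [spinMinus, spinPlus, conjTranspose_apply, of_apply, hv]
      simp
    · intro a _ ha
      simp only [spinMinus, spinPlus, conjTranspose_apply, of_apply]
      rw [if_neg]
      · simp
      · intro h
        apply ha
        ext
        rw [hv, h]
    · simp

end SiteOperators

/-! ### The bond term as the Dirichlet form of a reversible hopping process. -/

section Bond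

/-- The bond term `S² - S⃗_x · S⃗_y`. -/
def bond (N L : ℕ) (x y : Fin L) : Matrix (Config N L) (Config N L) ℂ :=
  ((N : ℂ) / 2) ^ 2 • (1 : Matrix (Config N L) (Config N L) ℂ) - spinDot N L x y

variable {N L : ℕ}

theorem hamiltonian_eq (N L : ℕ) : hamiltonian N L =
    ∑ x : Fin (L - 1), bond N L ⟨(x : ℕ), by omega⟩ ⟨(x : ℕ) + 1, by omega⟩ := rfl

/-- Move one particle from `x` to `y` (cyclically in the occupation numbers). -/
def hop (x y : Fin L) (s : Config N L) : Config N L :=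
  Function.update (Function.update s x (s x - 1)) y (s y + 1)

theorem hop_apply_left {x y : Fin L} (hxy : x ≠ y) (s : Config N L) : hop x y s x = s x - 1 := by
  rw [hop, Function.update_of_ne hxy, Function.update_self]

theorem hop_apply_right (x y : Fin L) (s : Config N L) : hop x y s y = s y + 1 := by
  rw [hop, Function.update_self]

theorem hop_apply_of_ne {x y z : Fin L} (hx : z ≠ x) (hy : z ≠ y) (s : Config N L) :
    hop x y s z = s z := by
  rw [hop, Function.update_of_ne hy, Function.update_of_ne hx]

theorem hop_hop {x y : Fin L} (hxy : x ≠ y) (s : Config N L) : hop y x (hop x y s) = s := by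
  ext z
  by_cases hx : z = x
  · subst hx
    rw [hop_apply_right, hop_apply_left hxy, sub_add_cancel]
  by_cases hy : z = y
  · subst hy
    rw [hop_apply_left hxy.symm, hop_apply_right, add_sub_cancel_right]
  rw [hop_apply_of_ne hy hx, hop_apply_of_ne hx hy]

/-- `hop` as a permutation of configurations. -/
def hopEquiv {x y : Fin L} (hxy : x ≠ y) : Config N L ≃ Config N L where
  toFun := hop x y
  invFun := hop y x
  left_inv := hop_hop hxy
  right_inv := hop_hop hxy.symm

/-- The hopping amplitude. -/
def amp (x y : Fin L) (s : Config N L) : ℝ :=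
  Real.sqrt (((s x : ℕ) : ℝ) * ((N : ℝ) + 1 - (s x : ℕ))) *
    Real.sqrt ((((s y : ℕ) : ℝ) + 1) * ((N : ℝ) - (s y : ℕ)))

/-- For occupation numbers `a`, `b` the diagonal part is `N²/4 - (a - N/2)(b - N/2) = (a (N - b) + b
(N - a)) / 2`, half the sum of the two hopping rates. This balance is what makes the bond a
Dirichlet form. -/
theorem bond_mulVec {x y : Fin L} (hxy : x ≠ y) (ψ : Config N L → ℂ) (s : Config N L) :
    (bond N L x y *ᵥ ψ) s =
      ((1 / 2 * ((s x : ℕ) * ((N : ℝ) - (s y : ℕ)) + (s y : ℕ) * ((N : ℝ) - (s x : ℕ))) : ℝ) : ℂ) *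
        ψ s - (1 / 2 : ℂ) * (amp x y s * ψ (hop x y s) + amp y x s * ψ (hop y x s)) := by
  rw [bond, spinDot_eq, siteOp_comm (spinMinus N) (spinPlus N) hxy]
  simp only [sub_mulVec, add_mulVec, smul_mulVec, Pi.sub_apply, Pi.add_apply, Pi.smul_apply,
    one_mulVec, ← mulVec_mulVec, spinThree_mulVec, spinPlus_mulVec, spinMinus_mulVec,
    Function.update_of_ne hxy, Function.update_of_ne hxy.symm, smul_eq_mul]
  rw [amp, amp, hop, hop]
  push_cast
  ring

theorem bond_isHermitian {x y : Fin L} (hxy : x ≠ y) : (bond N L x y).IsHermitian := by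
  have h3 : (spinThree N)ᴴ = spinThree N := by
    rw [spinThree, diagonal_conjTranspose]
    congr 1
    ext n
    simp
  have hm : (spinMinus N)ᴴ = spinPlus N := by rw [spinMinus, conjTranspose_conjTranspose]
  have hp : (spinPlus N)ᴴ = spinMinus N := rfl
  rw [IsHermitian, bond, spinDot_eq]
  simp only [conjTranspose_sub, conjTranspose_add, conjTranspose_smul, conjTranspose_mul,
    siteOp_conjTranspose, h3, hm, hp, conjTranspose_one]
  rw [siteOp_comm _ _ hxy.symm, siteOp_comm _ _ hxy.symm, siteOp_comm _ _ hxy.symm]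
  congr 2
  · simp
  · simp [add_comm]

/-- The number of spin-`1/2` configurations with a given profile. -/
def weight (s : Config N L) : ℝ := ∏ z, (N.choose (s z) : ℝ)

theorem weight_pos (s : Config N L) : 0 < weight s :=
  Finset.prod_pos fun z _ => by exact_mod_cast Nat.choose_pos (Nat.lt_succ_iff.mp (s z).2)

theorem weight_update (s : Config N L) (x : Fin L) (a : Fin (N + 1)) :
    weight (Function.update s x a) * (N.choose (s x) : ℝ) = weight s * (N.choose a : ℝ) := by
  classical
  rw [weight, weight, ← Finset.mul_prod_erase _ _ (Finset.mem_univ x),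
    ← Finset.mul_prod_erase _ (fun z => (N.choose (s z) : ℝ)) (Finset.mem_univ x),
    Function.update_self]
  rw [Finset.prod_congr rfl fun z hz => by
    rw [Function.update_of_ne (Finset.ne_of_mem_erase hz)]]
  ring

/-- The rate of the move of a particle from `x` to `y`. -/
def rate (x y : Fin L) (s : Config N L) : ℝ :=
  weight s * ((s x : ℕ) * ((N : ℝ) - (s y : ℕ)))

theorem cast_le_N (a : Fin (N + 1)) : ((a : ℕ) : ℝ) ≤ N := by
  exact_mod_cast Nat.lt_succ_iff.mp a.2

theorem rate_nonneg (x y : Fin L) (s : Config N L) : 0 ≤ rate x y s :=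
  mul_nonneg (weight_pos s).le (mul_nonneg (Nat.cast_nonneg _) (sub_nonneg.mpr (cast_le_N _)))

/-- Two uses of `k C(N, k) = (N + 1 - k) C(N, k - 1)`, one at each site. -/
theorem rate_eq {x y : Fin L} (hxy : x ≠ y) (s : Config N L) (hx : s x ≠ 0)
    (hy : s y ≠ Fin.last N) :
    rate x y s = weight (hop x y s) * ((((s y : ℕ) : ℝ) + 1) * ((N : ℝ) + 1 - (s x : ℕ))) := by
  have hv : ((s x - 1 : Fin (N + 1)) : ℕ) = (s x : ℕ) - 1 := Fin.val_sub_one_of_ne_zero hx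
  have hw : ((s y + 1 : Fin (N + 1)) : ℕ) = (s y : ℕ) + 1 :=
    Fin.val_add_one_of_lt (lt_of_le_of_ne (Fin.le_last _) hy)
  have hpos : 0 < (s x : ℕ) := Fin.pos_iff_ne_zero.mpr hx
  have hxN : (s x : ℕ) ≤ N := Nat.lt_succ_iff.mp (s x).2
  have hyN : (s y : ℕ) ≤ N := Nat.lt_succ_iff.mp (s y).2
  have h1 := weight_update s x (s x - 1)
  have h2 := weight_update (Function.update s x (s x - 1)) y (s y + 1)
  rw [Function.update_of_ne hxy.symm] at h2
  rw [hv] at h1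
  rw [hw] at h2
  have c1 : (N.choose (s x) : ℝ) * (s x : ℕ) =
      (N.choose ((s x : ℕ) - 1) : ℝ) * ((N : ℝ) + 1 - (s x : ℕ)) := by
    have := Nat.choose_succ_right_eq N ((s x : ℕ) - 1)
    rw [Nat.sub_add_cancel hpos] at this
    have h' : N - ((s x : ℕ) - 1) = N + 1 - (s x : ℕ) := by omega
    rw [h'] at this
    have h3 : ((N + 1 - (s x : ℕ) : ℕ) : ℝ) = (N : ℝ) + 1 - (s x : ℕ) := by
      rw [Nat.cast_sub (by omega)]; push_cast; ring
    rw [← h3]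
    exact_mod_cast this
  have c2 : (N.choose ((s y : ℕ) + 1) : ℝ) * ((s y : ℕ) + 1) =
      (N.choose (s y : ℕ) : ℝ) * ((N : ℝ) - (s y : ℕ)) := by
    have := Nat.choose_succ_right_eq N (s y : ℕ)
    rw [← Nat.cast_sub hyN]
    exact_mod_cast this
  have p1 : (0 : ℝ) < N.choose (s x) := by exact_mod_cast Nat.choose_pos hxN
  have p2 : (0 : ℝ) < N.choose (s y) := by exact_mod_cast Nat.choose_pos hyN
  have p3 : (0 : ℝ) < N.choose ((s x : ℕ) - 1) := by exact_mod_cast Nat.choose_pos (by omega)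
  rw [rate, hop]
  set W0 := weight s
  set W1 := weight (Function.update s x (s x - 1))
  set W2 := weight (Function.update (Function.update s x (s x - 1)) y (s y + 1))
  apply mul_right_cancel₀ (mul_pos p1 p2).ne'
  calc W0 * ((s x : ℕ) * ((N : ℝ) - (s y : ℕ))) * ((N.choose (s x)) * (N.choose (s y)))
      = W0 * ((N.choose (s x) : ℝ) * (s x : ℕ)) * ((N.choose (s y : ℕ) : ℝ) * ((N : ℝ) - (s y : ℕ))) := by
        ring
    _ = (W0 * (N.choose ((s x : ℕ) - 1) : ℝ)) * ((N : ℝ) + 1 - (s x : ℕ)) *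
        ((N.choose ((s y : ℕ) + 1) : ℝ) * ((s y : ℕ) + 1)) := by rw [c1, c2]; ring
    _ = (W1 * (N.choose ((s y : ℕ) + 1) : ℝ)) * ((N.choose (s x) : ℝ)) *
        ((N : ℝ) + 1 - (s x : ℕ)) * ((s y : ℕ) + 1) := by rw [← h1]; ring
    _ = _ := by rw [← h2]; ring

/-- Detailed balance: the product of binomial coefficients is a reversible measure for the hopping.
Where a hop wraps around cyclically, both rates are zero. -/
theorem rate_hop {x y : Fin L} (hxy : x ≠ y) (s : Config N L) :
    rate y x (hop x y s) = rate x y s := by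
  by_cases hx : s x = 0
  · have : rate x y s = 0 := by simp [rate, hx]
    rw [this, rate, hop_apply_left hxy, hx]
    have h0 : ((0 - 1 : Fin (N + 1)) : ℕ) = N := by simp
    rw [h0]
    simp
  by_cases hy : s y = Fin.last N
  · have : rate x y s = 0 := by simp [rate, hy]
    rw [this, rate, hop_apply_right, hy]
    simp
  rw [rate_eq hxy s hx hy, rate, hop_apply_left hxy, hop_apply_right,
    Fin.val_sub_one_of_ne_zero hx,
    Fin.val_add_one_of_lt (lt_of_le_of_ne (Fin.le_last _) hy)]
  have hpos : 0 < (s x : ℕ) := Fin.pos_iff_ne_zero.mpr hx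
  rw [Nat.cast_sub (by omega)]
  push_cast
  ring

/-- The square of the left side is the product of two expressions for the rate, its definition and
the one in `rate_eq`. Conjugation by `√weight` thus turns matrix elements into rates. -/
theorem amp_mul_sqrt {x y : Fin L} (hxy : x ≠ y) (s : Config N L) :
    amp x y s * Real.sqrt (weight s) * Real.sqrt (weight (hop x y s)) = rate x y s := by
  by_cases hx : s x = 0
  · simp [rate, amp, hx]
  by_cases hy : s y = Fin.last N
  · simp [rate, amp, hy]
  have hxN := cast_le_N (s x)
  have hyN := cast_le_N (s y)
  rw [amp, ← Real.sqrt_mul (by apply mul_nonneg <;> [positivity; linarith]),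
    ← Real.sqrt_mul (mul_nonneg (mul_nonneg (by positivity) (by linarith))
      (mul_nonneg (by positivity) (by linarith))),
    ← Real.sqrt_mul (mul_nonneg (mul_nonneg (mul_nonneg (by positivity) (by linarith))
      (mul_nonneg (by positivity) (by linarith))) (weight_pos _).le)]
  rw [← Real.sqrt_sq (rate_nonneg x y s)]
  congr 1
  rw [sq]
  nth_rewrite 2 [rate_eq hxy s hx hy]
  rw [rate]
  ring

/-- The amplitude relative to the square root of the weight. -/
def relAmp (ψ : Config N L → ℂ) (s : Config N L) : ℂ := ψ s / (Real.sqrt (weight s) : ℝ)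

theorem eq_sqrt_mul_relAmp (ψ : Config N L → ℂ) (s : Config N L) :
    ψ s = (Real.sqrt (weight s) : ℝ) * relAmp ψ s := by
  have : ((Real.sqrt (weight s) : ℝ) : ℂ) ≠ 0 := by
    exact_mod_cast (Real.sqrt_pos.mpr (weight_pos s)).ne'
  rw [relAmp]
  field_simp

theorem norm_sq_relAmp (ψ : Config N L → ℂ) (s : Config N L) :
    weight s * ‖relAmp ψ s‖ ^ 2 = ‖ψ s‖ ^ 2 := by
  rw [eq_sqrt_mul_relAmp ψ s, norm_mul, mul_pow, Complex.norm_real, Real.norm_eq_abs, sq_abs,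
    Real.sq_sqrt (weight_pos s).le]

/-- The form of a bond term as a Dirichlet form. -/
theorem qf_bond {x y : Fin L} (hxy : x ≠ y) (ψ : Config N L → ℂ) :
    qf (bond N L x y) ψ =
      1 / 2 * ∑ s, rate x y s * ‖relAmp ψ s - relAmp ψ (hop x y s)‖ ^ 2 := by
  set f := relAmp ψ with hf
  have hsub : ∀ a b : ℂ, ‖a - b‖ ^ 2 = ‖a‖ ^ 2 + ‖b‖ ^ 2 - 2 * (star a * b).re := by
    intro a b
    rw [← Complex.normSq_eq_norm_sq, ← Complex.normSq_eq_norm_sq, ← Complex.normSq_eq_norm_sq,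
      Complex.normSq_sub]
    congr 2
    rw [← Complex.conj_re]
    simp [mul_comm]
  have hcross : ∀ {x y : Fin L}, x ≠ y → ∀ s : Config N L,
      (star (ψ s) * (amp x y s * ψ (hop x y s))).re = rate x y s * (star (f s) * f (hop x y s)).re := by
    intro x y hxy s
    rw [eq_sqrt_mul_relAmp ψ s, eq_sqrt_mul_relAmp ψ (hop x y s), ← amp_mul_sqrt hxy s,
      ← Complex.re_ofReal_mul]
    congr 1
    rw [star_mul', RCLike.star_def, Complex.conj_ofReal]
    push_cast
    ring
  have hdiag : ∀ s : Config N L, (star (ψ s) * (((1 / 2 * ((s x : ℕ) * ((N : ℝ) - (s y : ℕ)) +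
      (s y : ℕ) * ((N : ℝ) - (s x : ℕ))) : ℝ) : ℂ) * ψ s)).re =
      1 / 2 * (rate x y s * ‖f s‖ ^ 2 + rate y x s * ‖f s‖ ^ 2) := by
    intro s
    rw [mul_left_comm, RCLike.star_def, Complex.conj_mul', ← Complex.ofReal_pow,
      ← Complex.ofReal_mul, Complex.ofReal_re, ← norm_sq_relAmp, rate, rate]
    ring
  have hterm : ∀ s : Config N L, (star (ψ s) * (bond N L x y *ᵥ ψ) s).re =
      1 / 2 * (rate x y s * ‖f s‖ ^ 2 + rate y x s * ‖f s‖ ^ 2) -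
      1 / 2 * (rate x y s * (star (f s) * f (hop x y s)).re +
        rate y x s * (star (f s) * f (hop y x s)).re) := by
    intro s
    rw [bond_mulVec hxy, mul_sub, Complex.sub_re, hdiag]
    congr 1
    rw [mul_left_comm, mul_add, ← hcross hxy, ← hcross hxy.symm, ← Complex.add_re,
      ← Complex.re_ofReal_mul]
    congr 2
    push_cast
    rfl
  -- The permutation `hopEquiv` exchanges the two directions of hopping by `rate_hop`, so the
  -- backward half of the form equals the forward half.
  have hre1 : ∑ s : Config N L, rate y x s * ‖f s‖ ^ 2 = ∑ s, rate x y s * ‖f (hop x y s)‖ ^ 2 := by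
    rw [← Equiv.sum_comp (hopEquiv hxy)]
    refine Finset.sum_congr rfl fun s _ => ?_
    change rate y x (hop x y s) * _ = _
    rw [rate_hop hxy]
    rfl
  have hre2 : ∑ s : Config N L, rate y x s * (star (f s) * f (hop y x s)).re =
      ∑ s, rate x y s * (star (f s) * f (hop x y s)).re := by
    rw [← Equiv.sum_comp (hopEquiv hxy)]
    refine Finset.sum_congr rfl fun s _ => ?_
    change rate y x (hop x y s) * (star (f (hop x y s)) * f (hop y x (hop x y s))).re = _
    rw [rate_hop hxy, hop_hop hxy]
    congr 1
    rw [← Complex.conj_re]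
    simp [mul_comm]
  have hqf : qf (bond N L x y) ψ = ∑ s, (star (ψ s) * (bond N L x y *ᵥ ψ) s).re := by
    simp only [qf, dotProduct, Complex.re_sum, Pi.star_apply]
  rw [hqf, Finset.sum_congr rfl fun s _ => hterm s, Finset.sum_sub_distrib, ← Finset.mul_sum,
    ← Finset.mul_sum, Finset.sum_add_distrib, Finset.sum_add_distrib, hre1, hre2]
  simp only [hsub, mul_sub, mul_add, Finset.sum_sub_distrib, Finset.sum_add_distrib]
  have : ∑ s : Config N L, rate x y s * (2 * (star (f s) * f (hop x y s)).re) =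
      2 * ∑ s : Config N L, rate x y s * (star (f s) * f (hop x y s)).re := by
    rw [Finset.mul_sum]
    exact Finset.sum_congr rfl fun s _ => by ring
  rw [this]
  ring

theorem qf_bond_nonneg {x y : Fin L} (hxy : x ≠ y) (ψ : Config N L → ℂ) :
    0 ≤ qf (bond N L x y) ψ := by
  rw [qf_bond hxy]
  exact mul_nonneg (by norm_num) (Finset.sum_nonneg fun s _ =>
    mul_nonneg (rate_nonneg _ _ _) (sq_nonneg _))

/-- Neither site has a particle to give, so the diagonal part and both amplitudes vanish. This
decouples chains that meet at empty end sites. -/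
theorem bond_apply_of_zero {x y : Fin L} (hxy : x ≠ y) {s : Config N L} (hx : s x = 0)
    (hy : s y = 0) (t : Config N L) : bond N L x y s t = 0 := by
  have := bond_mulVec hxy (Pi.single t 1) s
  rw [mulVec_single_one, col_apply] at this
  rw [this, amp, amp, hx, hy]
  simp

theorem left_ne_right {n m : ℕ} (x : Fin n) (h : (x : ℕ) < m) (h' : (x : ℕ) + 1 < m) :
    (⟨x, h⟩ : Fin m) ≠ ⟨(x : ℕ) + 1, h'⟩ := by
  intro h
  have := congrArg Fin.val h
  simp at this

theorem hamiltonian_isHermitian (N L : ℕ) : (hamiltonian N L).IsHermitian := by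
  rw [hamiltonian_eq]
  exact isSelfAdjoint_sum _ fun x _ => bond_isHermitian (left_ne_right _ _ _)

theorem qf_hamiltonian (ψ : Config N L → ℂ) : qf (hamiltonian N L) ψ =
    ∑ x : Fin (L - 1), qf (bond N L ⟨(x : ℕ), by omega⟩ ⟨(x : ℕ) + 1, by omega⟩) ψ := by
  rw [hamiltonian_eq, qf_sum]

theorem qf_hamiltonian_nonneg (ψ : Config N L → ℂ) : 0 ≤ qf (hamiltonian N L) ψ := by
  rw [qf_hamiltonian]
  exact Finset.sum_nonneg fun x _ => qf_bond_nonneg (left_ne_right _ _ _) ψ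

end Bond

end HeisenbergChain
end

noncomputable section

namespace HeisenbergChain

open Matrix
open scoped Kronecker

/-! ### Cutting and joining chains. -/

section Additivity

variable {N : ℕ}

/-- Concatenation of configurations. -/
def joinConfig (N a b : ℕ) : Config N a × Config N b ≃ Config N (a + b) := Fin.appendEquiv a b

theorem joinConfig_left {a b : ℕ} (p : Config N a × Config N b) (x : Fin a) :
    joinConfig N a b p (Fin.castAdd b x) = p.1 x := Fin.append_left _ _ _

theorem joinConfig_right {a b : ℕ} (p : Config N a × Config N b) (x : Fin b) :
    joinConfig N a b p (Fin.natAdd a x) = p.2 x := Fin.append_right _ _ _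

theorem siteOp_castAdd {a b : ℕ} (A : Matrix (Fin (N + 1)) (Fin (N + 1)) ℂ) (x : Fin a) :
    (siteOp N (a + b) A (Fin.castAdd b x)).submatrix (joinConfig N a b) (joinConfig N a b) =
      siteOp N a A x ⊗ₖ (1 : Matrix (Config N b) (Config N b) ℂ) := by
  ext p q
  simp only [submatrix_apply, siteOp, of_apply, kroneckerMap_apply, joinConfig_left, one_apply]
  have h : (∀ y, y ≠ Fin.castAdd b x → joinConfig N a b p y = joinConfig N a b q y) ↔
      (∀ y, y ≠ x → p.1 y = q.1 y) ∧ p.2 = q.2 := by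
    constructor
    · intro h
      refine ⟨fun y hy => ?_, ?_⟩
      · have := h (Fin.castAdd b y) (fun hc => hy (Fin.castAdd_injective _ _ hc))
        rwa [joinConfig_left, joinConfig_left] at this
      · ext y
        have := h (Fin.natAdd a y) (fun hc => by
          have := congrArg Fin.val hc; simp at this; omega)
        rw [joinConfig_right, joinConfig_right] at this
        rw [this]
    · rintro ⟨h1, h2⟩ y hy
      refine Fin.addCases (fun z hz => ?_) (fun z _ => ?_) y hy
      · rw [joinConfig_left, joinConfig_left, h1 z (fun hc => hz (by rw [hc]))]
      · rw [joinConfig_right, joinConfig_right, h2]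
  by_cases h1 : ∀ y, y ≠ x → p.1 y = q.1 y
  · by_cases h2 : p.2 = q.2
    · rw [if_pos (h.mpr ⟨h1, h2⟩), if_pos h1, if_pos h2, mul_one]
    · rw [if_neg fun hc => h2 (h.mp hc).2, if_neg h2, mul_zero]
  · rw [if_neg fun hc => h1 (h.mp hc).1, if_neg h1, zero_mul]

theorem siteOp_natAdd {a b : ℕ} (A : Matrix (Fin (N + 1)) (Fin (N + 1)) ℂ) (x : Fin b) :
    (siteOp N (a + b) A (Fin.natAdd a x)).submatrix (joinConfig N a b) (joinConfig N a b) =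
      (1 : Matrix (Config N a) (Config N a) ℂ) ⊗ₖ siteOp N b A x := by
  ext p q
  simp only [submatrix_apply, siteOp, of_apply, kroneckerMap_apply, joinConfig_right, one_apply]
  have h : (∀ y, y ≠ Fin.natAdd a x → joinConfig N a b p y = joinConfig N a b q y) ↔
      p.1 = q.1 ∧ (∀ y, y ≠ x → p.2 y = q.2 y) := by
    constructor
    · intro h
      refine ⟨?_, fun y hy => ?_⟩
      · ext y
        have := h (Fin.castAdd b y) (fun hc => by
          have := congrArg Fin.val hc; simp at this; omega)
        rw [joinConfig_left, joinConfig_left] at this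
        rw [this]
      · have := h (Fin.natAdd a y) (fun hc => hy (Fin.natAdd_injective _ _ hc))
        rwa [joinConfig_right, joinConfig_right] at this
    · rintro ⟨h1, h2⟩ y hy
      refine Fin.addCases (fun z _ => ?_) (fun z hz => ?_) y hy
      · rw [joinConfig_left, joinConfig_left, h1]
      · rw [joinConfig_right, joinConfig_right, h2 z (fun hc => hz (by rw [hc]))]
  by_cases h1 : p.1 = q.1
  · by_cases h2 : ∀ y, y ≠ x → p.2 y = q.2 y
    · rw [if_pos (h.mpr ⟨h1, h2⟩), if_pos h1, if_pos h2, one_mul]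
    · rw [if_neg fun hc => h2 (h.mp hc).2, if_neg h2, mul_zero]
  · rw [if_neg fun hc => h1 (h.mp hc).1, if_neg h1, zero_mul]

theorem bond_castAdd {a b : ℕ} (x y : Fin a) :
    (bond N (a + b) (Fin.castAdd b x) (Fin.castAdd b y)).submatrix (joinConfig N a b)
      (joinConfig N a b) = bond N a x y ⊗ₖ (1 : Matrix (Config N b) (Config N b) ℂ) := by
  have hmul : ∀ A B : Matrix (Config N (a + b)) (Config N (a + b)) ℂ,
      (A * B).submatrix (joinConfig N a b) (joinConfig N a b) =
        A.submatrix (joinConfig N a b) (joinConfig N a b) *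
          B.submatrix (joinConfig N a b) (joinConfig N a b) :=
    fun A B => (submatrix_mul_equiv A B _ _ _).symm
  have h1 : (1 : Matrix (Config N (a + b)) (Config N (a + b)) ℂ).submatrix (joinConfig N a b)
      (joinConfig N a b) = 1 := submatrix_one_equiv _
  simp only [bond, spinDot_eq, submatrix_sub, submatrix_add, submatrix_smul, Pi.sub_apply,
    Pi.add_apply, Pi.smul_apply, hmul, h1, siteOp_castAdd, ← mul_kronecker_mul, one_mul]
  simp only [sub_eq_add_neg, add_kronecker, smul_kronecker, one_kronecker_one]
  rw [← neg_one_smul ℂ, ← neg_one_smul ℂ (_ + _), smul_kronecker, add_kronecker, smul_kronecker,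
    add_kronecker]

theorem bond_natAdd {a b : ℕ} (x y : Fin b) :
    (bond N (a + b) (Fin.natAdd a x) (Fin.natAdd a y)).submatrix (joinConfig N a b)
      (joinConfig N a b) = (1 : Matrix (Config N a) (Config N a) ℂ) ⊗ₖ bond N b x y := by
  have hmul : ∀ A B : Matrix (Config N (a + b)) (Config N (a + b)) ℂ,
      (A * B).submatrix (joinConfig N a b) (joinConfig N a b) =
        A.submatrix (joinConfig N a b) (joinConfig N a b) *
          B.submatrix (joinConfig N a b) (joinConfig N a b) :=
    fun A B => (submatrix_mul_equiv A B _ _ _).symm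
  have h1 : (1 : Matrix (Config N (a + b)) (Config N (a + b)) ℂ).submatrix (joinConfig N a b)
      (joinConfig N a b) = 1 := submatrix_one_equiv _
  simp only [bond, spinDot_eq, submatrix_sub, submatrix_add, submatrix_smul, Pi.sub_apply,
    Pi.add_apply, Pi.smul_apply, hmul, h1, siteOp_natAdd, ← mul_kronecker_mul, one_mul]
  simp only [sub_eq_add_neg, kronecker_add, kronecker_smul, one_kronecker_one]
  rw [← neg_one_smul ℂ, ← neg_one_smul ℂ (_ + _), kronecker_smul, kronecker_add, kronecker_smul,
    kronecker_add]

theorem sum_kronecker {ι κ σ : Type*} (s : Finset σ) (A : σ → Matrix ι ι ℂ) (B : Matrix κ κ ℂ) :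
    (∑ i ∈ s, A i) ⊗ₖ B = ∑ i ∈ s, A i ⊗ₖ B := by
  classical
  induction s using Finset.induction_on with
  | empty => simp
  | insert a s ha ih => rw [Finset.sum_insert ha, Finset.sum_insert ha, add_kronecker, ih]

theorem kronecker_sum {ι κ σ : Type*} (s : Finset σ) (A : σ → Matrix ι ι ℂ) (B : Matrix κ κ ℂ) :
    B ⊗ₖ (∑ i ∈ s, A i) = ∑ i ∈ s, B ⊗ₖ A i := by
  classical
  induction s using Finset.induction_on with
  | empty => simp
  | insert a s ha ih => rw [Finset.sum_insert ha, Finset.sum_insert ha, kronecker_add, ih]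

theorem hamiltonian_join (a b : ℕ) :
    (hamiltonian N (a + 1 + (b + 1))).submatrix (joinConfig N (a + 1) (b + 1))
      (joinConfig N (a + 1) (b + 1)) =
    (hamiltonian N (a + 1) ⊗ₖ (1 : Matrix (Config N (b + 1)) (Config N (b + 1)) ℂ) +
      (1 : Matrix (Config N (a + 1)) (Config N (a + 1)) ℂ) ⊗ₖ hamiltonian N (b + 1)) +
    (bond N (a + 1 + (b + 1)) (Fin.castAdd _ (Fin.last a)) (Fin.natAdd _ 0)).submatrix
      (joinConfig N (a + 1) (b + 1)) (joinConfig N (a + 1) (b + 1)) := by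
  have hs : hamiltonian N (a + 1 + (b + 1)) =
      (∑ x : Fin a, bond N (a + 1 + (b + 1)) (Fin.castAdd _ x.castSucc) (Fin.castAdd _ x.succ)) +
      bond N (a + 1 + (b + 1)) (Fin.castAdd _ (Fin.last a)) (Fin.natAdd _ 0) +
      ∑ x : Fin b, bond N (a + 1 + (b + 1)) (Fin.natAdd _ x.castSucc) (Fin.natAdd _ x.succ) := by
    have : hamiltonian N (a + 1 + (b + 1)) = ∑ x : Fin (a + 1 + b),
        bond N (a + 1 + (b + 1)) ⟨(x : ℕ), by omega⟩ ⟨(x : ℕ) + 1, by omega⟩ := rfl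
    rw [this, Fin.sum_univ_add, Fin.sum_univ_castSucc]
    rfl
  have h1 : hamiltonian N (a + 1) = ∑ x : Fin a, bond N (a + 1) x.castSucc x.succ := rfl
  have h2 : hamiltonian N (b + 1) = ∑ x : Fin b, bond N (b + 1) x.castSucc x.succ := rfl
  rw [h1, h2, sum_kronecker, kronecker_sum]
  simp only [← bond_castAdd, ← bond_natAdd]
  rw [hs]
  ext p q
  simp only [submatrix_apply, Matrix.add_apply, Matrix.sum_apply]
  ring

theorem castAdd_ne_natAdd {a b : ℕ} (x : Fin a) (y : Fin b) :
    Fin.castAdd b x ≠ Fin.natAdd a y := by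
  intro h
  have := congrArg Fin.val h
  simp at this
  omega

theorem heatTrace_submatrix_equiv {ι κ : Type*} [Fintype ι] [Fintype κ] [DecidableEq ι]
    [DecidableEq κ] {β : ℝ} (hβ : 0 ≤ β) {A : Matrix ι ι ℂ} (hA : A.IsHermitian)
    (hA0 : ∀ v, 0 ≤ qf A v) (e : κ ≃ ι) : heatTrace β (A.submatrix e e) = heatTrace β A := by
  refine le_antisymm (heatTrace_submatrix_le hβ hA hA0 e.injective) ?_
  have := heatTrace_submatrix_le hβ (hA.submatrix e)
    (fun v => by rw [← mulVec_extend A e.injective]; exact hA0 _) e.symm.injective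
  simpa using this

theorem partitionFunction_eq (β : ℝ) (L : ℕ) :
    partitionFunction N L β = heatTrace β (hamiltonian N L) := rfl

/-- The connecting bond has a nonnegative form; leaving it out raises the trace, which then
factorises. -/
theorem partitionFunction_join_le {β : ℝ} (hβ : 0 ≤ β) (a b : ℕ) :
    partitionFunction N (a + 1 + (b + 1)) β ≤
      partitionFunction N (a + 1) β * partitionFunction N (b + 1) β := by
  rw [partitionFunction_eq, partitionFunction_eq, partitionFunction_eq,
    ← heatTrace_kronecker β (hamiltonian_isHermitian N _) (hamiltonian_isHermitian N _),
    ← heatTrace_submatrix_equiv hβ (hamiltonian_isHermitian N _) qf_hamiltonian_nonneg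
      (joinConfig N (a + 1) (b + 1))]
  have hsub : ∀ {x y : Fin (a + 1 + (b + 1))}, x ≠ y → ∀ v, 0 ≤ qf ((bond N _ x y).submatrix
      (joinConfig N (a + 1) (b + 1)) (joinConfig N (a + 1) (b + 1))) v := by
    intro x y hxy v
    rw [← mulVec_extend _ (joinConfig N (a + 1) (b + 1)).injective]
    exact qf_bond_nonneg hxy _
  have hpos : ∀ v, 0 ≤ qf
      (hamiltonian N (a + 1) ⊗ₖ (1 : Matrix (Config N (b + 1)) (Config N (b + 1)) ℂ) +
      (1 : Matrix (Config N (a + 1)) (Config N (a + 1)) ℂ) ⊗ₖ hamiltonian N (b + 1)) v := by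
    intro v
    rw [hamiltonian_eq, hamiltonian_eq, sum_kronecker, kronecker_sum, qf_add, qf_sum, qf_sum]
    refine add_nonneg (Finset.sum_nonneg fun x _ => ?_) (Finset.sum_nonneg fun x _ => ?_)
    · rw [← bond_castAdd]
      exact hsub (fun h => left_ne_right _ _ _ (Fin.castAdd_injective _ _ h)) v
    · rw [← bond_natAdd]
      exact hsub (fun h => left_ne_right _ _ _ (Fin.natAdd_injective _ _ h)) v
  refine heatTrace_antitone hβ ?_ ((hamiltonian_isHermitian N _).submatrix _) hpos fun v => ?_
  · refine IsHermitian.add ?_ ?_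
    · rw [IsHermitian, conjTranspose_kronecker, conjTranspose_one,
        (hamiltonian_isHermitian N _).eq]
    · rw [IsHermitian, conjTranspose_kronecker, conjTranspose_one,
        (hamiltonian_isHermitian N _).eq]
  · rw [hamiltonian_join, qf_add _ (submatrix _ _ _)]
    linarith [hsub (castAdd_ne_natAdd (Fin.last a) (0 : Fin (b + 1))) v]

/-- Configurations with empty end sites. -/
abbrev EmptyEnds (N L : ℕ) : Type :=
  {s : Config N L // ∀ x : Fin L, (x : ℕ) = 0 ∨ (x : ℕ) + 1 = L → s x = 0}

/-- The Hamiltonian compressed to configurations with empty end sites. -/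
def dirichletHamiltonian (N L : ℕ) : Matrix (EmptyEnds N L) (EmptyEnds N L) ℂ :=
  (hamiltonian N L).submatrix Subtype.val Subtype.val

theorem dirichletHamiltonian_isHermitian (N L : ℕ) : (dirichletHamiltonian N L).IsHermitian :=
  (hamiltonian_isHermitian N L).submatrix _

theorem qf_dirichletHamiltonian_nonneg {L : ℕ} (v : EmptyEnds N L → ℂ) :
    0 ≤ qf (dirichletHamiltonian N L) v := by
  rw [dirichletHamiltonian, ← mulVec_extend _ Subtype.val_injective]
  exact qf_hamiltonian_nonneg _

theorem heatTrace_dirichlet_le {β : ℝ} (hβ : 0 ≤ β) (L : ℕ) :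
    heatTrace β (dirichletHamiltonian N L) ≤ partitionFunction N L β :=
  heatTrace_submatrix_le hβ (hamiltonian_isHermitian N L) qf_hamiltonian_nonneg
    Subtype.val_injective

/-- Concatenation of configurations with empty ends. -/
def joinEmptyEnds (N a b : ℕ) (p : EmptyEnds N (a + 1) × EmptyEnds N (b + 1)) :
    EmptyEnds N (a + 1 + (b + 1)) :=
  ⟨joinConfig N (a + 1) (b + 1) (p.1.1, p.2.1), fun x hx => by
    revert hx
    refine Fin.addCases (fun z hz => ?_) (fun z hz => ?_) x
    · rw [joinConfig_left]
      apply p.1.2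
      rw [Fin.val_castAdd] at hz
      omega
    · rw [joinConfig_right]
      apply p.2.2
      rw [Fin.val_natAdd] at hz
      omega⟩

theorem joinEmptyEnds_injective (N a b : ℕ) : Function.Injective (joinEmptyEnds N a b) := by
  intro p q h
  have h1 := (joinConfig N (a + 1) (b + 1)).injective (congrArg Subtype.val h)
  have h2 := Prod.ext_iff.mp h1
  exact Prod.ext (Subtype.ext h2.1) (Subtype.ext h2.2)

/-- Joined configurations with empty ends are among those of the long chain, and the connecting bond
vanishes on them. Compression to them only lowers the trace. -/
theorem le_heatTrace_dirichlet_join {β : ℝ} (hβ : 0 ≤ β) (a b : ℕ) :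
    heatTrace β (dirichletHamiltonian N (a + 1)) * heatTrace β (dirichletHamiltonian N (b + 1)) ≤
      heatTrace β (dirichletHamiltonian N (a + 1 + (b + 1))) := by
  rw [← heatTrace_kronecker β (dirichletHamiltonian_isHermitian N _)
    (dirichletHamiltonian_isHermitian N _)]
  refine le_trans (le_of_eq ?_) (heatTrace_submatrix_le hβ (dirichletHamiltonian_isHermitian N _)
    qf_dirichletHamiltonian_nonneg (joinEmptyEnds_injective N a b))
  congr 1
  ext p q
  have h := congrFun (congrFun (hamiltonian_join (N := N) a b) (p.1.1, p.2.1)) (q.1.1, q.2.1)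
  rw [submatrix_apply] at h
  simp only [dirichletHamiltonian, submatrix_apply, joinEmptyEnds]
  rw [h]
  simp only [Matrix.add_apply, submatrix_apply]
  rw [bond_apply_of_zero (castAdd_ne_natAdd _ _)]
  · simp only [kroneckerMap_apply, submatrix_apply, one_apply, Subtype.ext_iff, add_zero]
  · rw [joinConfig_left]
    exact p.1.2 _ (Or.inr (by simp))
  · rw [joinConfig_right]
    exact p.2.2 _ (Or.inl (by simp))

end Additivity

/-! ### The thermodynamic limit. -/

section Limit

variable {N : ℕ}

/-- The configuration without particles has energy zero; compression to it alone gives trace 1. -/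
theorem one_le_heatTrace_dirichlet {β : ℝ} (hβ : 0 ≤ β) (L : ℕ) :
    1 ≤ heatTrace β (dirichletHamiltonian N L) := by
  have hz : ∀ x y : Fin L, x ≠ y → bond N L x y (0 : Config N L) 0 = 0 := fun x y hxy =>
    bond_apply_of_zero hxy rfl rfl _
  let f : Unit → EmptyEnds N L := fun _ => ⟨0, fun _ _ => rfl⟩
  have h := heatTrace_submatrix_le hβ (dirichletHamiltonian_isHermitian N L)
    qf_dirichletHamiltonian_nonneg (f := f) (fun _ _ _ => rfl)
  have h0 : (dirichletHamiltonian N L).submatrix f f = 0 := by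
    ext i j
    simp only [submatrix_apply, dirichletHamiltonian, hamiltonian_eq, Matrix.sum_apply]
    exact Finset.sum_eq_zero fun x _ => hz _ _ (left_ne_right _ _ _)
  rw [h0] at h
  simpa [heatTrace] using h

theorem one_le_partitionFunction {β : ℝ} (hβ : 0 ≤ β) (L : ℕ) : 1 ≤ partitionFunction N L β :=
  (one_le_heatTrace_dirichlet hβ L).trans (heatTrace_dirichlet_le hβ L)

theorem partitionFunction_zero (β : ℝ) : partitionFunction N 0 β = 1 := by
  have : hamiltonian N 0 = 0 := rfl
  rw [partitionFunction, this]
  simp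

theorem subadditive_log_partitionFunction {β : ℝ} (hβ : 0 ≤ β) :
    Subadditive fun L => Real.log (partitionFunction N L β) := by
  intro m n
  rcases m with _ | m
  · simp [partitionFunction_zero]
  rcases n with _ | n
  · simp [partitionFunction_zero]
  have h1 := one_le_partitionFunction (N := N) hβ (m + 1)
  have h2 := one_le_partitionFunction (N := N) hβ (n + 1)
  rw [← Real.log_mul (by linarith) (by linarith)]
  exact Real.log_le_log (by linarith [one_le_partitionFunction (N := N) hβ (m + 1 + (n + 1))])
    (partitionFunction_join_le hβ m n)

/-- The pressure times `β`: the limit of `L⁻¹ ln Tr e^{-β H_L}`. -/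
def pressure (N : ℕ) (β : ℝ) : ℝ := limUnder atTop fun L : ℕ => Real.log (partitionFunction N L β) / L

theorem bddBelow_log_partitionFunction {β : ℝ} (hβ : 0 ≤ β) :
    BddBelow (Set.range fun L : ℕ => Real.log (partitionFunction N L β) / L) :=
  ⟨0, by
    rintro _ ⟨L, rfl⟩
    exact div_nonneg (Real.log_nonneg (one_le_partitionFunction hβ L)) (Nat.cast_nonneg _)⟩

theorem tendsto_pressure {β : ℝ} (hβ : 0 ≤ β) :
    Tendsto (fun L : ℕ => Real.log (partitionFunction N L β) / L) atTop (𝓝 (pressure N β)) :=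
  tendsto_nhds_limUnder ⟨_, (subadditive_log_partitionFunction hβ).tendsto_lim
    (bddBelow_log_partitionFunction hβ)⟩

/-- By Fekete's lemma the limit of a subadditive sequence divided by the length is its infimum. -/
theorem pressure_le {β : ℝ} (hβ : 0 ≤ β) {L : ℕ} (hL : L ≠ 0) :
    pressure N β ≤ Real.log (partitionFunction N L β) / L := by
  have h := tendsto_nhds_unique (tendsto_pressure (N := N) hβ)
    ((subadditive_log_partitionFunction hβ).tendsto_lim (bddBelow_log_partitionFunction hβ))
  rw [h]
  exact (subadditive_log_partitionFunction hβ).lim_le_div (bddBelow_log_partitionFunction hβ) hL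

theorem pow_le_heatTrace_dirichlet {β : ℝ} (hβ : 0 ≤ β) (a k : ℕ) :
    heatTrace β (dirichletHamiltonian N (a + 1)) ^ (k + 1) ≤
      heatTrace β (dirichletHamiltonian N ((k + 1) * (a + 1))) := by
  induction k with
  | zero => rw [zero_add, pow_one, one_mul]
  | succ k ih =>
    obtain ⟨c, hc⟩ : ∃ c, (k + 1) * (a + 1) = c + 1 := ⟨(k + 1) * (a + 1) - 1, by
      have : 0 < (k + 1) * (a + 1) := by positivity
      omega⟩
    have h1 := le_heatTrace_dirichlet_join (N := N) hβ c a
    rw [← hc] at h1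
    have h2 : (k + 1 + 1) * (a + 1) = (k + 1) * (a + 1) + (a + 1) := by ring
    rw [h2, pow_succ]
    have := one_le_heatTrace_dirichlet (N := N) hβ (a + 1)
    exact (mul_le_mul_of_nonneg_right ih (by linarith)).trans h1

/-- Join `k + 1` copies of a box with empty ends: the power of the box trace is a lower bound for
the free chain of length `(k + 1) (a + 1)`, and `k → ∞`. -/
theorem le_pressure {β : ℝ} (hβ : 0 ≤ β) (a : ℕ) :
    Real.log (heatTrace β (dirichletHamiltonian N (a + 1))) / (a + 1 : ℕ) ≤ pressure N β := by
  have hmul : Tendsto (fun k : ℕ => (k + 1) * (a + 1)) atTop atTop :=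
    tendsto_atTop_mono (fun k => by simp only [id]; nlinarith) tendsto_id
  refine ge_of_tendsto ((tendsto_pressure hβ).comp hmul) (Eventually.of_forall fun k => ?_)
  have h1 := one_le_heatTrace_dirichlet (N := N) hβ (a + 1)
  have h2 := (pow_le_heatTrace_dirichlet (N := N) hβ a k).trans (heatTrace_dirichlet_le hβ _)
  have h3 := Real.log_le_log (by positivity) h2
  rw [Real.log_pow] at h3
  simp only [Function.comp_apply]
  rw [div_le_div_iff₀ (by positivity) (by positivity)]
  push_cast at h3 ⊢
  have : (0 : ℝ) < a + 1 := by positivity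
  nlinarith

theorem partitionFunction_mul_le {β : ℝ} (hβ : 0 ≤ β) (a k : ℕ) :
    partitionFunction N (k * a) β ≤ partitionFunction N a β ^ k := by
  have h := one_le_partitionFunction (N := N) hβ
  have hs := subadditive_log_partitionFunction (N := N) hβ
  have : Real.log (partitionFunction N (k * a) β) ≤ k * Real.log (partitionFunction N a β) := by
    induction k with
    | zero => simp [partitionFunction_zero]
    | succ k ih =>
      have := hs (k * a) a
      rw [show (k + 1) * a = k * a + a by ring]
      push_cast
      linarith
  rw [← Real.log_pow] at this
  exact (Real.log_le_log_iff (by linarith [h (k * a)]) (pow_pos (by linarith [h a]) k)).mp this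

theorem tendsto_finiteFreeEnergy {β : ℝ} (hβ : 0 < β) :
    Tendsto (fun L : ℕ => finiteFreeEnergy N L β) atTop (𝓝 (-(pressure N β / β))) := by
  have := ((tendsto_pressure (N := N) hβ.le).div_const β).neg
  refine this.congr fun L => ?_
  rw [finiteFreeEnergy, div_div, one_div, div_eq_mul_inv, mul_comm β]
  ring

theorem freeEnergy_eq {β : ℝ} (hβ : 0 < β) : freeEnergy N β = -(pressure N β / β) :=
  (tendsto_finiteFreeEnergy hβ).limUnder_eq

end Limit

end HeisenbergChain
end

noncomputable section

namespace HeisenbergChain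

open Matrix

/-! ### Exchanging two spins one half. -/

section Swaps

variable {Ω : Type*} [Fintype Ω] [DecidableEq Ω]

/-- The squared distance of `F` from its translate under a permutation of the sites. -/
def permDefect (F : (Ω → Bool) → ℂ) (π : Equiv.Perm Ω) : ℝ := ∑ η, ‖F η - F (η ∘ π)‖ ^ 2

theorem permDefect_nonneg (F : (Ω → Bool) → ℂ) (π : Equiv.Perm Ω) : 0 ≤ permDefect F π :=
  Finset.sum_nonneg fun _ _ => sq_nonneg _

/-- Permutations of sites act on spin configurations. -/
def permConfig (π : Equiv.Perm Ω) : (Ω → Bool) ≃ (Ω → Bool) := Equiv.arrowCongr π.symm (Equiv.refl _)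

theorem sum_comp_perm {M : Type*} [AddCommMonoid M] (g : (Ω → Bool) → M) (π : Equiv.Perm Ω) :
    ∑ η, g (η ∘ π) = ∑ η, g η := Equiv.sum_comp (permConfig π) g

/-- Permutations of sites act isometrically on functions of spin configurations, so this is the
triangle inequality in `ℓ²`. -/
theorem sqrt_permDefect_mul_le (F : (Ω → Bool) → ℂ) (π σ : Equiv.Perm Ω) :
    Real.sqrt (permDefect F (π * σ)) ≤ Real.sqrt (permDefect F π) + Real.sqrt (permDefect F σ) := by
  have hn : ∀ G : (Ω → Bool) → ℂ, Real.sqrt (∑ η, ‖G η‖ ^ 2) = ‖WithLp.toLp 2 G‖ := fun G => by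
    rw [EuclideanSpace.norm_eq]
  have h2 : permDefect F σ = ∑ η, ‖F (η ∘ π) - F ((η ∘ π) ∘ σ)‖ ^ 2 :=
    (sum_comp_perm (fun η => ‖F η - F (η ∘ σ)‖ ^ 2) π).symm
  rw [h2, permDefect, permDefect, hn fun η => F η - F (η ∘ (π * σ)), hn fun η => F η - F (η ∘ π),
    hn fun η => F (η ∘ π) - F ((η ∘ π) ∘ σ)]
  refine le_trans (le_of_eq ?_) (norm_add_le _ _)
  congr 1
  rw [← WithLp.toLp_add]
  congr 1
  ext η
  simp only [Pi.add_apply, sub_add_sub_cancel]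
  rfl

/-- Conjugation: `(a c) = (b c)(a b)(b c)`. The coefficient 1 of the first term matters: along a
chain of neighbours the factors 2 then add up instead of multiplying. -/
theorem sqrt_permDefect_swap_le (F : (Ω → Bool) → ℂ) {a b c : Ω} (hab : a ≠ b) (hac : a ≠ c) :
    Real.sqrt (permDefect F (Equiv.swap a c)) ≤
      Real.sqrt (permDefect F (Equiv.swap a b)) + 2 * Real.sqrt (permDefect F (Equiv.swap b c)) := by
  have h : Equiv.swap a c = Equiv.swap b c * Equiv.swap a b * Equiv.swap b c := by
    rw [Equiv.swap_mul_swap_mul_swap hab hac, Equiv.swap_comm]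
  rw [h]
  have h1 := sqrt_permDefect_mul_le F (Equiv.swap b c * Equiv.swap a b) (Equiv.swap b c)
  have h2 := sqrt_permDefect_mul_le F (Equiv.swap b c) (Equiv.swap a b)
  linarith

/-- The two-point density. -/
def pairDensity (F : (Ω → Bool) → ℂ) (a b : Ω) : ℝ :=
  ∑ η, if η a = true ∧ η b = true then ‖F η‖ ^ 2 else 0

/-- Where `a` and `b` are occupied, compare `F` with its translate under the exchange of `b` and
`c`, which moves the second particle to `c`. If `c = a`, the first term on the right is a one-point
density and already suffices. -/
theorem pairDensity_le (F : (Ω → Bool) → ℂ) {a b : Ω} (hab : a ≠ b) (c : Ω) :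
    pairDensity F a b ≤ 2 * pairDensity F a c + 2 * permDefect F (Equiv.swap b c) := by
  by_cases hc : c = a
  · subst hc
    have h1 : pairDensity F c b ≤ pairDensity F c c := by
      refine Finset.sum_le_sum fun η _ => ?_
      by_cases h : η c = true <;> by_cases h' : η b = true <;> simp [h, h']
    have h2 : 0 ≤ pairDensity F c c :=
      Finset.sum_nonneg fun η _ => by split_ifs <;> positivity
    linarith [permDefect_nonneg F (Equiv.swap b c)]
  have h1 : pairDensity F a c =
      ∑ η : Ω → Bool, if η a = true ∧ η b = true then ‖F (η ∘ Equiv.swap b c)‖ ^ 2 else 0 := by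
    rw [pairDensity, ← sum_comp_perm _ (Equiv.swap b c)]
    refine Finset.sum_congr rfl fun η _ => ?_
    simp only [Function.comp_apply, Equiv.swap_apply_right,
      Equiv.swap_apply_of_ne_of_ne hab (Ne.symm hc)]
  rw [h1, pairDensity, permDefect, Finset.mul_sum, Finset.mul_sum, ← Finset.sum_add_distrib]
  refine Finset.sum_le_sum fun η _ => ?_
  have key : ‖F η‖ ^ 2 ≤ 2 * ‖F (η ∘ Equiv.swap b c)‖ ^ 2 +
      2 * ‖F η - F (η ∘ Equiv.swap b c)‖ ^ 2 := by
    have := norm_add_le (F (η ∘ Equiv.swap b c)) (F η - F (η ∘ Equiv.swap b c))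
    rw [add_sub_cancel] at this
    have h0 := norm_nonneg (F η)
    nlinarith [sq_nonneg (‖F (η ∘ Equiv.swap b c)‖ - ‖F η - F (η ∘ Equiv.swap b c)‖)]
  split_ifs
  · exact key
  · have := sq_nonneg ‖F η - F (η ∘ Equiv.swap b c)‖
    linarith

end Swaps

/-! ### A spin `N/2` as `N` symmetrised spins one half, and bonds between distant sites. -/

section Blobs

variable {N L : ℕ}

/-- Occupation numbers of a configuration of `N` spins `1/2` per site. -/
def profile (η : Fin L × Fin N → Bool) : Config N L := fun x =>
  ⟨(Finset.univ.filter fun i => η (x, i) = true).card,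
    Nat.lt_succ_of_le ((Finset.card_le_univ _).trans (by simp))⟩

theorem profile_val (η : Fin L × Fin N → Bool) (x : Fin L) :
    ((profile η x : ℕ)) = (Finset.univ.filter fun i => η (x, i) = true).card := rfl

theorem card_bool_eq_choose (N k : ℕ) :
    (Finset.univ.filter fun u : Fin N → Bool =>
      (Finset.univ.filter fun i => u i = true).card = k).card = N.choose k := by
  have h := Finset.card_powersetCard k (Finset.univ : Finset (Fin N))
  rw [Finset.card_univ, Fintype.card_fin] at h
  rw [← h]
  refine Finset.card_nbij' (fun u => Finset.univ.filter fun i => u i = true)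
    (fun s i => decide (i ∈ s)) ?_ ?_ ?_ ?_
  · intro u hu
    simpa [Finset.mem_powersetCard] using hu
  · intro s hs
    simpa [Finset.mem_powersetCard] using hs
  · intro u _
    ext i
    simp
  · intro s _
    ext i
    simp

theorem card_profile_eq (s : Config N L) :
    ((Finset.univ.filter fun η : Fin L × Fin N → Bool => profile η = s).card : ℝ) = weight s := by
  have h : (Finset.univ.filter fun η : Fin L × Fin N → Bool => profile η = s).card =
      (Fintype.piFinset fun x : Fin L => Finset.univ.filter fun u : Fin N → Bool =>
        (Finset.univ.filter fun i => u i = true).card = s x).card := by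
    refine Finset.card_nbij' (fun η x i => η (x, i)) (fun u p => u p.1 p.2) ?_ ?_ ?_ ?_
    · intro η hη
      have hη : profile η = s := by simpa using hη
      subst hη
      rw [Finset.mem_coe, Fintype.mem_piFinset]
      intro x
      rw [Finset.mem_filter]
      exact ⟨Finset.mem_univ _, rfl⟩
    · intro u hu
      rw [Finset.mem_coe, Finset.mem_filter]
      refine ⟨Finset.mem_univ _, ?_⟩
      ext x
      have := (Fintype.mem_piFinset.mp hu) x
      simpa [profile_val] using this
    · intro η _
      rfl
    · intro u _
      rfl
  rw [h, Fintype.card_piFinset, weight, Nat.cast_prod]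
  exact Finset.prod_congr rfl fun x _ => by rw [card_bool_eq_choose]

theorem sum_profile (g : Config N L → ℝ) :
    ∑ η : Fin L × Fin N → Bool, g (profile η) = ∑ s, weight s * g s := by
  rw [← Finset.sum_fiberwise (s := Finset.univ) (g := profile)]
  refine Finset.sum_congr rfl fun s _ => ?_
  rw [Finset.sum_congr rfl fun η hη => by rw [(Finset.mem_filter.mp hη).2], Finset.sum_const,
    nsmul_eq_mul, card_profile_eq]

/-- The spin-`1/2` wave function of a state of the spin-`N/2` chain. -/
def blobAmp (ψ : Config N L → ℂ) (η : Fin L × Fin N → Bool) : ℂ := relAmp ψ (profile η)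

/-- Each profile is shared by `weight` many configurations, which undoes the division in `relAmp`:
the passage to spins one half is isometric. -/
theorem sum_norm_sq_blobAmp (ψ : Config N L → ℂ) : ∑ η, ‖blobAmp ψ η‖ ^ 2 = sqNorm ψ := by
  simp only [blobAmp]
  rw [sum_profile fun s => ‖relAmp ψ s‖ ^ 2]
  exact Finset.sum_congr rfl fun s _ => norm_sq_relAmp ψ s

theorem profile_comp_swap_same (η : Fin L × Fin N → Bool) (x : Fin L) (i j : Fin N) :
    profile (η ∘ Equiv.swap (x, i) (x, j)) = profile η := by
  ext z
  rw [profile_val, profile_val]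
  by_cases hz : z = x
  · subst hz
    refine Finset.card_nbij' (Equiv.swap i j) (Equiv.swap i j) ?_ ?_ ?_ ?_
    · intro k hk
      have hs : Equiv.swap (z, i) (z, j) (z, k) = (z, Equiv.swap i j k) := by
        simp only [Equiv.swap_apply_def, Prod.mk.injEq, true_and]
        split_ifs <;> rfl
      simpa [hs] using hk
    · intro k hk
      have hs : Equiv.swap (z, i) (z, j) (z, Equiv.swap i j k) = (z, k) := by
        have h2 : (z, Equiv.swap i j k) = Equiv.swap (z, i) (z, j) (z, k) := by
          simp only [Equiv.swap_apply_def, Prod.mk.injEq, true_and]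
          split_ifs <;> rfl
        rw [h2, Equiv.swap_apply_self]
      simpa [hs] using hk
    · intro k _; simp
    · intro k _; simp
  · congr 1
    refine Finset.filter_congr fun k _ => ?_
    rw [Function.comp_apply, Equiv.swap_apply_of_ne_of_ne]
    · simp [hz]
    · simp [hz]

theorem profile_comp_swap {x y : Fin L} (hxy : x ≠ y) (η : Fin L × Fin N → Bool) (i j : Fin N)
    (hi : η (x, i) = true) (hj : η (y, j) = false) :
    profile (η ∘ Equiv.swap (x, i) (y, j)) = hop x y (profile η) := by
  have hxcard : (Finset.univ.filter fun k => (η ∘ Equiv.swap (x, i) (y, j)) (x, k) = true) =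
      (Finset.univ.filter fun k => η (x, k) = true).erase i := by
    ext k
    by_cases hk : k = i
    · subst hk; simp [hj]
    · simp only [Finset.mem_filter, Finset.mem_univ, true_and, Finset.mem_erase, Function.comp_apply]
      rw [Equiv.swap_apply_of_ne_of_ne (by simp [hk]) (by simp [hxy])]
      simp [hk]
  have hycard : (Finset.univ.filter fun k => (η ∘ Equiv.swap (x, i) (y, j)) (y, k) = true) =
      insert j (Finset.univ.filter fun k => η (y, k) = true) := by
    ext k
    by_cases hk : k = j
    · subst hk; simp [hi]
    · simp only [Finset.mem_filter, Finset.mem_univ, true_and, Finset.mem_insert,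
        Function.comp_apply]
      rw [Equiv.swap_apply_of_ne_of_ne (by simp [hxy.symm]) (by simp [hk])]
      simp [hk]
  have himem : i ∈ Finset.univ.filter fun k => η (x, k) = true := by simp [hi]
  have hjmem : j ∉ Finset.univ.filter fun k => η (y, k) = true := by simp [hj]
  funext z
  apply Fin.ext
  by_cases hzx : z = x
  · subst hzx
    rw [hop_apply_left hxy, profile_val, hxcard, Finset.card_erase_of_mem himem]
    have h0 : profile η z ≠ 0 := by
      intro h
      have := congrArg Fin.val h
      rw [profile_val] at this
      exact absurd this (Finset.card_ne_zero_of_mem himem)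
    rw [Fin.val_sub_one_of_ne_zero h0, profile_val]
  by_cases hzy : z = y
  · subst hzy
    rw [hop_apply_right, profile_val, hycard, Finset.card_insert_of_notMem hjmem]
    have h0 : profile η z < Fin.last N := by
      rw [Fin.lt_def, profile_val, Fin.val_last]
      have := Finset.card_lt_univ_of_notMem hjmem
      simpa using this
    rw [Fin.val_add_one_of_lt h0, profile_val]
  · rw [hop_apply_of_ne hzx hzy, profile_val, profile_val]
    congr 1
    refine Finset.filter_congr fun k _ => ?_
    rw [Function.comp_apply, Equiv.swap_apply_of_ne_of_ne]
    · simp [hzx]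
    · simp [hzy]

/-- Configurations that agree at `a` and `b` are fixed by the exchange, and the two remaining cases
are mapped to each other. -/
theorem permDefect_swap_eq_two_mul {Ω : Type*} [Fintype Ω] [DecidableEq Ω] (F : (Ω → Bool) → ℂ)
    (a b : Ω) : permDefect F (Equiv.swap a b) =
      2 * ∑ η : Ω → Bool, if η a = true ∧ η b = false then
        ‖F η - F (η ∘ Equiv.swap a b)‖ ^ 2 else 0 := by
  have h1 : ∑ η : Ω → Bool, (if η a = true ∧ η b = false then
        ‖F η - F (η ∘ Equiv.swap a b)‖ ^ 2 else 0) =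
      ∑ η : Ω → Bool, (if η b = true ∧ η a = false then
        ‖F η - F (η ∘ Equiv.swap a b)‖ ^ 2 else 0) := by
    rw [← sum_comp_perm _ (Equiv.swap a b)]
    refine Finset.sum_congr rfl fun η _ => ?_
    have : (η ∘ Equiv.swap a b) ∘ Equiv.swap a b = η := by
      ext k; simp
    rw [this, norm_sub_rev]
    simp
  rw [two_mul]
  nth_rewrite 2 [h1]
  rw [← Finset.sum_add_distrib, permDefect]
  refine Finset.sum_congr rfl fun η _ => ?_
  rcases ha : η a with _ | _ <;> rcases hb : η b with _ | _
  · have : η ∘ Equiv.swap a b = η := by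
      ext k
      rw [Function.comp_apply, Equiv.swap_apply_def]
      split_ifs with h1 h2
      · rw [h1, ha, hb]
      · rw [h2, ha, hb]
      · rfl
    simp [this]
  · simp
  · simp
  · have : η ∘ Equiv.swap a b = η := by
      ext k
      rw [Function.comp_apply, Equiv.swap_apply_def]
      split_ifs with h1 h2
      · rw [h1, ha, hb]
      · rw [h2, ha, hb]
      · rfl
    simp [this]

/-- The factor `s x (N - s y)` in the rate counts pairs of an occupied spin at `x` and an empty one
at `y`; each pair is one exchange. -/
theorem qf_bond_eq_sum_permDefect {x y : Fin L} (hxy : x ≠ y) (ψ : Config N L → ℂ) :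
    qf (bond N L x y) ψ = 1 / 4 * ∑ i : Fin N, ∑ j : Fin N,
      permDefect (blobAmp ψ) (Equiv.swap (x, i) (y, j)) := by
  have hcount : ∀ η : Fin L × Fin N → Bool, ((profile η x : ℕ) : ℝ) * ((N : ℝ) - (profile η y : ℕ)) =
      ∑ i : Fin N, ∑ j : Fin N, if η (x, i) = true ∧ η (y, j) = false then (1 : ℝ) else 0 := by
    intro η
    have h1 : ((profile η x : ℕ) : ℝ) = ∑ i : Fin N, if η (x, i) = true then (1 : ℝ) else 0 := by
      rw [profile_val]; simp
    have h2 : (N : ℝ) - (profile η y : ℕ) = ∑ j : Fin N, if η (y, j) = false then (1 : ℝ) else 0 := by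
      have : (N : ℝ) = ∑ j : Fin N, (1 : ℝ) := by simp
      rw [profile_val, Finset.card_filter, this]
      push_cast
      rw [← Finset.sum_sub_distrib]
      refine Finset.sum_congr rfl fun j _ => ?_
      rcases η (y, j) with _ | _ <;> simp
    rw [h1, h2, Finset.sum_mul_sum]
    refine Finset.sum_congr rfl fun i _ => Finset.sum_congr rfl fun j _ => ?_
    by_cases h : η (x, i) = true <;> by_cases h' : η (y, j) = false <;> simp [h, h']
  rw [qf_bond hxy]
  have hrate : ∑ s : Config N L, rate x y s * ‖relAmp ψ s - relAmp ψ (hop x y s)‖ ^ 2 =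
      ∑ η : Fin L × Fin N → Bool, (((profile η x : ℕ) : ℝ) * ((N : ℝ) - (profile η y : ℕ))) *
        ‖relAmp ψ (profile η) - relAmp ψ (hop x y (profile η))‖ ^ 2 := by
    rw [sum_profile fun s => (((s x : ℕ) : ℝ) * ((N : ℝ) - (s y : ℕ))) *
        ‖relAmp ψ s - relAmp ψ (hop x y s)‖ ^ 2]
    refine Finset.sum_congr rfl fun s _ => ?_
    rw [rate]
    ring
  rw [hrate]
  simp only [hcount, permDefect_swap_eq_two_mul, ← Finset.mul_sum]
  rw [← mul_assoc, show (1 / 4 * 2 : ℝ) = 1 / 2 by norm_num]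
  congr 1
  simp only [Finset.sum_mul]
  rw [Finset.sum_comm]
  refine Finset.sum_congr rfl fun i _ => ?_
  rw [Finset.sum_comm]
  refine Finset.sum_congr rfl fun j _ => Finset.sum_congr rfl fun η _ => ?_
  by_cases h : η (x, i) = true ∧ η (y, j) = false
  · rw [if_pos h, if_pos h, one_mul, blobAmp, blobAmp, profile_comp_swap hxy η i j h.1 h.2]
  · rw [if_neg h, if_neg h, zero_mul]

theorem blobAmp_comp_swap (ψ : Config N L → ℂ) (η : Fin L × Fin N → Bool) (x : Fin L)
    (i j : Fin N) : blobAmp ψ (η ∘ Equiv.swap (x, i) (x, j)) = blobAmp ψ η := by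
  rw [blobAmp, profile_comp_swap_same, blobAmp]

theorem permDefect_blobAmp_same (ψ : Config N L → ℂ) (x : Fin L) (i j : Fin N) :
    permDefect (blobAmp ψ) (Equiv.swap (x, i) (x, j)) = 0 := by
  simp [permDefect, blobAmp_comp_swap]

theorem permDefect_conj {Ω : Type*} [Fintype Ω] [DecidableEq Ω] {F : (Ω → Bool) → ℂ}
    {σ : Equiv.Perm Ω} (hσ : ∀ η, F (η ∘ σ) = F η) (a b : Ω) :
    permDefect F (Equiv.swap (σ a) (σ b)) = permDefect F (Equiv.swap a b) := by
  have h2 : ∀ η, F (η ∘ σ.symm) = F η := fun η => by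
    rw [← hσ]
    congr 1
    ext k
    simp
  rw [permDefect, ← sum_comp_perm _ σ.symm, permDefect]
  refine Finset.sum_congr rfl fun η _ => ?_
  have h3 : (η ∘ σ.symm) ∘ Equiv.swap (σ a) (σ b) = (η ∘ Equiv.swap a b) ∘ σ.symm := by
    ext k
    obtain ⟨l, rfl⟩ := σ.surjective k
    simp only [Function.comp_apply, Equiv.symm_apply_apply]
    rw [Equiv.swap_apply_apply]
    simp
  rw [h3, h2, h2]

/-- The function `blobAmp ψ` is symmetric within each site, and conjugation by exchanges inside `x`
and inside `y` relabels the two spins. A single exchange therefore represents the whole bond. -/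
theorem permDefect_blobAmp_indep {x y : Fin L} (hxy : x ≠ y) (ψ : Config N L → ℂ)
    (i j i' j' : Fin N) : permDefect (blobAmp ψ) (Equiv.swap (x, i) (y, j)) =
      permDefect (blobAmp ψ) (Equiv.swap (x, i') (y, j')) := by
  have h1 := permDefect_conj (F := blobAmp ψ) (σ := Equiv.swap (x, i) (x, i'))
    (fun η => blobAmp_comp_swap ψ η x i i') (x, i) (y, j)
  have h2 := permDefect_conj (F := blobAmp ψ) (σ := Equiv.swap (y, j) (y, j'))
    (fun η => blobAmp_comp_swap ψ η y j j') (x, i') (y, j)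
  rw [Equiv.swap_apply_left, Equiv.swap_apply_of_ne_of_ne (by simp [hxy.symm])
    (by simp [hxy.symm])] at h1
  rw [Equiv.swap_apply_left, Equiv.swap_apply_of_ne_of_ne (by simp [hxy])
    (by simp [hxy])] at h2
  rw [← h1, ← h2]

theorem qf_bond_eq_permDefect {x y : Fin L} (hxy : x ≠ y) (ψ : Config N L → ℂ) (i j : Fin N) :
    qf (bond N L x y) ψ = (N : ℝ) ^ 2 / 4 * permDefect (blobAmp ψ) (Equiv.swap (x, i) (y, j)) := by
  rw [qf_bond_eq_sum_permDefect hxy, Finset.sum_congr rfl fun k _ => Finset.sum_congr rfl fun l _ =>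
    permDefect_blobAmp_indep hxy ψ k l i j]
  simp
  ring

theorem sqrt_qf_bond_le (hN : 0 < N) {x y z : Fin L} (hxy : x ≠ y) (hyz : y ≠ z) (hxz : x ≠ z)
    (ψ : Config N L → ℂ) : Real.sqrt (qf (bond N L x z) ψ) ≤
      Real.sqrt (qf (bond N L x y) ψ) + 2 * Real.sqrt (qf (bond N L y z) ψ) := by
  let i : Fin N := ⟨0, hN⟩
  rw [qf_bond_eq_permDefect hxz ψ i i, qf_bond_eq_permDefect hxy ψ i i,
    qf_bond_eq_permDefect hyz ψ i i, Real.sqrt_mul (by positivity), Real.sqrt_mul (by positivity),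
    Real.sqrt_mul (by positivity)]
  have h := sqrt_permDefect_swap_le (blobAmp ψ) (a := (x, i)) (b := (y, i)) (c := (z, i))
    (by simp [hxy]) (by simp [hxz])
  have h0 := Real.sqrt_nonneg ((N : ℝ) ^ 2 / 4)
  nlinarith

theorem bond_comm {x y : Fin L} (hxy : x ≠ y) : bond N L x y = bond N L y x := by
  rw [bond, bond, spinDot, spinDot]
  congr 1
  exact Finset.sum_congr rfl fun a _ => siteOp_comm _ _ hxy

/-- The energy of the nearest neighbour bond starting at `z`. -/
def bondEnergy (ψ : Config N L → ℂ) (z : ℕ) : ℝ :=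
  if h : z + 1 < L then qf (bond N L ⟨z, by omega⟩ ⟨z + 1, h⟩) ψ else 0

theorem bondEnergy_nonneg (ψ : Config N L → ℂ) (z : ℕ) : 0 ≤ bondEnergy ψ z := by
  rw [bondEnergy]
  split_ifs with h
  · exact qf_bond_nonneg (by simp) ψ
  · exact le_rfl

theorem qf_hamiltonian_eq_sum_bondEnergy (ψ : Config N L → ℂ) :
    qf (hamiltonian N L) ψ = ∑ z ∈ Finset.range (L - 1), bondEnergy ψ z := by
  rw [qf_hamiltonian, Finset.sum_range]
  refine Finset.sum_congr rfl fun x _ => ?_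
  rw [bondEnergy, dif_pos (by omega)]

/-- Induction on the distance with `sqrt_qf_bond_le`, where only the newest link carries the factor
2. -/
theorem sqrt_qf_bond_le_sum (hN : 0 < N) (ψ : Config N L → ℂ) (x k : ℕ) (hk : 0 < k)
    (h : x + k < L) : Real.sqrt (qf (bond N L ⟨x, by omega⟩ ⟨x + k, h⟩) ψ) ≤
      2 * ∑ z ∈ Finset.Ico x (x + k), Real.sqrt (bondEnergy ψ z) := by
  induction k with
  | zero => omega
  | succ k ih =>
    have he : Real.sqrt (bondEnergy ψ (x + k)) =
        Real.sqrt (qf (bond N L ⟨x + k, by omega⟩ ⟨x + (k + 1), h⟩) ψ) := by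
      rw [bondEnergy, dif_pos (by omega)]
      rfl
    have hI : ∑ z ∈ Finset.Ico x (x + (k + 1)), Real.sqrt (bondEnergy ψ z) =
        ∑ z ∈ Finset.Ico x (x + k), Real.sqrt (bondEnergy ψ z) + Real.sqrt (bondEnergy ψ (x + k)) := by
      rw [← add_assoc, Finset.sum_Ico_succ_top (by omega)]
    rw [hI, he, mul_add]
    rcases Nat.eq_zero_or_pos k with rfl | hk'
    · simp only [add_zero, zero_add, Finset.Ico_self, Finset.sum_empty, mul_zero]
      have := Real.sqrt_nonneg (qf (bond N L ⟨x, by omega⟩ ⟨x + 1, h⟩) ψ)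
      linarith
    · have h1 := ih hk' (by omega)
      have h2 := sqrt_qf_bond_le hN (x := (⟨x, by omega⟩ : Fin L)) (y := ⟨x + k, by omega⟩)
        (z := ⟨x + (k + 1), h⟩) (by simp [Fin.ext_iff]; omega) (by simp [Fin.ext_iff])
        (by simp [Fin.ext_iff]) ψ
      linarith

/-- Cauchy–Schwarz for a sum of `k` square roots; the 4 is the square of the factor 2. -/
theorem qf_bond_le_sum (hN : 0 < N) (ψ : Config N L → ℂ) (x k : ℕ) (hk : 0 < k)
    (h : x + k < L) : qf (bond N L ⟨x, by omega⟩ ⟨x + k, h⟩) ψ ≤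
      4 * k * ∑ z ∈ Finset.Ico x (x + k), bondEnergy ψ z := by
  have h1 := sqrt_qf_bond_le_sum hN ψ x k hk h
  have hq := qf_bond_nonneg (x := (⟨x, by omega⟩ : Fin L)) (y := ⟨x + k, h⟩)
    (by simp [Fin.ext_iff]; omega) ψ
  have h2 : qf (bond N L ⟨x, by omega⟩ ⟨x + k, h⟩) ψ ≤
      (2 * ∑ z ∈ Finset.Ico x (x + k), Real.sqrt (bondEnergy ψ z)) ^ 2 := by
    rw [← Real.sq_sqrt hq]
    exact pow_le_pow_left₀ (Real.sqrt_nonneg _) h1 2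
  have h3 := sq_sum_le_card_mul_sum_sq (s := Finset.Ico x (x + k))
    (f := fun z => Real.sqrt (bondEnergy ψ z))
  simp only [Nat.card_Ico, Real.sq_sqrt (bondEnergy_nonneg ψ _), add_tsub_cancel_left] at h3
  nlinarith

theorem qf_bond_le_of_dist (hN : 0 < N) (ψ : Config N L → ℂ) {x y : Fin L} (hxy : x ≠ y) {d : ℕ}
    (h1 : (x : ℕ) ≤ y + d) (h2 : (y : ℕ) ≤ x + d) : qf (bond N L x y) ψ ≤
      4 * d * ∑ z ∈ (Finset.range (L - 1)).filter (fun z => z ≤ x + d ∧ (x : ℕ) ≤ z + d),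
        bondEnergy ψ z := by
  have key : ∀ a b : ℕ, ∀ (hab : a < b) (hb : b < L), b ≤ a + d →
      (∀ z, a ≤ z → z < b → z ≤ x + d ∧ (x : ℕ) ≤ z + d) →
      qf (bond N L ⟨a, by omega⟩ ⟨b, hb⟩) ψ ≤
      4 * d * ∑ z ∈ (Finset.range (L - 1)).filter (fun z => z ≤ x + d ∧ (x : ℕ) ≤ z + d),
        bondEnergy ψ z := by
    intro a b hab hb hd hz
    obtain ⟨k, rfl⟩ := Nat.exists_eq_add_of_lt hab
    have := qf_bond_le_sum hN ψ a (k + 1) (by omega) hb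
    refine this.trans ?_
    have hsub : ∑ z ∈ Finset.Ico a (a + (k + 1)), bondEnergy ψ z ≤
        ∑ z ∈ (Finset.range (L - 1)).filter (fun z => z ≤ x + d ∧ (x : ℕ) ≤ z + d),
        bondEnergy ψ z := by
      refine Finset.sum_le_sum_of_subset_of_nonneg (fun z hz' => ?_) fun z _ _ =>
        bondEnergy_nonneg ψ z
      rw [Finset.mem_Ico] at hz'
      rw [Finset.mem_filter, Finset.mem_range]
      exact ⟨by omega, hz z hz'.1 hz'.2⟩
    have hk : ((k + 1 : ℕ) : ℝ) ≤ d := by exact_mod_cast (by omega : k + 1 ≤ d)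
    have h0 : 0 ≤ ∑ z ∈ Finset.Ico a (a + (k + 1)), bondEnergy ψ z :=
      Finset.sum_nonneg fun z _ => bondEnergy_nonneg ψ z
    have hk0 : (0 : ℝ) ≤ ((k + 1 : ℕ) : ℝ) := Nat.cast_nonneg _
    nlinarith [mul_le_mul hk hsub h0 (hk0.trans hk)]
  rcases lt_or_gt_of_ne hxy with h | h
  · exact key x y h y.2 h2 fun z hz1 hz2 => by omega
  · rw [bond_comm hxy]
    exact key y x h x.2 h1 fun z hz1 hz2 => by omega

end Blobs

end HeisenbergChain
end

noncomputable section

namespace HeisenbergChain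

open Matrix

/-! ### Particles are rarely close at low energy. -/

section Coincidences

variable {N L : ℕ}

/-- A state with exactly `n` particles. -/
def HasParticles (n : ℕ) (ψ : Config N L → ℂ) : Prop := ∀ s, ψ s ≠ 0 → ∑ x, (s x : ℕ) = n

/-- No site is doubly occupied and no two neighbouring sites are both occupied. -/
def IsDilute (s : Config N L) : Prop :=
  (∀ x, (s x : ℕ) ≤ 1) ∧ ∀ x y : Fin L, (x : ℕ) + 1 = y → (s x : ℕ) = 0 ∨ (s y : ℕ) = 0

theorem sum_profile_val (η : Fin L × Fin N → Bool) :
    ∑ x, ((profile η x : ℕ) : ℝ) = ∑ a : Fin L × Fin N, if η a = true then (1 : ℝ) else 0 := by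
  rw [Fintype.sum_prod_type]
  refine Finset.sum_congr rfl fun x _ => ?_
  rw [profile_val]
  simp

/-- Over all ordered pairs, the diagonal included, the pair densities add up to the expectation of
the squared particle number. -/
theorem sum_pairDensity {n : ℕ} {ψ : Config N L → ℂ} (hψ : HasParticles n ψ) :
    ∑ a, ∑ c, pairDensity (blobAmp ψ) a c = (n : ℝ) ^ 2 * sqNorm ψ := by
  have h1 : ∑ a, ∑ c, pairDensity (blobAmp ψ) a c =
      ∑ η : Fin L × Fin N → Bool, (∑ a, if η a = true then (1 : ℝ) else 0) ^ 2 *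
        ‖blobAmp ψ η‖ ^ 2 := by
    simp only [pairDensity]
    rw [Finset.sum_congr rfl fun a _ => Finset.sum_comm, Finset.sum_comm]
    refine Finset.sum_congr rfl fun η _ => ?_
    rw [sq (∑ a, _), Finset.sum_mul_sum, Finset.sum_mul]
    refine Finset.sum_congr rfl fun a _ => ?_
    rw [Finset.sum_mul]
    refine Finset.sum_congr rfl fun c _ => ?_
    by_cases h : η a = true <;> by_cases h' : η c = true <;> simp [h, h']
  rw [h1, ← sum_norm_sq_blobAmp ψ, Finset.mul_sum]
  refine Finset.sum_congr rfl fun η _ => ?_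
  by_cases h : ψ (profile η) = 0
  · simp [blobAmp, relAmp, h]
  · rw [← sum_profile_val, ← hψ _ h]
    push_cast
    rfl

/-- Pairs of distinct spins on equal or neighbouring sites. -/
def closePairs (N L : ℕ) : Finset ((Fin L × Fin N) × (Fin L × Fin N)) :=
  Finset.univ.filter fun p => p.1 ≠ p.2 ∧ (p.1.1 : ℕ) ≤ p.2.1 + 1 ∧ (p.2.1 : ℕ) ≤ p.1.1 + 1

theorem exists_closePair {η : Fin L × Fin N → Bool} (h : ¬ IsDilute (profile η)) :
    ∃ p ∈ closePairs N L, η p.1 = true ∧ η p.2 = true := by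
  rw [IsDilute, not_and_or] at h
  rcases h with h | h
  · push Not at h
    obtain ⟨x, hx⟩ := h
    rw [profile_val, Finset.one_lt_card] at hx
    obtain ⟨i, hi, j, hj, hij⟩ := hx
    refine ⟨((x, i), (x, j)), ?_, by simpa using hi, by simpa using hj⟩
    simp [closePairs, hij]
  · push Not at h
    obtain ⟨x, y, hxy, hx, hy⟩ := h
    rw [profile_val, Finset.card_ne_zero] at hx hy
    obtain ⟨i, hi⟩ := hx
    obtain ⟨j, hj⟩ := hy
    refine ⟨((x, i), (y, j)), ?_, by simpa using hi, by simpa using hj⟩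
    have : x ≠ y := fun h => by rw [h] at hxy; omega
    simp only [closePairs, Finset.mem_filter, Finset.mem_univ, true_and]
    exact ⟨fun h => this (congrArg Prod.fst h), by omega, by omega⟩

open Classical in
theorem sum_not_isDilute_le (ψ : Config N L → ℂ) :
    ∑ s ∈ Finset.univ.filter (fun s : Config N L => ¬ IsDilute s), ‖ψ s‖ ^ 2 ≤
      ∑ p ∈ closePairs N L, pairDensity (blobAmp ψ) p.1 p.2 := by
  have h1 : ∑ s ∈ Finset.univ.filter (fun s : Config N L => ¬ IsDilute s), ‖ψ s‖ ^ 2 =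
      ∑ η : Fin L × Fin N → Bool, if ¬ IsDilute (profile η) then ‖blobAmp ψ η‖ ^ 2 else 0 := by
    have := sum_profile (N := N) (L := L) fun s => if ¬ IsDilute s then ‖relAmp ψ s‖ ^ 2 else 0
    simp only [blobAmp]
    rw [this, Finset.sum_filter]
    refine Finset.sum_congr rfl fun s _ => ?_
    split_ifs
    · rw [mul_zero]
    · rw [norm_sq_relAmp]
  rw [h1]
  simp only [pairDensity]
  rw [Finset.sum_comm]
  refine Finset.sum_le_sum fun η _ => ?_
  have hnn : ∀ p ∈ closePairs N L,
      0 ≤ if η p.1 = true ∧ η p.2 = true then ‖blobAmp ψ η‖ ^ 2 else 0 :=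
    fun p _ => by split_ifs <;> positivity
  split_ifs with h
  · exact Finset.sum_nonneg hnn
  · obtain ⟨p, hp, hp2⟩ := exists_closePair h
    refine le_trans (le_of_eq ?_) (Finset.single_le_sum hnn hp)
    rw [if_pos hp2]

/-- The sites at distance less than `d` from `x`. -/
def window (d : ℕ) (x : Fin L) : Finset (Fin L) :=
  Finset.univ.filter fun y => (x : ℕ) < y + d ∧ (y : ℕ) < x + d

/-- Since `2 d ≤ L`, there are `d` sites starting at `x` and going to the right, or else to the
left. -/
theorem le_card_window {d : ℕ} (hd : 2 * d ≤ L) (x : Fin L) : d ≤ (window d x).card := by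
  have hinj : Function.Injective fun r : Fin d =>
      (if h : (x : ℕ) + d ≤ L then (⟨x + r, by omega⟩ : Fin L) else ⟨x - r, by omega⟩) := by
    intro r r' h
    by_cases hx : (x : ℕ) + d ≤ L
    · simp only [hx, dif_pos, Fin.mk.injEq] at h
      ext; omega
    · simp only [hx, dif_neg, not_false_iff, Fin.mk.injEq] at h
      ext; omega
  have := Finset.card_le_card_of_injOn (s := (Finset.univ : Finset (Fin d))) (t := window d x) _
    (fun r _ => ?_) hinj.injOn
  · simpa using this
  · simp only [window, Finset.mem_univ, true_and, Finset.coe_filter]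
    by_cases hx : (x : ℕ) + d ≤ L
    · have := r.2
      simp only [hx, dif_pos]
      exact ⟨by simp; omega, by simp⟩
    · have := r.2
      simp only [hx, dif_neg, not_false_iff]
      exact ⟨by simp; omega, by simp; omega⟩

theorem card_window_le (d : ℕ) (x : Fin L) : (window d x).card ≤ 2 * d := by
  have := Finset.card_le_card_of_injOn (s := window d x)
    (t := Finset.Ico ((x : ℕ) + 1 - d) (x + d)) (fun y : Fin L => (y : ℕ)) (fun y hy => ?_)
    (fun a _ b _ h => Fin.ext h)
  · refine this.trans ?_
    rw [Nat.card_Ico]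
    omega
  · have hy : (x : ℕ) < y + d ∧ (y : ℕ) < x + d := by simpa [window] using hy
    simp only [Finset.coe_Ico, Set.mem_Ico]
    omega

theorem card_near_le (x d : ℕ) : (Finset.univ.filter fun y : Fin L =>
    x ≤ (y : ℕ) + d ∧ (y : ℕ) ≤ x + d).card ≤ 2 * d + 1 := by
  have := Finset.card_le_card_of_injOn (s := Finset.univ.filter fun y : Fin L =>
    x ≤ (y : ℕ) + d ∧ (y : ℕ) ≤ x + d)
    (t := Finset.Ico (x - d) (x + d + 1)) (fun y : Fin L => (y : ℕ)) (fun y hy => ?_)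
    (fun a _ b _ h => Fin.ext h)
  · refine this.trans ?_
    rw [Nat.card_Ico]
    omega
  · have hy : x ≤ (y : ℕ) + d ∧ (y : ℕ) ≤ x + d := by simpa using hy
    simp only [Finset.coe_Ico, Set.mem_Ico]
    omega

/-- The energy of the bonds at distance at most `d` from `x`. -/
def localEnergy (ψ : Config N L → ℂ) (d : ℕ) (x : Fin L) : ℝ :=
  ∑ z ∈ (Finset.range (L - 1)).filter (fun z => z ≤ x + d ∧ (x : ℕ) ≤ z + d), bondEnergy ψ z

theorem localEnergy_nonneg (ψ : Config N L → ℂ) (d : ℕ) (x : Fin L) : 0 ≤ localEnergy ψ d x :=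
  Finset.sum_nonneg fun z _ => bondEnergy_nonneg ψ z

theorem sum_localEnergy_le (ψ : Config N L → ℂ) (d : ℕ) :
    ∑ x, localEnergy ψ d x ≤ (2 * d + 1) * qf (hamiltonian N L) ψ := by
  simp only [localEnergy, Finset.sum_filter]
  rw [Finset.sum_comm, qf_hamiltonian_eq_sum_bondEnergy, Finset.mul_sum]
  refine Finset.sum_le_sum fun z _ => ?_
  rw [← Finset.sum_filter, Finset.sum_const, nsmul_eq_mul]
  refine mul_le_mul_of_nonneg_right ?_ (bondEnergy_nonneg ψ z)
  have h := card_near_le (L := L) z d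
  have h2 : (Finset.univ.filter fun x : Fin L => z ≤ (x : ℕ) + d ∧ (x : ℕ) ≤ z + d).card ≤ 2 * d + 1 := h
  exact_mod_cast h2

/-- The constant `4 d` of `qf_bond_le_of_dist` is divided by the factor `N² / 4` of
`qf_bond_eq_permDefect`. -/
theorem permDefect_le_localEnergy (hN : 0 < N) (ψ : Config N L → ℂ) {d : ℕ} {x y : Fin L}
    (hy : y ∈ window d x) (i : Fin N) : permDefect (blobAmp ψ) (Equiv.swap (x, i) (y, i)) ≤
      16 * d / (N : ℝ) ^ 2 * localEnergy ψ d x := by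
  have hN' : (0 : ℝ) < N := by exact_mod_cast hN
  by_cases hxy : x = y
  · subst hxy
    rw [permDefect_blobAmp_same]
    have := localEnergy_nonneg ψ d x
    positivity
  · have hw : (x : ℕ) < y + d ∧ (y : ℕ) < x + d := by simpa [window] using hy
    have h1 := qf_bond_le_of_dist hN ψ hxy (d := d) hw.1.le hw.2.le
    rw [qf_bond_eq_permDefect hxy ψ i i] at h1
    change _ ≤ 4 * d * localEnergy ψ d x at h1
    rw [div_mul_eq_mul_div, le_div_iff₀ (by positivity)]
    nlinarith

/-- In states with few particles and small energy, particles are unlikely to be close. -/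
theorem sum_not_isDilute_le_energy (hN : 0 < N) {n : ℕ} {ψ : Config N L → ℂ}
    (hψ : HasParticles n ψ) {d : ℕ} (hd0 : 0 < d) (hd : 2 * d ≤ L) :
    d * ∑ p ∈ closePairs N L, pairDensity (blobAmp ψ) p.1 p.2 ≤
      6 * (n : ℝ) ^ 2 * sqNorm ψ + 576 * (d : ℝ) ^ 3 * qf (hamiltonian N L) ψ := by
  have hN' : (0 : ℝ) < N := by exact_mod_cast hN
  have hρ0 : ∀ a b, 0 ≤ pairDensity (blobAmp ψ) a b := fun a b =>
    Finset.sum_nonneg fun η _ => by split_ifs <;> positivity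
  -- Average over new positions `y` of the second particle. Moving it there costs twice the exchange
  -- defect, at most `16 d / N²` times the local energy; over at most `2 d` sites this gives `64 d²
  -- / N²`.
  have hstep : ∀ p ∈ closePairs N L, d * pairDensity (blobAmp ψ) p.1 p.2 ≤
      ∑ y : Fin L, 2 * pairDensity (blobAmp ψ) p.1 (y, p.2.2) +
        64 * (d : ℝ) ^ 2 / (N : ℝ) ^ 2 * localEnergy ψ d p.2.1 := by
    intro p hp
    have hne : p.1 ≠ p.2 := (Finset.mem_filter.mp hp).2.1
    have hle := localEnergy_nonneg ψ d p.2.1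
    calc d * pairDensity (blobAmp ψ) p.1 p.2
        ≤ (window d p.2.1).card * pairDensity (blobAmp ψ) p.1 p.2 :=
          mul_le_mul_of_nonneg_right (by exact_mod_cast le_card_window hd p.2.1) (hρ0 _ _)
      _ = ∑ y ∈ window d p.2.1, pairDensity (blobAmp ψ) p.1 p.2 := by
          rw [Finset.sum_const, nsmul_eq_mul]
      _ ≤ ∑ y ∈ window d p.2.1, (2 * pairDensity (blobAmp ψ) p.1 (y, p.2.2) +
            2 * (16 * d / (N : ℝ) ^ 2 * localEnergy ψ d p.2.1)) := by
          refine Finset.sum_le_sum fun y hy => ?_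
          have h1 := pairDensity_le (blobAmp ψ) hne (y, p.2.2)
          have h2 := permDefect_le_localEnergy hN ψ hy p.2.2
          have h3 : ((p.2.1, p.2.2) : Fin L × Fin N) = p.2 := rfl
          rw [h3] at h2
          linarith
      _ = ∑ y ∈ window d p.2.1, 2 * pairDensity (blobAmp ψ) p.1 (y, p.2.2) +
            (window d p.2.1).card * (2 * (16 * d / (N : ℝ) ^ 2 * localEnergy ψ d p.2.1)) := by
          rw [Finset.sum_add_distrib, Finset.sum_const, nsmul_eq_mul]
      _ ≤ _ := by
          refine add_le_add (Finset.sum_le_sum_of_subset_of_nonneg (Finset.subset_univ _)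
            fun y _ _ => mul_nonneg zero_le_two (hρ0 _ _)) ?_
          have hc : ((window d p.2.1).card : ℝ) ≤ 2 * d := by exact_mod_cast card_window_le d p.2.1
          calc _ ≤ 2 * d * (2 * (16 * d / (N : ℝ) ^ 2 * localEnergy ψ d p.2.1)) :=
                mul_le_mul_of_nonneg_right hc (by positivity)
            _ = _ := by ring
  have hnear : ∀ x : Fin L, ((Finset.univ.filter fun y : Fin L =>
      (x : ℕ) ≤ (y : ℕ) + 1 ∧ (y : ℕ) ≤ x + 1).card : ℝ) ≤ 3 := fun x => by
    exact_mod_cast card_near_le (L := L) x 1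
  have hnear' : ∀ x : Fin L, ((Finset.univ.filter fun y : Fin L =>
      (y : ℕ) ≤ (x : ℕ) + 1 ∧ (x : ℕ) ≤ y + 1).card : ℝ) ≤ 3 := fun x => by
    have := hnear x
    simpa only [and_comm] using this
  -- At most three sites are equal or adjacent to a given one, and summing over `y` restores the
  -- full pair sum: `6 = 3 · 2`.
  have hA : ∑ p ∈ closePairs N L, ∑ y : Fin L, 2 * pairDensity (blobAmp ψ) p.1 (y, p.2.2) ≤
      6 * (n : ℝ) ^ 2 * sqNorm ψ := by
    calc ∑ p ∈ closePairs N L, ∑ y : Fin L, 2 * pairDensity (blobAmp ψ) p.1 (y, p.2.2)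
        ≤ ∑ p : (Fin L × Fin N) × (Fin L × Fin N),
            if (p.1.1 : ℕ) ≤ p.2.1 + 1 ∧ (p.2.1 : ℕ) ≤ p.1.1 + 1 then
              ∑ y : Fin L, 2 * pairDensity (blobAmp ψ) p.1 (y, p.2.2) else 0 := by
          rw [← Finset.sum_filter]
          refine Finset.sum_le_sum_of_subset_of_nonneg (fun p hp => ?_) fun p _ _ =>
            Finset.sum_nonneg fun y _ => mul_nonneg zero_le_two (hρ0 _ _)
          exact Finset.mem_filter.mpr ⟨Finset.mem_univ _, (Finset.mem_filter.mp hp).2.2⟩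
      _ = ∑ a : Fin L × Fin N, ((Finset.univ.filter fun y : Fin L =>
            (a.1 : ℕ) ≤ (y : ℕ) + 1 ∧ (y : ℕ) ≤ a.1 + 1).card : ℝ) *
            ∑ c : Fin L × Fin N, 2 * pairDensity (blobAmp ψ) a c := by
          rw [Fintype.sum_prod_type]
          refine Finset.sum_congr rfl fun a _ => ?_
          rw [Fintype.sum_prod_type, Fintype.sum_prod_type]
          simp only
          have : ∀ x : Fin L, (∑ i : Fin N, if (a.1 : ℕ) ≤ (x : ℕ) + 1 ∧ (x : ℕ) ≤ a.1 + 1 then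
              ∑ y : Fin L, 2 * pairDensity (blobAmp ψ) a (y, i) else 0) =
              if (a.1 : ℕ) ≤ (x : ℕ) + 1 ∧ (x : ℕ) ≤ a.1 + 1 then
                ∑ y : Fin L, ∑ i : Fin N, 2 * pairDensity (blobAmp ψ) a (y, i) else 0 := by
            intro x
            split_ifs
            · exact Finset.sum_comm
            · simp
          rw [Finset.sum_congr rfl fun x _ => this x, ← Finset.sum_filter, Finset.sum_const,
            nsmul_eq_mul]
      _ ≤ ∑ a : Fin L × Fin N, 3 * ∑ c : Fin L × Fin N, 2 * pairDensity (blobAmp ψ) a c :=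
          Finset.sum_le_sum fun a _ => mul_le_mul_of_nonneg_right (hnear a.1)
            (Finset.sum_nonneg fun c _ => mul_nonneg zero_le_two (hρ0 _ _))
      _ = 6 * (n : ℝ) ^ 2 * sqNorm ψ := by
          rw [mul_assoc, ← sum_pairDensity hψ, Finset.mul_sum]
          refine Finset.sum_congr rfl fun a _ => ?_
          rw [← Finset.mul_sum]
          ring
  -- The `N²` choices of spin labels cancel the denominator; `192 = 3 · 64`, and `2 d + 1 ≤ 3 d`
  -- leads to 576.
  have hB : ∑ p ∈ closePairs N L, 64 * (d : ℝ) ^ 2 / (N : ℝ) ^ 2 * localEnergy ψ d p.2.1 ≤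
      576 * (d : ℝ) ^ 3 * qf (hamiltonian N L) ψ := by
    calc ∑ p ∈ closePairs N L, 64 * (d : ℝ) ^ 2 / (N : ℝ) ^ 2 * localEnergy ψ d p.2.1
        ≤ ∑ p : (Fin L × Fin N) × (Fin L × Fin N),
            if (p.1.1 : ℕ) ≤ p.2.1 + 1 ∧ (p.2.1 : ℕ) ≤ p.1.1 + 1 then
              64 * (d : ℝ) ^ 2 / (N : ℝ) ^ 2 * localEnergy ψ d p.2.1 else 0 := by
          rw [← Finset.sum_filter]
          refine Finset.sum_le_sum_of_subset_of_nonneg (fun p hp => ?_) fun p _ _ =>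
            mul_nonneg (by positivity) (localEnergy_nonneg _ _ _)
          exact Finset.mem_filter.mpr ⟨Finset.mem_univ _, (Finset.mem_filter.mp hp).2.2⟩
      _ = ∑ x : Fin L, (N : ℝ) ^ 2 * (((Finset.univ.filter fun y : Fin L =>
            (y : ℕ) ≤ (x : ℕ) + 1 ∧ (x : ℕ) ≤ y + 1).card : ℝ) *
            (64 * (d : ℝ) ^ 2 / (N : ℝ) ^ 2 * localEnergy ψ d x)) := by
          rw [Fintype.sum_prod_type, Finset.sum_comm, Fintype.sum_prod_type]
          refine Finset.sum_congr rfl fun x _ => ?_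
          simp only [Fintype.sum_prod_type, Finset.sum_const, Finset.card_univ, Fintype.card_fin]
          have hc : ∀ y : Fin L, (∑ _i : Fin N, if (y : ℕ) ≤ x + 1 ∧ (x : ℕ) ≤ y + 1 then
              64 * (d : ℝ) ^ 2 / (N : ℝ) ^ 2 * localEnergy ψ d x else 0) =
              N • (if (y : ℕ) ≤ x + 1 ∧ (x : ℕ) ≤ y + 1 then
              64 * (d : ℝ) ^ 2 / (N : ℝ) ^ 2 * localEnergy ψ d x else 0) := fun y => by
            rw [Finset.sum_const, Finset.card_univ, Fintype.card_fin]
          rw [Finset.sum_congr rfl fun y _ => hc y, ← Finset.smul_sum, ← Finset.sum_filter,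
            Finset.sum_const]
          simp only [nsmul_eq_mul]
          ring
      _ ≤ ∑ x : Fin L, (N : ℝ) ^ 2 * (3 *
            (64 * (d : ℝ) ^ 2 / (N : ℝ) ^ 2 * localEnergy ψ d x)) := by
          refine Finset.sum_le_sum fun x _ => mul_le_mul_of_nonneg_left
            (mul_le_mul_of_nonneg_right (hnear' x) ?_) (by positivity)
          have := localEnergy_nonneg ψ d x
          positivity
      _ = 192 * (d : ℝ) ^ 2 * ∑ x : Fin L, localEnergy ψ d x := by
          rw [Finset.mul_sum]
          refine Finset.sum_congr rfl fun x _ => ?_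
          field_simp
          ring
      _ ≤ 192 * (d : ℝ) ^ 2 * ((2 * d + 1) * qf (hamiltonian N L) ψ) :=
          mul_le_mul_of_nonneg_left (sum_localEnergy_le ψ d) (by positivity)
      _ ≤ 192 * (d : ℝ) ^ 2 * ((3 * d) * qf (hamiltonian N L) ψ) := by
          have h1 : (1 : ℝ) ≤ d := by exact_mod_cast hd0
          have := qf_hamiltonian_nonneg ψ
          gcongr
          linarith
      _ = _ := by ring
  rw [Finset.mul_sum]
  calc _ ≤ _ := Finset.sum_le_sum hstep
    _ = _ := Finset.sum_add_distrib
    _ ≤ _ := add_le_add hA hB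

end Coincidences

end HeisenbergChain
end

noncomputable section

namespace HeisenbergChain

open Matrix

/-! ### Occupation numbers of tuples. -/

section Occupation

variable {α : Type*} [Fintype α] [DecidableEq α]

/-- The occupation numbers of a tuple. -/
def occ {n : ℕ} {α : Type*} [DecidableEq α] (x : Fin n → α) (a : α) : ℕ :=
  (Finset.univ.filter fun i => x i = a).card

theorem sum_occ {n : ℕ} (x : Fin n → α) : ∑ a, occ x a = n := by
  have := Finset.card_eq_sum_card_fiberwise (f := x) (s := Finset.univ) (t := Finset.univ)
    (fun _ _ => Finset.mem_coe.mpr (Finset.mem_univ _))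
  simpa [occ] using this.symm

theorem exists_occ_eq {n : ℕ} (f : α → ℕ) (hf : ∑ a, f a = n) : ∃ x : Fin n → α, occ x = f := by
  let e : Fin n ≃ Σ a, Fin (f a) := (Fintype.equivFinOfCardEq (by simp [hf])).symm
  refine ⟨fun i => (e i).1, ?_⟩
  ext a
  have h1 : occ (fun i => (e i).1) a =
      (Finset.univ.filter fun p : Σ a, Fin (f a) => p.1 = a).card := by
    refine Finset.card_nbij' e e.symm ?_ ?_ ?_ ?_ <;> intro i <;> simp
  have h2 : (Finset.univ.filter fun p : Σ a, Fin (f a) => p.1 = a).card =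
      (Finset.univ : Finset (Fin (f a))).card := by
    symm
    refine Finset.card_bij (fun r _ => ⟨a, r⟩) (by simp) (fun r _ r' _ h => by simpa using h) ?_
    rintro ⟨b, r⟩ hb
    have hb : b = a := by simpa using hb
    subst hb
    exact ⟨r, by simp, rfl⟩
  rw [h1, h2, Finset.card_univ, Fintype.card_fin]

end Occupation

/-! ### Rotation symmetry, lowest weight states and reduction to few particles. -/

section TotalSpin

variable {N L : ℕ}

theorem spinThree_comm_spinMinus (N : ℕ) :
    spinThree N * spinMinus N - spinMinus N * spinThree N = -spinMinus N := by
  ext m n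
  rw [Matrix.sub_apply, spinThree, diagonal_mul, mul_diagonal, Matrix.neg_apply]
  by_cases h : (n : ℕ) = (m : ℕ) + 1
  · rw [h]; push_cast; ring
  · have : spinMinus N m n = 0 := by
      rw [spinMinus, conjTranspose_apply, spinPlus, of_apply, if_neg h, star_zero]
    rw [this]; ring

theorem spinPlus_mul_spinMinus (N : ℕ) : spinPlus N * spinMinus N =
    Matrix.diagonal fun n : Fin (N + 1) => ((n : ℕ) : ℂ) * ((N : ℂ) + 1 - (n : ℕ)) := by
  refine matrix_ext_mulVec fun v s => ?_
  -- A chain with one site turns the formula for the chain into one for the spin matrix itself.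
  have h1 := spinPlus_mulVec (L := 1) 0 (siteOp N 1 (spinMinus N) 0 *ᵥ fun t => v (t 0)) fun _ => s
  rw [spinMinus_mulVec, mulVec_mulVec, siteOp_mul, siteOp_mulVec] at h1
  simp only [Function.update_self, sub_add_cancel] at h1
  rw [mulVec, dotProduct, h1, mulVec_diagonal, ← mul_assoc]
  congr 1
  by_cases hs : s = 0
  · simp [hs]
  · have hpos : 0 < (s : ℕ) := Fin.pos_iff_ne_zero.mpr hs
    rw [Fin.val_sub_one_of_ne_zero hs, Nat.cast_sub (by omega), ← Complex.ofReal_mul]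
    have hc := cast_le_N s
    have e1 : (((s : ℕ) : ℝ) - (1 : ℕ) + 1) * ((N : ℝ) - (((s : ℕ) : ℝ) - (1 : ℕ))) =
        ((s : ℕ) : ℝ) * ((N : ℝ) + 1 - (s : ℕ)) := by push_cast; ring
    rw [e1, Real.mul_self_sqrt (mul_nonneg (Nat.cast_nonneg _) (by linarith))]
    push_cast
    ring

theorem spinMinus_mul_spinPlus (N : ℕ) : spinMinus N * spinPlus N =
    Matrix.diagonal fun n : Fin (N + 1) => (((n : ℕ) : ℂ) + 1) * ((N : ℂ) - (n : ℕ)) := by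
  refine matrix_ext_mulVec fun v s => ?_
  have h1 := spinMinus_mulVec (L := 1) 0 (siteOp N 1 (spinPlus N) 0 *ᵥ fun t => v (t 0)) fun _ => s
  rw [spinPlus_mulVec, mulVec_mulVec, siteOp_mul, siteOp_mulVec] at h1
  simp only [Function.update_self, add_sub_cancel_right] at h1
  rw [mulVec, dotProduct, h1, mulVec_diagonal, ← mul_assoc]
  congr 1
  by_cases hs : s = Fin.last N
  · simp [hs]
  · have hlt : s < Fin.last N := lt_of_le_of_ne (Fin.le_last _) hs
    rw [Fin.val_add_one_of_lt hlt, ← Complex.ofReal_mul]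
    have hc := cast_le_N s
    have e1 : ((((s : ℕ) + 1 : ℕ) : ℝ)) * ((N : ℝ) + 1 - (((s : ℕ) + 1 : ℕ))) =
        (((s : ℕ) : ℝ) + 1) * ((N : ℝ) - (s : ℕ)) := by push_cast; ring
    rw [e1, Real.mul_self_sqrt (mul_nonneg (by positivity) (by linarith))]
    push_cast
    ring

theorem spinPlus_comm_spinMinus (N : ℕ) :
    spinPlus N * spinMinus N - spinMinus N * spinPlus N = (2 : ℂ) • spinThree N := by
  rw [spinPlus_mul_spinMinus, spinMinus_mul_spinPlus, spinThree, ← diagonal_smul]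
  ext m n
  by_cases h : m = n
  · subst h
    simp
    ring
  · simp [h]

theorem spin_casimir (N : ℕ) : spinThree N * spinThree N +
    (1 / 2 : ℂ) • (spinPlus N * spinMinus N + spinMinus N * spinPlus N) =
      ((N : ℂ) / 2 * ((N : ℂ) / 2 + 1)) • (1 : Matrix (Fin (N + 1)) (Fin (N + 1)) ℂ) := by
  rw [spinPlus_mul_spinMinus, spinMinus_mul_spinPlus, spinThree, diagonal_mul_diagonal]
  ext m n
  by_cases h : m = n
  · subst h
    simp
    ring
  · simp [h]

/-- The total lowering operator. -/
def totalMinus (N L : ℕ) : Matrix (Config N L) (Config N L) ℂ := ∑ x, siteOp N L (spinMinus N) x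

/-- The total raising operator. -/
def totalPlus (N L : ℕ) : Matrix (Config N L) (Config N L) ℂ := ∑ x, siteOp N L (spinPlus N) x

/-- The total third component of the spin. -/
def totalThree (N L : ℕ) : Matrix (Config N L) (Config N L) ℂ := ∑ x, siteOp N L (spinThree N) x

theorem totalPlus_comm_totalMinus : totalPlus N L * totalMinus N L - totalMinus N L * totalPlus N L =
    (2 : ℂ) • totalThree N L := by
  rw [totalPlus, totalMinus, totalThree, Finset.sum_mul_sum, Finset.sum_mul_sum, Finset.smul_sum]
  rw [Finset.sum_comm (f := fun x y => siteOp N L (spinMinus N) x * siteOp N L (spinPlus N) y),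
    ← Finset.sum_sub_distrib]
  refine Finset.sum_congr rfl fun x _ => ?_
  rw [← Finset.sum_sub_distrib, Finset.sum_eq_single x]
  · rw [siteOp_mul, siteOp_mul, ← siteOp_sub, spinPlus_comm_spinMinus, siteOp_smul]
  · intro y _ hy
    rw [siteOp_comm _ _ hy.symm, sub_self]
  · simp

/-- Rotation invariance of the scalar product: other sites commute with the bond, and for `x` and
`y` the commutation relations make all terms cancel. -/
theorem bond_mul_totalMinus {x y : Fin L} (hxy : x ≠ y) :
    bond N L x y * totalMinus N L = totalMinus N L * bond N L x y := by
  have hdot : spinDot N L x y * totalMinus N L = totalMinus N L * spinDot N L x y := by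
    rw [totalMinus, Finset.mul_sum, Finset.sum_mul, ← sub_eq_zero, ← Finset.sum_sub_distrib,
      ← Finset.add_sum_erase _ _ (Finset.mem_univ x),
      ← Finset.add_sum_erase _ _ (Finset.mem_erase.mpr ⟨hxy.symm, Finset.mem_univ y⟩),
      Finset.sum_eq_zero]
    · have a1 : ∀ A B : Matrix (Fin (N + 1)) (Fin (N + 1)) ℂ,
        siteOp N L A y * siteOp N L B x = siteOp N L B x * siteOp N L A y :=
        fun A B => siteOp_comm A B hxy.symm
      have h3 : ∀ z : Fin L, siteOp N L (spinThree N) z * siteOp N L (spinMinus N) z =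
          siteOp N L (spinMinus N) z * siteOp N L (spinThree N) z - siteOp N L (spinMinus N) z := by
        intro z
        rw [siteOp_mul, siteOp_mul, ← siteOp_sub]
        congr 1
        have := spinThree_comm_spinMinus N
        rw [sub_eq_iff_eq_add] at this
        rw [this]; abel
      have hp : ∀ z : Fin L, siteOp N L (spinPlus N) z * siteOp N L (spinMinus N) z =
          siteOp N L (spinMinus N) z * siteOp N L (spinPlus N) z +
            (2 : ℂ) • siteOp N L (spinThree N) z := by
        intro z
        rw [siteOp_mul, siteOp_mul, ← siteOp_smul, ← siteOp_add]
        congr 1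
        have := spinPlus_comm_spinMinus N
        rw [sub_eq_iff_eq_add] at this
        rw [this]; abel
      rw [spinDot_eq]
      generalize hA : siteOp N L (spinThree N) x = A at *
      generalize hB : siteOp N L (spinThree N) y = B at *
      generalize hP : siteOp N L (spinPlus N) x = P at *
      generalize hQ : siteOp N L (spinPlus N) y = Q at *
      generalize hM : siteOp N L (spinMinus N) x = M at *
      generalize hK : siteOp N L (spinMinus N) y = K at *
      have h3x := h3 x
      have h3y := h3 y
      have hpx := hp x
      have hpy := hp y
      have c1 := a1 (spinThree N) (spinMinus N)
      have c2 := a1 (spinMinus N) (spinMinus N)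
      have c3 := a1 (spinPlus N) (spinMinus N)
      have c4 := a1 (spinMinus N) (spinThree N)
      have c5 := a1 (spinMinus N) (spinPlus N)
      rw [hA, hM] at h3x
      rw [hB, hK] at h3y
      rw [hA, hP, hM] at hpx
      rw [hB, hQ, hK] at hpy
      rw [hB, hM] at c1
      rw [hK, hM] at c2
      rw [hQ, hM] at c3
      rw [hK, hA] at c4
      rw [hK, hP] at c5
      have e1 : A * B * M = M * A * B - M * B := by
        rw [mul_assoc, c1, ← mul_assoc, h3x, sub_mul]
      have e2 : P * K * M = M * P * K + (2 : ℂ) • (A * K) := by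
        rw [mul_assoc, c2, ← mul_assoc, hpx, add_mul, smul_mul_assoc]
      have e3 : M * Q * M = M * M * Q := by rw [mul_assoc, c3, ← mul_assoc]
      have e4 : A * B * K = K * A * B - A * K := by
        rw [mul_assoc, h3y, mul_sub, ← mul_assoc, c4]
      have e5 : P * K * K = K * P * K := by rw [c5]
      have e6 : M * Q * K = K * M * Q + (2 : ℂ) • (M * B) := by
        rw [mul_assoc, hpy, mul_add, ← mul_assoc, c2, mul_smul_comm]
      simp only [add_mul, mul_add, smul_mul_assoc, mul_smul_comm, e1, e2, e3, e4, e5, e6,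
        smul_add, smul_smul, ← mul_assoc]
      norm_num
      abel
    · intro z hz
      have hzy : z ≠ y := Finset.ne_of_mem_erase hz
      have hzx : z ≠ x := Finset.ne_of_mem_erase (Finset.mem_of_mem_erase hz)
      rw [sub_eq_zero, spinDot, Finset.sum_mul, Finset.mul_sum]
      refine Finset.sum_congr rfl fun a _ => ?_
      rw [mul_assoc, siteOp_comm _ _ hzy.symm, ← mul_assoc, siteOp_comm _ _ hzx.symm, mul_assoc]
  rw [bond, sub_mul, mul_sub, hdot]
  simp

theorem hamiltonian_mul_totalMinus :
    hamiltonian N L * totalMinus N L = totalMinus N L * hamiltonian N L := by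
  rw [hamiltonian_eq, Finset.sum_mul, Finset.mul_sum]
  exact Finset.sum_congr rfl fun x _ => bond_mul_totalMinus (left_ne_right _ _ _)

theorem sum_spinDot : ∑ x : Fin L, ∑ y : Fin L, spinDot N L x y =
    totalThree N L * totalThree N L + (1 / 2 : ℂ) •
      (totalPlus N L * totalMinus N L + totalMinus N L * totalPlus N L) := by
  simp only [spinDot_eq, Finset.sum_add_distrib, ← Finset.smul_sum, totalThree, totalPlus,
    totalMinus, Finset.sum_mul_sum]

theorem spinDot_self (x : Fin L) : spinDot N L x x =
    ((N : ℂ) / 2 * ((N : ℂ) / 2 + 1)) • (1 : Matrix (Config N L) (Config N L) ℂ) := by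
  rw [spinDot_eq, siteOp_mul, siteOp_mul, siteOp_mul, ← siteOp_add, ← siteOp_smul, ← siteOp_add,
    spin_casimir, siteOp_smul, siteOp_one]

/-- The scalar products over all ordered pairs add up to the square of the total spin. A diagonal
term is `S (S + 1)` instead of `S²`; the correction `S` for each `x = y` completes the constant to
`(N L / 2)(N L / 2 + 1)`. -/
theorem sum_bond : ∑ x : Fin L, ∑ y : Fin L, (if x = y then 0 else bond N L x y) =
    ((N * L : ℂ) / 2 * ((N * L : ℂ) / 2 + 1)) • (1 : Matrix (Config N L) (Config N L) ℂ) -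
      (totalThree N L * totalThree N L - totalThree N L + totalPlus N L * totalMinus N L) := by
  have h1 : ∀ x y : Fin L, (if x = y then 0 else bond N L x y) =
      ((N : ℂ) / 2) ^ 2 • (1 : Matrix (Config N L) (Config N L) ℂ) - spinDot N L x y +
      (if x = y then ((N : ℂ) / 2) • (1 : Matrix (Config N L) (Config N L) ℂ) else 0) := by
    intro x y
    by_cases h : x = y
    · subst h
      rw [if_pos rfl, if_pos rfl, spinDot_self]
      module
    · rw [if_neg h, if_neg h, add_zero, bond]
  have h2 : totalMinus N L * totalPlus N L = totalPlus N L * totalMinus N L -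
      (2 : ℂ) • totalThree N L := by
    rw [← totalPlus_comm_totalMinus]; abel
  simp only [h1, Finset.sum_add_distrib, Finset.sum_sub_distrib, sum_spinDot, h2,
    Finset.sum_ite_eq, Finset.mem_univ, if_true, Finset.sum_const, Finset.card_univ,
    Fintype.card_fin, ← Nat.cast_smul_eq_nsmul ℂ]
  module

theorem totalThree_mulVec {n : ℕ} {ψ : Config N L → ℂ} (hψ : HasParticles n ψ) :
    totalThree N L *ᵥ ψ = ((n : ℂ) - (N * L : ℂ) / 2) • ψ := by
  ext s
  rw [totalThree, sum_mulVec, Finset.sum_apply, Pi.smul_apply, smul_eq_mul]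
  simp only [spinThree_mulVec]
  rw [← Finset.sum_mul]
  by_cases h : ψ s = 0
  · rw [h, mul_zero, mul_zero]
  · rw [Finset.sum_sub_distrib, ← hψ s h]
    congr 2
    · push_cast; rfl
    · simp; ring

theorem totalMinus_conjTranspose : (totalMinus N L)ᴴ = totalPlus N L := by
  rw [totalMinus, totalPlus, conjTranspose_sum]
  refine Finset.sum_congr rfl fun x _ => ?_
  rw [siteOp_conjTranspose, spinMinus, conjTranspose_conjTranspose]

theorem smul_one_mulVec {ι : Type*} [Fintype ι] [DecidableEq ι] (c : ℂ) (v : ι → ℂ) :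
    (c • (1 : Matrix ι ι ℂ)) *ᵥ v = c • v := by rw [smul_mulVec, one_mulVec]

theorem qf_eq_of_mulVec {ι : Type*} [Fintype ι] {A : Matrix ι ι ℂ} {v : ι → ℂ} {c : ℝ}
    (h : A *ᵥ v = (c : ℂ) • v) : qf A v = c * sqNorm v := by
  rw [qf, h, dotProduct_smul, ← sqNorm_eq_dotProduct, smul_eq_mul, ← Complex.ofReal_mul,
    Complex.ofReal_re]

/-- With `J = N L / 2`, a lowest weight state with `n` particles has total spin `J - n`, and `J (J +
1) - (J - n)(J - n + 1) = n (2 J - n + 1)`. -/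
theorem sum_qf_bond {n : ℕ} {ψ : Config N L → ℂ} (hψ : HasParticles n ψ)
    (h0 : totalMinus N L *ᵥ ψ = 0) :
    ∑ x : Fin L, ∑ y : Fin L, (if x = y then 0 else qf (bond N L x y) ψ) =
      n * ((N : ℝ) * L - n + 1) * sqNorm ψ := by
  have h1 : ∑ x : Fin L, ∑ y : Fin L, (if x = y then 0 else qf (bond N L x y) ψ) =
      qf (∑ x : Fin L, ∑ y : Fin L, (if x = y then 0 else bond N L x y)) ψ := by
    rw [qf_sum]
    refine Finset.sum_congr rfl fun x _ => ?_
    rw [qf_sum]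
    refine Finset.sum_congr rfl fun y _ => ?_
    split_ifs
    · simp [qf]
    · rfl
  rw [h1]
  apply qf_eq_of_mulVec
  rw [sum_bond, sub_mulVec, add_mulVec, sub_mulVec, ← mulVec_mulVec, ← mulVec_mulVec, h0,
    totalThree_mulVec hψ, mulVec_smul, totalThree_mulVec hψ, smul_one_mulVec, mulVec_zero]
  push_cast
  module

theorem qf_bond_le_hamiltonian (hN : 0 < N) {x y : Fin L} (hxy : x ≠ y) (ψ : Config N L → ℂ) :
    qf (bond N L x y) ψ ≤ 4 * L * qf (hamiltonian N L) ψ := by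
  have h := qf_bond_le_of_dist hN ψ hxy (d := L) (by omega) (by omega)
  refine h.trans (mul_le_mul_of_nonneg_left ?_ (by positivity))
  rw [qf_hamiltonian_eq_sum_bondEnergy]
  exact Finset.sum_le_sum_of_subset_of_nonneg (Finset.filter_subset _ _) fun z _ _ =>
    bondEnergy_nonneg ψ z

/-- The energy of lowest weight states. -/
theorem lowest_weight_energy (hN : 0 < N) {n : ℕ} {ψ : Config N L → ℂ} (hψ : HasParticles n ψ)
    (h0 : totalMinus N L *ᵥ ψ = 0) :
    n * ((N : ℝ) * L - n + 1) * sqNorm ψ ≤ 4 * (L : ℝ) ^ 3 * qf (hamiltonian N L) ψ := by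
  rw [← sum_qf_bond hψ h0]
  have hq := qf_hamiltonian_nonneg ψ
  calc ∑ x : Fin L, ∑ y : Fin L, (if x = y then 0 else qf (bond N L x y) ψ)
      ≤ ∑ x : Fin L, ∑ y : Fin L, 4 * L * qf (hamiltonian N L) ψ := by
        refine Finset.sum_le_sum fun x _ => Finset.sum_le_sum fun y _ => ?_
        split_ifs with h
        · positivity
        · exact qf_bond_le_hamiltonian hN h ψ
    _ = _ := by simp; ring

/-- As `totalMinus` annihilates `ψ`, the raised state has squared norm `(N L - 2 n) ‖ψ‖²`, which
cannot be negative. -/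
theorem two_mul_le_of_lowest_weight {n : ℕ} {ψ : Config N L → ℂ} (hψ : HasParticles n ψ)
    (h0 : totalMinus N L *ᵥ ψ = 0) (hne : ψ ≠ 0) : 2 * n ≤ N * L := by
  have h1 : star (totalPlus N L *ᵥ ψ) ⬝ᵥ (totalPlus N L *ᵥ ψ) =
      star ψ ⬝ᵥ ((totalMinus N L * totalPlus N L) *ᵥ ψ) := by
    rw [star_mulVec, ← dotProduct_mulVec, mulVec_mulVec, ← totalMinus_conjTranspose,
      conjTranspose_conjTranspose]
  have h2 : totalMinus N L * totalPlus N L = totalPlus N L * totalMinus N L -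
      (2 : ℂ) • totalThree N L := by
    rw [← totalPlus_comm_totalMinus]; abel
  have h3 : (totalMinus N L * totalPlus N L) *ᵥ ψ = ((((N : ℝ) * L - 2 * n : ℝ)) : ℂ) • ψ := by
    rw [h2, sub_mulVec, ← mulVec_mulVec, h0, mulVec_zero, smul_mulVec, totalThree_mulVec hψ]
    push_cast
    module
  have h4 : sqNorm (totalPlus N L *ᵥ ψ) = ((N : ℝ) * L - 2 * n) * sqNorm ψ := by
    rw [sqNorm_eq_re, h1]
    exact qf_eq_of_mulVec h3
  have h5 := sqNorm_nonneg (totalPlus N L *ᵥ ψ)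
  have h6 := sqNorm_pos hne
  rw [h4] at h5
  have h7 : 0 ≤ (N : ℝ) * L - 2 * n := nonneg_of_mul_nonneg_left h5 h6
  have h8 : ((2 * n : ℕ) : ℝ) ≤ ((N * L : ℕ) : ℝ) := by push_cast; linarith
  exact_mod_cast h8

theorem sum_update_add_one (s : Config N L) (x : Fin L) (hx : s x ≠ Fin.last N) :
    ∑ z, ((Function.update s x (s x + 1) z : Fin (N + 1)) : ℕ) = ∑ z, (s z : ℕ) + 1 := by
  rw [← Finset.add_sum_erase _ _ (Finset.mem_univ x),
    ← Finset.add_sum_erase _ (fun z => (s z : ℕ)) (Finset.mem_univ x), Function.update_self,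
    Fin.val_add_one_of_lt (lt_of_le_of_ne (Fin.le_last _) hx),
    Finset.sum_congr rfl fun z hz => by rw [Function.update_of_ne (Finset.ne_of_mem_erase hz)]]
  ring

theorem hasParticles_totalMinus {n : ℕ} {ψ : Config N L → ℂ} (hψ : HasParticles (n + 1) ψ) :
    HasParticles n (totalMinus N L *ᵥ ψ) := by
  intro s hs
  rw [totalMinus, sum_mulVec, Finset.sum_apply] at hs
  obtain ⟨x, _, hx⟩ := Finset.exists_ne_zero_of_sum_ne_zero hs
  rw [spinMinus_mulVec] at hx
  have hl : s x ≠ Fin.last N := by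
    intro h
    apply hx
    simp [h]
  have := hψ _ (right_ne_zero_of_mul hx)
  rw [sum_update_add_one s x hl] at this
  omega

/-- The states with `n` particles, as a submodule. -/
def particleSpace (N L n : ℕ) : Submodule ℂ (Config N L → ℂ) where
  carrier := {ψ | HasParticles n ψ}
  add_mem' := fun {v w} hv hw s hs => by
    by_cases h : v s = 0
    · refine hw s fun h' => hs ?_
      rw [Pi.add_apply, h, h', add_zero]
    · exact hv s h
  zero_mem' := fun s hs => absurd rfl hs
  smul_mem' := fun c v hv s hs => hv s fun h => hs (by rw [Pi.smul_apply, h, smul_zero])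

/-- The states with `n` particles and energy at most `t`. -/
def lowParticleSpace (N L n : ℕ) (t : ℝ) : Submodule ℂ (Config N L → ℂ) :=
  lowSpace (hamiltonian_isHermitian N L) t ⊓ particleSpace N L n

/-- The lowering operator is injective here: its kernel consists of lowest weight states, whose
energy is at least `(n + 1) N / (8 L²) > t` by `lowest_weight_energy` and `2 (n + 1) ≤ N L`. -/
theorem finrank_lowParticleSpace_succ_le (hN : 0 < N) (hL : 0 < L) {n : ℕ} {t : ℝ}
    (ht : 8 * (L : ℝ) ^ 2 * t < (n + 1 : ℕ) * N) :
    Module.finrank ℂ (lowParticleSpace N L (n + 1) t) ≤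
      Module.finrank ℂ (lowParticleSpace N L n t) := by
  let f : lowParticleSpace N L (n + 1) t →ₗ[ℂ] lowParticleSpace N L n t :=
    ((totalMinus N L).mulVecLin).restrict fun ψ hψ =>
      ⟨mem_lowSpace_mulVec _ hamiltonian_mul_totalMinus hψ.1, hasParticles_totalMinus hψ.2⟩
  refine LinearMap.finrank_le_finrank_of_injective (f := f) ?_
  rw [← LinearMap.ker_eq_bot, LinearMap.ker_eq_bot']
  intro ψ hψ
  by_contra hne
  have hne' : ψ.1 ≠ 0 := fun h => hne (Subtype.ext h)
  have h0 : totalMinus N L *ᵥ ψ.1 = 0 := congrArg Subtype.val hψ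
  have h1 := two_mul_le_of_lowest_weight ψ.2.2 h0 hne'
  have h2 := lowest_weight_energy hN ψ.2.2 h0
  have h3 := qf_le_of_mem_lowSpace _ ψ.2.1
  have h4 := sqNorm_pos hne'
  have h5 : (2 : ℝ) * (n + 1 : ℕ) ≤ N * L := by exact_mod_cast h1
  have hL' : (0 : ℝ) < L := by exact_mod_cast hL
  set m : ℝ := ((n + 1 : ℕ) : ℝ)
  have hm : 0 < m := by simp only [m]; positivity
  set q := sqNorm ψ.1
  have h6 : m * ((N : ℝ) * L - m + 1) * q ≤ 4 * (L : ℝ) ^ 3 * (t * q) :=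
    h2.trans (mul_le_mul_of_nonneg_left h3 (by positivity))
  have h7 : m * ((N : ℝ) * L - m + 1) ≤ 4 * (L : ℝ) ^ 3 * t := by
    rw [← mul_assoc] at h6
    exact le_of_mul_le_mul_right h6 h4
  have h8 : m * (N * L / 2) ≤ m * ((N : ℝ) * L - m + 1) :=
    mul_le_mul_of_nonneg_left (by linarith) hm.le
  have h9 : 8 * (L : ℝ) ^ 2 * t * L < m * N * L := mul_lt_mul_of_pos_right ht hL'
  nlinarith

/-- Lower repeatedly: at energies up to `t`, each sector with more than `k` particles injects into
the sector with `k`. No direct control of the particle number is needed. -/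
theorem finrank_lowParticleSpace_le_min (hN : 0 < N) (hL : 0 < L) {k : ℕ} {t : ℝ}
    (ht : 8 * (L : ℝ) ^ 2 * t < (k + 1 : ℕ) * N) (n : ℕ) :
    Module.finrank ℂ (lowParticleSpace N L n t) ≤
      Module.finrank ℂ (lowParticleSpace N L (min n k) t) := by
  induction n with
  | zero => rw [Nat.zero_min]
  | succ n ih =>
    by_cases h : n + 1 ≤ k
    · rw [min_eq_left h]
    · rw [min_eq_right (by omega)]
      rw [min_eq_right (by omega)] at ih
      refine (finrank_lowParticleSpace_succ_le hN hL (lt_of_lt_of_le ht ?_)).trans ih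
      have : ((k + 1 : ℕ) : ℝ) ≤ (n + 1 : ℕ) := by exact_mod_cast (by omega)
      exact mul_le_mul_of_nonneg_right this (Nat.cast_nonneg _)

theorem sum_hop {x y : Fin L} (hxy : x ≠ y) (s : Config N L) (hx : s x ≠ 0)
    (hy : s y ≠ Fin.last N) : ∑ z, (hop x y s z : ℕ) = ∑ z, (s z : ℕ) := by
  rw [← Finset.add_sum_erase _ _ (Finset.mem_univ x),
    ← Finset.add_sum_erase _ (fun z => (s z : ℕ)) (Finset.mem_univ x),
    ← Finset.add_sum_erase _ _ (Finset.mem_erase.mpr ⟨hxy.symm, Finset.mem_univ y⟩),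
    ← Finset.add_sum_erase _ (fun z => (s z : ℕ)) (Finset.mem_erase.mpr ⟨hxy.symm, Finset.mem_univ y⟩),
    hop_apply_left hxy, hop_apply_right, Fin.val_sub_one_of_ne_zero hx,
    Fin.val_add_one_of_lt (lt_of_le_of_ne (Fin.le_last _) hy),
    Finset.sum_congr rfl fun z hz => by
      rw [hop_apply_of_ne (Finset.ne_of_mem_erase (Finset.mem_of_mem_erase hz))
        (Finset.ne_of_mem_erase hz)]]
  have hpos : 0 < (s x : ℕ) := Fin.pos_iff_ne_zero.mpr hx
  omega

theorem bond_apply_eq_zero {x y : Fin L} (hxy : x ≠ y) {s t : Config N L}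
    (hst : ∑ z, (s z : ℕ) ≠ ∑ z, (t z : ℕ)) : bond N L x y s t = 0 := by
  have h := bond_mulVec hxy (Pi.single t 1) s
  rw [mulVec_single_one, col_apply] at h
  have key : ∀ {x y : Fin L}, x ≠ y → (amp x y s : ℂ) * (Pi.single t 1 : Config N L → ℂ) (hop x y s) = 0 := by
    intro x y hxy
    by_cases hx : s x = 0
    · simp [amp, hx]
    by_cases hy : s y = Fin.last N
    · simp [amp, hy]
    have : hop x y s ≠ t := fun h => hst (by rw [← h, sum_hop hxy s hx hy])
    simp [this]
  have hne : s ≠ t := fun h => hst (by rw [h])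
  rw [h, key hxy, key hxy.symm, Pi.single_eq_of_ne hne]
  simp

/-- The projection to the states with `n` particles. -/
def particleProj (N L n : ℕ) : Matrix (Config N L) (Config N L) ℂ :=
  Matrix.diagonal fun s => if ∑ z, (s z : ℕ) = n then 1 else 0

theorem hamiltonian_mul_particleProj (n : ℕ) :
    hamiltonian N L * particleProj N L n = particleProj N L n * hamiltonian N L := by
  ext s t
  rw [particleProj, mul_diagonal, diagonal_mul]
  by_cases h : ∑ z, (s z : ℕ) = ∑ z, (t z : ℕ)
  · rw [h, mul_comm]
  · have : hamiltonian N L s t = 0 := by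
      rw [hamiltonian_eq, Matrix.sum_apply]
      exact Finset.sum_eq_zero fun x _ => bond_apply_eq_zero (left_ne_right _ _ _) h
    rw [this, zero_mul, mul_zero]

theorem sum_val_le (s : Config N L) : ∑ z, (s z : ℕ) ≤ N * L := by
  calc ∑ z, (s z : ℕ) ≤ ∑ _z : Fin L, N := Finset.sum_le_sum fun z _ => Nat.lt_succ_iff.mp (s z).2
    _ = N * L := by simp [mul_comm]

theorem finrank_lowSpace_le_sum (t : ℝ) :
    Module.finrank ℂ (lowSpace (hamiltonian_isHermitian N L) t) ≤
      ∑ n : Fin (N * L + 1), Module.finrank ℂ (lowParticleSpace N L n t) := by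
  let f : lowSpace (hamiltonian_isHermitian N L) t →ₗ[ℂ]
      (∀ n : Fin (N * L + 1), lowParticleSpace N L n t) := LinearMap.pi fun n =>
    ((particleProj N L n).mulVecLin.comp (Submodule.subtype _)).codRestrict _ fun ψ =>
      ⟨mem_lowSpace_mulVec _ (hamiltonian_mul_particleProj _) ψ.2, fun s hs => by
        simp only [LinearMap.comp_apply, mulVecLin_apply, particleProj, mulVec_diagonal] at hs
        by_contra h
        rw [if_neg h, zero_mul] at hs
        exact hs rfl⟩
  rw [← Module.finrank_pi_fintype]
  refine LinearMap.finrank_le_finrank_of_injective (f := f) ?_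
  rw [← LinearMap.ker_eq_bot, LinearMap.ker_eq_bot']
  intro ψ hψ
  apply Subtype.ext
  funext s
  have h1 := congrArg (fun v => (v ⟨∑ z, (s z : ℕ), Nat.lt_succ_of_le (sum_val_le s)⟩).1 s) hψ
  have h2 : (particleProj N L (∑ z, (s z : ℕ)) *ᵥ ψ.1) s = 0 := h1
  rw [particleProj, mulVec_diagonal, if_pos rfl, one_mul] at h2
  exact h2

/-- A configuration of `n` particles is determined by the positions of `n` labelled particles. -/
theorem finrank_lowParticleSpace_le_pow (n : ℕ) (t : ℝ) :
    Module.finrank ℂ (lowParticleSpace N L n t) ≤ L ^ n := by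
  classical
  let f : lowParticleSpace N L n t →ₗ[ℂ] ({s : Config N L // ∑ z, (s z : ℕ) = n} → ℂ) :=
    { toFun := fun v s => v.1 s.1
      map_add' := fun v w => by ext i; simp
      map_smul' := fun c v => by ext i; simp }
  have h1 := LinearMap.finrank_le_finrank_of_injective (f := f) (by
    rw [← LinearMap.ker_eq_bot, LinearMap.ker_eq_bot']
    intro v hv
    apply Subtype.ext
    funext s
    by_contra h
    exact h (congrFun hv ⟨s, v.2.2 s h⟩))
  rw [Module.finrank_fintype_fun_eq_card] at h1
  refine h1.trans ?_
  have h2 : ∀ s : {s : Config N L // ∑ z, (s z : ℕ) = n}, ∃ x : Fin n → Fin L,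
      occ x = fun z => (s.1 z : ℕ) := fun s => exists_occ_eq _ s.2
  choose g hg using h2
  have hinj : Function.Injective g := by
    intro s s' h
    apply Subtype.ext
    funext z
    have := congrFun ((hg s).symm.trans ((congrArg occ h).trans (hg s'))) z
    exact Fin.ext this
  have := Fintype.card_le_of_injective g hinj
  simpa using this

end TotalSpin

end HeisenbergChain
end

noncomputable section

namespace HeisenbergChain

/-! ### Products of one-particle modes diagonalise the form of independent particles. -/

section Modes

variable {α E K : Type*} [Fintype α] [DecidableEq α] [Fintype E] [Fintype K] [DecidableEq K]

/-- Orthonormal functions diagonalizing the Dirichlet form of a graph with edges `E`. -/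
structure IsModeSystem (src tgt : E → α) (u : K → α → ℝ) (μ : K → ℝ) : Prop where
  orthonormal : ∀ j k, ∑ a, u j a * u k a = if j = k then 1 else 0
  form : ∀ j k, ∑ e, (u j (tgt e) - u j (src e)) * (u k (tgt e) - u k (src e)) =
    if j = k then μ k else 0

/-- Products of one-particle modes. -/
def prodMode {n : ℕ} (u : K → α → ℝ) (k : Fin n → K) (y : Fin n → α) : ℝ := ∏ i, u (k i) (y i)

/-- Superposition of products of modes. -/
def synth {n : ℕ} (u : K → α → ℝ) (c : (Fin n → K) → ℂ) (y : Fin n → α) : ℂ :=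
  ∑ k, c k * (prodMode u k y : ℂ)

/-- The Dirichlet form of `n` independent particles on a graph. -/
def tupleForm {n : ℕ} (src tgt : E → α) (φ : (Fin n → α) → ℂ) : ℝ :=
  ∑ i, ∑ e, ∑ y, if y i = src e then ‖φ (Function.update y i (tgt e)) - φ y‖ ^ 2 else 0

/-- Pythagoras for orthogonal real functions with complex coefficients. Applied both to product
modes and to their discrete gradients. -/
theorem sum_norm_sq_of_gram {Y κ : Type*} [Fintype Y] [Fintype κ] [DecidableEq κ]
    (X : κ → Y → ℝ) (w : κ → ℝ) (h : ∀ k k', ∑ y, X k y * X k' y = if k = k' then w k else 0)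
    (c : κ → ℂ) : ∑ y, ‖∑ k, c k * (X k y : ℂ)‖ ^ 2 = ∑ k, w k * ‖c k‖ ^ 2 := by
  have h1 : ((∑ y, ‖∑ k, c k * (X k y : ℂ)‖ ^ 2 : ℝ) : ℂ) = ((∑ k, w k * ‖c k‖ ^ 2 : ℝ) : ℂ) := by
    push_cast
    have h2 : ∀ y, ((‖∑ k, c k * (X k y : ℂ)‖ : ℂ)) ^ 2 =
        ∑ k, ∑ k', (c k * (starRingEnd ℂ) (c k')) * ((X k y * X k' y : ℝ) : ℂ) := by
      intro y
      rw [← Complex.mul_conj', map_sum, Finset.sum_mul_sum]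
      refine Finset.sum_congr rfl fun k _ => Finset.sum_congr rfl fun k' _ => ?_
      rw [map_mul, Complex.conj_ofReal]
      push_cast
      ring
    rw [Finset.sum_congr rfl fun y _ => h2 y, Finset.sum_comm]
    refine Finset.sum_congr rfl fun k _ => ?_
    rw [Finset.sum_comm, Finset.sum_eq_single k]
    · rw [← Finset.mul_sum, ← Complex.ofReal_sum, h, if_pos rfl, Complex.mul_conj']
      ring
    · intro k' _ hk'
      rw [← Finset.mul_sum, ← Complex.ofReal_sum, h, if_neg (Ne.symm hk')]
      simp
    · simp
  exact_mod_cast h1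

theorem sum_prod_eq_prod_sum {n : ℕ} (g : Fin n → α → ℝ) :
    ∑ y : Fin n → α, ∏ i, g i (y i) = ∏ i, ∑ a, g i a := by
  rw [Finset.prod_univ_sum, Fintype.piFinset_univ]

theorem prod_ite_eq_ite {n : ℕ} (k k' : Fin n → K) :
    ∏ i, (if k i = k' i then (1 : ℝ) else 0) = if k = k' then 1 else 0 := by
  by_cases h : k = k'
  · simp [h]
  · rw [if_neg h]
    obtain ⟨i, hi⟩ := Function.ne_iff.mp h
    exact Finset.prod_eq_zero (Finset.mem_univ i) (if_neg hi)

variable {src tgt : E → α} {u : K → α → ℝ} {μ : K → ℝ}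

theorem IsModeSystem.sum_prodMode (hu : IsModeSystem src tgt u μ) {n : ℕ} (k k' : Fin n → K) :
    ∑ y, prodMode u k y * prodMode u k' y = if k = k' then 1 else 0 := by
  simp only [prodMode, ← Finset.prod_mul_distrib]
  rw [sum_prod_eq_prod_sum fun i a => u (k i) a * u (k' i) a]
  simp only [hu.orthonormal]
  exact prod_ite_eq_ite k k'

theorem IsModeSystem.sum_norm_sq_synth (hu : IsModeSystem src tgt u μ) {n : ℕ}
    (c : (Fin n → K) → ℂ) : ∑ y, ‖synth u c y‖ ^ 2 = ∑ k, ‖c k‖ ^ 2 := by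
  have := sum_norm_sq_of_gram (fun k y => prodMode u k y) (fun _ => 1) hu.sum_prodMode c
  simpa [synth] using this

theorem prodMode_update_sub {n : ℕ} (k : Fin n → K) (y : Fin n → α) (i : Fin n) (a : α) :
    prodMode u k (Function.update y i a) - prodMode u k y =
      (u (k i) a - u (k i) (y i)) * ∏ j ∈ Finset.univ.erase i, u (k j) (y j) := by
  rw [prodMode, prodMode, ← Finset.mul_prod_erase _ _ (Finset.mem_univ i),
    ← Finset.mul_prod_erase _ (fun j => u (k j) (y j)) (Finset.mem_univ i), Function.update_self,
    Finset.prod_congr rfl fun j hj => by rw [Function.update_of_ne (Finset.ne_of_mem_erase hj)]]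
  ring

/-- The gradients of product modes, indexed by particle, edge and tuple, are again orthogonal:
coordinate `i` contributes the one-particle form, the free sums over the others give Kronecker
deltas. -/
theorem IsModeSystem.tupleForm_synth (hu : IsModeSystem src tgt u μ) {n : ℕ}
    (c : (Fin n → K) → ℂ) :
    tupleForm src tgt (synth u c) = ∑ k, (∑ i, μ (k i)) * ‖c k‖ ^ 2 := by
  let X : (Fin n → K) → (Fin n × E × (Fin n → α)) → ℝ := fun k p =>
    if p.2.2 p.1 = src p.2.1 then
      prodMode u k (Function.update p.2.2 p.1 (tgt p.2.1)) - prodMode u k p.2.2 else 0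
  have hgram : ∀ k k', ∑ p, X k p * X k' p = if k = k' then ∑ i, μ (k i) else 0 := by
    intro k k'
    have h1 : ∀ i e, ∑ y : Fin n → α, X k (i, e, y) * X k' (i, e, y) =
        ((u (k i) (tgt e) - u (k i) (src e)) * (u (k' i) (tgt e) - u (k' i) (src e))) *
          ∏ j ∈ Finset.univ.erase i, if k j = k' j then (1 : ℝ) else 0 := by
      intro i e
      have h2 : ∀ y : Fin n → α, X k (i, e, y) * X k' (i, e, y) =
          ((u (k i) (tgt e) - u (k i) (src e)) * (u (k' i) (tgt e) - u (k' i) (src e))) *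
          ∏ j, if j = i then (if y j = src e then 1 else 0) else u (k j) (y j) * u (k' j) (y j) := by
        intro y
        rw [← Finset.mul_prod_erase _ _ (Finset.mem_univ i), if_pos rfl]
        have h3 : (∏ j ∈ Finset.univ.erase i, if j = i then (if y j = src e then (1 : ℝ) else 0)
            else u (k j) (y j) * u (k' j) (y j)) =
            (∏ j ∈ Finset.univ.erase i, u (k j) (y j)) *
              ∏ j ∈ Finset.univ.erase i, u (k' j) (y j) := by
          rw [← Finset.prod_mul_distrib]
          exact Finset.prod_congr rfl fun j hj => by rw [if_neg (Finset.ne_of_mem_erase hj)]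
        rw [h3]
        simp only [X]
        by_cases hy : y i = src e
        · rw [if_pos hy, if_pos hy, if_pos hy, prodMode_update_sub, prodMode_update_sub, hy]
          ring
        · rw [if_neg hy, if_neg hy, if_neg hy]
          ring
      rw [Finset.sum_congr rfl fun y _ => h2 y, ← Finset.mul_sum, sum_prod_eq_prod_sum fun j a =>
        if j = i then (if a = src e then (1 : ℝ) else 0) else u (k j) a * u (k' j) a]
      congr 1
      rw [← Finset.mul_prod_erase _ _ (Finset.mem_univ i)]
      simp only [if_true, Finset.sum_ite_eq', Finset.mem_univ, one_mul]
      refine Finset.prod_congr rfl fun j hj => ?_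
      simp only [if_neg (Finset.ne_of_mem_erase hj)]
      exact hu.orthonormal _ _
    rw [Fintype.sum_prod_type]
    have h4 : ∀ i, ∑ q : E × (Fin n → α), X k (i, q) * X k' (i, q) =
        if k = k' then μ (k i) else 0 := by
      intro i
      rw [Fintype.sum_prod_type]
      simp only [h1]
      rw [← Finset.sum_mul, hu.form]
      have h5 := prod_ite_eq_ite k k'
      rw [← Finset.mul_prod_erase _ _ (Finset.mem_univ i)] at h5
      by_cases hi : k i = k' i
      · rw [if_pos hi, one_mul] at h5
        rw [if_pos hi, h5, hi, mul_ite, mul_one, mul_zero]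
      · have : k ≠ k' := fun h => hi (congrFun h i)
        rw [if_neg hi, zero_mul, if_neg this]
    simp only [h4]
    split_ifs <;> simp
  have := sum_norm_sq_of_gram X _ hgram c
  rw [← this, tupleForm, Fintype.sum_prod_type]
  refine Finset.sum_congr rfl fun i _ => ?_
  rw [Fintype.sum_prod_type]
  refine Finset.sum_congr rfl fun e _ => Finset.sum_congr rfl fun y _ => ?_
  simp only [X]
  by_cases hy : y i = src e
  · simp only [if_pos hy, synth, ← Finset.sum_sub_distrib, ← mul_sub, ← Complex.ofReal_sub]
  · simp [if_neg hy]

end Modes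

/-! ### Cosine and sine modes of a path. -/

section PathModes

/-- Summation by parts for sequences satisfying a second order recursion. -/
theorem sum_by_parts (V w : ℕ → ℝ) (μ : ℝ) (hV : ∀ j, 2 * V (j + 1) - V j - V (j + 2) = μ * V (j + 1))
    (m : ℕ) : ∑ e ∈ Finset.range m, (V (e + 2) - V (e + 1)) * (w (e + 1) - w e) =
      μ * ∑ y ∈ Finset.range (m + 1), V (y + 1) * w y + (V (m + 2) - V (m + 1)) * w m -
        (V 1 - V 0) * w 0 := by
  induction m with
  | zero =>
    have := hV 0
    simp only [zero_add] at this
    simp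
    linear_combination (w 0) * this
  | succ m ih =>
    rw [Finset.sum_range_succ, ih, Finset.sum_range_succ _ (m + 1)]
    have := hV (m + 1)
    linear_combination (w (m + 1)) * this

/-- The Dirichlet form of the path with `m` edges. -/
def pathForm {m : ℕ} (v w : Fin (m + 1) → ℝ) : ℝ :=
  ∑ e : Fin m, (v e.succ - v e.castSucc) * (w e.succ - w e.castSucc)

theorem pathForm_comm {m : ℕ} (v w : Fin (m + 1) → ℝ) : pathForm v w = pathForm w v :=
  Finset.sum_congr rfl fun _ _ => mul_comm _ _

/-- The shift by one makes `V 0` and `V (m + 2)` ghost values beyond the path. The boundary term at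
each end vanishes by reflection or because the test function is zero there. -/
theorem pathForm_eq {m : ℕ} (V : ℕ → ℝ) (μ : ℝ)
    (hV : ∀ j, 2 * V (j + 1) - V j - V (j + 2) = μ * V (j + 1)) (w : Fin (m + 1) → ℝ)
    (h0 : V 1 = V 0 ∨ w 0 = 0) (hm : V (m + 2) = V (m + 1) ∨ w (Fin.last m) = 0) :
    pathForm (fun y : Fin (m + 1) => V (y + 1)) w = μ * ∑ y : Fin (m + 1), V (y + 1) * w y := by
  let W : ℕ → ℝ := fun y => if h : y < m + 1 then w ⟨y, h⟩ else 0
  have hW : ∀ y : Fin (m + 1), w y = W y := fun y => by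
    change w y = if h : _ then _ else 0
    rw [dif_pos y.2]
  have h := sum_by_parts V W μ hV m
  have e1 : pathForm (fun y : Fin (m + 1) => V (y + 1)) w =
      ∑ e ∈ Finset.range m, (V (e + 2) - V (e + 1)) * (W (e + 1) - W e) := by
    rw [pathForm, Finset.sum_range]
    refine Finset.sum_congr rfl fun e _ => ?_
    rw [hW, hW]
    rfl
  have e2 : ∑ y : Fin (m + 1), V (y + 1) * w y = ∑ y ∈ Finset.range (m + 1), V (y + 1) * W y := by
    rw [Finset.sum_range]
    exact Finset.sum_congr rfl fun y _ => by rw [hW]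
  have e3 : (V (m + 2) - V (m + 1)) * W m = 0 := by
    rcases hm with h | h
    · rw [h, sub_self, zero_mul]
    · have : W m = w (Fin.last m) := by rw [hW]; rfl
      rw [this, h, mul_zero]
  have e4 : (V 1 - V 0) * W 0 = 0 := by
    rcases h0 with h | h
    · rw [h, sub_self, zero_mul]
    · have : W 0 = w 0 := by rw [hW]; rfl
      rw [this, h, mul_zero]
  rw [e1, e2, h, e3, e4]
  ring

/-- Eigenfunctions of a symmetric form with distinct eigenvalues are orthogonal, so only
normalisation remains. -/
theorem isModeSystem_normalize {m : ℕ} {K : Type*} [DecidableEq K] (v : K → Fin (m + 1) → ℝ)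
    (μ : K → ℝ) (hv : ∀ j k, pathForm (v j) (v k) = μ j * ∑ y, v j y * v k y)
    (hμ : Function.Injective μ) (h0 : ∀ k, v k ≠ 0) :
    IsModeSystem (Fin.castSucc : Fin m → Fin (m + 1)) Fin.succ
      (fun k y => (Real.sqrt (∑ z, v k z ^ 2))⁻¹ * v k y) μ := by
  have horth : ∀ j k, j ≠ k → ∑ y, v j y * v k y = 0 := by
    intro j k hjk
    have h1 := hv j k
    rw [pathForm_comm, hv k j] at h1
    have h2 : ∑ y, v k y * v j y = ∑ y, v j y * v k y :=
      Finset.sum_congr rfl fun _ _ => mul_comm _ _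
    rw [h2, ← sub_eq_zero, ← sub_mul] at h1
    rcases mul_eq_zero.mp h1 with h | h
    · exact absurd (hμ (sub_eq_zero.mp h)).symm hjk
    · exact h
  have hpos : ∀ k, 0 < ∑ z, v k z ^ 2 := by
    intro k
    obtain ⟨z, hz⟩ := Function.ne_iff.mp (h0 k)
    exact Finset.sum_pos' (fun _ _ => sq_nonneg _) ⟨z, Finset.mem_univ _, by
      have : v k z ≠ 0 := hz
      positivity⟩
  have hgram : ∀ j k, ∑ y, ((Real.sqrt (∑ z, v j z ^ 2))⁻¹ * v j y) *
      ((Real.sqrt (∑ z, v k z ^ 2))⁻¹ * v k y) = if j = k then 1 else 0 := by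
    intro j k
    have h1 : ∑ y, ((Real.sqrt (∑ z, v j z ^ 2))⁻¹ * v j y) *
      ((Real.sqrt (∑ z, v k z ^ 2))⁻¹ * v k y) = (Real.sqrt (∑ z, v j z ^ 2))⁻¹ *
        (Real.sqrt (∑ z, v k z ^ 2))⁻¹ * ∑ y, v j y * v k y := by
      rw [Finset.mul_sum]
      exact Finset.sum_congr rfl fun y _ => by ring
    rw [h1]
    by_cases h : j = k
    · subst h
      rw [if_pos rfl, ← mul_inv, Real.mul_self_sqrt (hpos j).le,
        Finset.sum_congr rfl fun y _ => (sq (v j y)).symm, inv_mul_cancel₀ (hpos j).ne']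
    · rw [if_neg h, horth j k h, mul_zero]
  refine ⟨hgram, fun j k => ?_⟩
  have h1 : ∑ e : Fin m, ((Real.sqrt (∑ z, v j z ^ 2))⁻¹ * v j e.succ -
        (Real.sqrt (∑ z, v j z ^ 2))⁻¹ * v j e.castSucc) *
      ((Real.sqrt (∑ z, v k z ^ 2))⁻¹ * v k e.succ -
        (Real.sqrt (∑ z, v k z ^ 2))⁻¹ * v k e.castSucc) =
      (Real.sqrt (∑ z, v j z ^ 2))⁻¹ * (Real.sqrt (∑ z, v k z ^ 2))⁻¹ * pathForm (v j) (v k) := by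
    rw [pathForm, Finset.mul_sum]
    exact Finset.sum_congr rfl fun y _ => by ring
  rw [h1, hv]
  have h2 : (Real.sqrt (∑ z, v j z ^ 2))⁻¹ * (Real.sqrt (∑ z, v k z ^ 2))⁻¹ *
      (μ j * ∑ y, v j y * v k y) = μ j * ∑ y, ((Real.sqrt (∑ z, v j z ^ 2))⁻¹ * v j y) *
      ((Real.sqrt (∑ z, v k z ^ 2))⁻¹ * v k y) := by
    simp only [Finset.mul_sum]
    exact Finset.sum_congr rfl fun y _ => by ring
  rw [h2, hgram]
  by_cases h : j = k
  · subst h; simp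
  · simp [h]

theorem cos_recursion (θ a : ℝ) :
    2 * Real.cos a - Real.cos (a - θ) - Real.cos (a + θ) = 2 * (1 - Real.cos θ) * Real.cos a := by
  rw [Real.cos_add, Real.cos_sub]; ring

theorem sin_recursion (θ a : ℝ) :
    2 * Real.sin a - Real.sin (a - θ) - Real.sin (a + θ) = 2 * (1 - Real.cos θ) * Real.sin a := by
  rw [Real.sin_add, Real.sin_sub]; ring

theorem mode_injective {m : ℕ} : Function.Injective fun k : Fin (m + 1) =>
    2 * (1 - Real.cos (Real.pi * k / (m + 1 : ℕ))) := by
  intro j k h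
  have hm : (0 : ℝ) < (m + 1 : ℕ) := by positivity
  have hmem : ∀ k : Fin (m + 1), Real.pi * k / (m + 1 : ℕ) ∈ Set.Icc 0 Real.pi := by
    intro k
    have hk : ((k : ℕ) : ℝ) ≤ (m + 1 : ℕ) := by exact_mod_cast k.2.le
    refine ⟨by positivity, ?_⟩
    rw [div_le_iff₀ hm]
    exact mul_le_mul_of_nonneg_left hk Real.pi_pos.le
  have h1 := Real.injOn_cos (hmem j) (hmem k) (by simp only at h; linarith)
  rw [div_left_inj' hm.ne'] at h1
  have h2 := mul_left_cancel₀ Real.pi_pos.ne' h1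
  exact Fin.ext (by exact_mod_cast h2)

/-- The eigenvalues of the Neumann Laplacian on a path. -/
def neumannEigenvalue (m k : ℕ) : ℝ := 2 * (1 - Real.cos (Real.pi * k / (m + 1 : ℕ)))

theorem exists_neumann_modes (m : ℕ) : ∃ u : Fin (m + 1) → Fin (m + 1) → ℝ,
    IsModeSystem (Fin.castSucc : Fin m → Fin (m + 1)) Fin.succ u
      fun k => neumannEigenvalue m k := by
  have hm : (0 : ℝ) < (m + 1 : ℕ) := by positivity
  -- The shift by one half places the axis of reflection midway between an end site and its ghost
  -- neighbour.
  let V : Fin (m + 1) → ℕ → ℝ := fun k j =>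
    Real.cos (Real.pi * k / (m + 1 : ℕ) * (j - 1 / 2))
  refine ⟨_, isModeSystem_normalize (fun k y => V k (y + 1)) _ ?_ mode_injective ?_⟩
  · intro j k
    refine pathForm_eq (V j) _ ?_ (fun y : Fin (m + 1) => V k (y + 1)) (Or.inl ?_) (Or.inl ?_)
    · intro i
      have := cos_recursion (Real.pi * j / (m + 1 : ℕ))
        (Real.pi * j / (m + 1 : ℕ) * ((i + 1 : ℕ) - 1 / 2))
      simp only [V, neumannEigenvalue]
      rw [← this]
      congr 2
      · congr 1; push_cast; ring
      · push_cast; ring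
    · simp only [V]
      rw [← Real.cos_neg]
      congr 1
      push_cast
      ring
    · simp only [V]
      have e1 : Real.pi * j / (m + 1 : ℕ) * ((m + 2 : ℕ) - 1 / 2) =
          j * Real.pi + Real.pi * j / (m + 1 : ℕ) / 2 := by
        push_cast at hm ⊢
        field_simp
        ring
      have e2 : Real.pi * j / (m + 1 : ℕ) * ((m + 1 : ℕ) - 1 / 2) =
          j * Real.pi - Real.pi * j / (m + 1 : ℕ) / 2 := by
        push_cast at hm ⊢
        field_simp
      rw [e1, e2, Real.cos_add, Real.cos_sub, Real.sin_nat_mul_pi]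
      ring
  · intro k h
    have h1 := congrFun h 0
    have hk : ((k : ℕ) : ℝ) < (m + 1 : ℕ) := by exact_mod_cast k.2
    have h2 : 0 < V k ((0 : Fin (m + 1)) + 1 : ℕ) := by
      apply Real.cos_pos_of_mem_Ioo
      have e : Real.pi * k / (m + 1 : ℕ) * ((((0 : Fin (m + 1)) : ℕ) + 1 : ℕ) - 1 / 2) =
          Real.pi / 2 * (k / (m + 1 : ℕ)) := by
        simp
        ring
      rw [e]
      have h3 : (k : ℝ) / (m + 1 : ℕ) < 1 := by rwa [div_lt_one hm]
      have h4 : 0 ≤ (k : ℝ) / (m + 1 : ℕ) := by positivity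
      constructor <;> nlinarith [Real.pi_pos]
    exact h2.ne' h1

theorem exists_dirichlet_modes (m K : ℕ) (hK : K ≤ m) : ∃ u : Fin K → Fin (m + 2) → ℝ,
    IsModeSystem (Fin.castSucc : Fin (m + 1) → Fin (m + 2)) Fin.succ u
      (fun k => neumannEigenvalue m (k + 1)) ∧
    (∀ k, u k 0 = 0) ∧ ∀ k, u k (Fin.last _) = 0 := by
  have hm : (0 : ℝ) < (m + 1 : ℕ) := by positivity
  -- Sines vanishing at both ends of a path with `m + 1` edges have momenta `π (k + 1) / (m + 1)`:
  -- these are the nonzero momenta of the Neumann path with `m + 1` sites.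
  let θ : Fin K → ℝ := fun k => Real.pi * (k + 1 : ℕ) / (m + 1 : ℕ)
  let V : Fin K → ℕ → ℝ := fun k j => Real.sin (θ k * (j - 1))
  have hfirst : ∀ k, V k ((0 : Fin (m + 2)) + 1 : ℕ) = 0 := by
    intro k; simp [V]
  have hlast : ∀ k, V k ((Fin.last (m + 1) : ℕ) + 1 : ℕ) = 0 := by
    intro k
    simp only [V, θ, Fin.val_last]
    have e : Real.pi * (k + 1 : ℕ) / (m + 1 : ℕ) * (((m + 1 + 1 : ℕ) : ℝ) - 1) =
        (k + 1 : ℕ) * Real.pi := by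
      push_cast at hm ⊢
      field_simp
      ring
    rw [e, Real.sin_nat_mul_pi]
  have hmi : Function.Injective fun k : Fin K => neumannEigenvalue m (k + 1) := by
    intro j k h
    have := @mode_injective m ⟨j + 1, by omega⟩ ⟨k + 1, by omega⟩ h
    have := congrArg Fin.val this
    simp at this
    exact Fin.ext this
  refine ⟨_, isModeSystem_normalize (m := m + 1) (fun k y => V k (y + 1)) _ ?_ hmi ?_, ?_, ?_⟩
  · intro j k
    refine pathForm_eq (V j) _ ?_ (fun y : Fin (m + 1 + 1) => V k (y + 1)) (Or.inr (hfirst k))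
      (Or.inr (hlast k))
    intro i
    have := sin_recursion (θ j) (θ j * ((i + 1 : ℕ) - 1))
    simp only [V, neumannEigenvalue]
    change _ = 2 * (1 - Real.cos (θ j)) * _
    rw [← this]
    congr 2
    · congr 1; push_cast; ring
    · push_cast; ring
  · intro k h
    have h1 := congrFun h 1
    have hk : ((k + 1 : ℕ) : ℝ) < (m + 1 : ℕ) := by exact_mod_cast (by omega)
    have h2 : 0 < V k ((1 : Fin (m + 1 + 1)) + 1 : ℕ) := by
      have e : θ k * ((((1 : Fin (m + 1 + 1)) : ℕ) + 1 : ℕ) - 1) = θ k := by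
        simp
        ring
      simp only [V]
      rw [e]
      apply Real.sin_pos_of_pos_of_lt_pi
      · simp only [θ]; positivity
      · simp only [θ]
        rw [div_lt_iff₀ hm]
        exact mul_lt_mul_of_pos_left hk Real.pi_pos
    exact h2.ne' h1
  · intro k
    rw [hfirst, mul_zero]
  · intro k
    rw [hlast, mul_zero]

end PathModes

/-! ### Expansion in product modes. -/

section Completeness

variable {α E : Type*} [Fintype α] [DecidableEq α] [Fintype E]
variable {src tgt : E → α} {u : α → α → ℝ} {μ : α → ℝ}

/-- There are as many modes as sites, so a one-sided inverse is two-sided. -/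
theorem IsModeSystem.sum_mode_mul (hu : IsModeSystem src tgt u μ) (a b : α) :
    ∑ k, u k a * u k b = if a = b then 1 else 0 := by
  have h1 : Matrix.of u * (Matrix.of u).transpose = 1 := by
    ext j k
    rw [Matrix.mul_apply, Matrix.one_apply, ← hu.orthonormal]
    rfl
  have h3 : (Matrix.of u).transpose * Matrix.of u = 1 := mul_eq_one_comm.mp h1
  have h2 := congrFun (congrFun h3 a) b
  rw [Matrix.mul_apply, Matrix.one_apply] at h2
  rw [← h2]
  rfl

/-- The coefficients of a function in the basis of products of modes. -/
def analyze {n : ℕ} (u : α → α → ℝ) (φ : (Fin n → α) → ℂ) (k : Fin n → α) : ℂ :=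
  ∑ y, (prodMode u k y : ℂ) * φ y

theorem IsModeSystem.synth_analyze (hu : IsModeSystem src tgt u μ) {n : ℕ}
    (φ : (Fin n → α) → ℂ) : synth u (analyze u φ) = φ := by
  funext y
  have h : ∀ y', ∑ k : Fin n → α, prodMode u k y' * prodMode u k y = if y' = y then 1 else 0 := by
    intro y'
    simp only [prodMode, ← Finset.prod_mul_distrib]
    rw [sum_prod_eq_prod_sum fun i a => u a (y' i) * u a (y i)]
    simp only [hu.sum_mode_mul]
    exact prod_ite_eq_ite y' y
  simp only [synth, analyze, Finset.sum_mul]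
  rw [Finset.sum_comm]
  have h2 : ∀ y', ∑ k, (prodMode u k y' : ℂ) * φ y' * (prodMode u k y : ℂ) =
      if y' = y then φ y' else 0 := by
    intro y'
    have h3 : ∑ k, (prodMode u k y' : ℂ) * φ y' * (prodMode u k y : ℂ) =
        φ y' * ((∑ k, prodMode u k y' * prodMode u k y : ℝ) : ℂ) := by
      push_cast
      rw [Finset.mul_sum]
      exact Finset.sum_congr rfl fun k _ => by ring
    rw [h3, h]
    split_ifs <;> simp
  rw [Finset.sum_congr rfl fun y' _ => h2 y']
  simp

theorem analyze_comp {n : ℕ} (φ : (Fin n → α) → ℂ)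
    (hφ : ∀ (σ : Equiv.Perm (Fin n)) y, φ (y ∘ σ) = φ y) (σ : Equiv.Perm (Fin n))
    (k : Fin n → α) : analyze u φ (k ∘ σ) = analyze u φ k := by
  rw [analyze, analyze, ← Equiv.sum_comp (Equiv.arrowCongr σ.symm (Equiv.refl α))]
  refine Finset.sum_congr rfl fun y _ => ?_
  have h1 : (Equiv.arrowCongr σ.symm (Equiv.refl α)) y = y ∘ σ := rfl
  have h2 : prodMode u (k ∘ σ) (y ∘ σ) = prodMode u k y :=
    Equiv.prod_comp σ fun i => u (k i) (y i)
  rw [h1, hφ, h2]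

end Completeness

/-! ### Counting tuples with given occupation numbers. -/

section Multiplicity

variable {α : Type*} [Fintype α] [DecidableEq α]

/-- The number of ways to distribute `n` labelled particles with given occupation numbers. -/
def multiplicity {n : ℕ} (f : α → ℕ) : ℕ :=
  (Finset.univ.filter fun x : Fin n → α => occ x = f).card

theorem exists_perm_of_occ_eq {n : ℕ} {x y : Fin n → α} (h : occ x = occ y) :
    ∃ σ : Equiv.Perm (Fin n), y = x ∘ σ := by
  have h1 : ∀ a, Nonempty ({i // y i = a} ≃ {i // x i = a}) := by
    intro a
    refine ⟨Fintype.equivOfCardEq ?_⟩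
    rw [Fintype.card_subtype, Fintype.card_subtype]
    exact (congrFun h a).symm
  refine ⟨Equiv.ofFiberEquiv fun a => (h1 a).some, ?_⟩
  funext i
  exact (Equiv.ofFiberEquiv_map (fun a => (h1 a).some) i).symm

theorem occ_comp_perm {n : ℕ} (x : Fin n → α) (σ : Equiv.Perm (Fin n)) :
    occ (x ∘ σ) = occ x := by
  funext a
  simp only [occ]
  exact Finset.card_equiv σ (by simp)

theorem sum_tuple_eq {n : ℕ} (g : (α → ℕ) → ℝ) :
    ∑ x : Fin n → α, g (occ x) = ∑ f ∈ Finset.univ.image (occ : (Fin n → α) → α → ℕ),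
      (multiplicity (n := n) f : ℝ) * g f := by
  rw [← Finset.sum_fiberwise_of_maps_to (g := occ) (t := Finset.univ.image occ)
    fun x hx => Finset.mem_image_of_mem _ hx]
  refine Finset.sum_congr rfl fun f _ => ?_
  rw [Finset.sum_congr rfl fun x hx => by rw [(Finset.mem_filter.mp hx).2], Finset.sum_const,
    nsmul_eq_mul, multiplicity]

/-- Orbit and stabiliser for permutations acting on tuples; the stabiliser is the product of the
symmetric groups of the fibres. -/
theorem multiplicity_mul_prod_factorial {n : ℕ} {f : α → ℕ} (hf : ∑ a, f a = n) :
    multiplicity (n := n) f * ∏ a, (f a).factorial = n.factorial := by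
  obtain ⟨x, rfl⟩ := exists_occ_eq f hf
  have h1 : (Finset.univ : Finset (Equiv.Perm (Fin n))).card = n.factorial := by
    rw [Finset.card_univ, Fintype.card_perm, Fintype.card_fin]
  rw [← h1, Finset.card_eq_sum_card_fiberwise (f := fun σ : Equiv.Perm (Fin n) => x ∘ σ)
    (t := Finset.univ.filter fun y : Fin n → α => occ y = occ x)
    fun σ _ => by simp [occ_comp_perm]]
  rw [multiplicity, ← smul_eq_mul, ← Finset.sum_const]
  refine Finset.sum_congr rfl fun y hy => ?_
  obtain ⟨τ, rfl⟩ := exists_perm_of_occ_eq (Finset.mem_filter.mp hy).2.symm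
  have h2 := DomMulAct.stabilizer_card x
  have h3 : ∀ a, Fintype.card {i // x i = a} = occ x a := fun a => Fintype.card_subtype _
  simp only [h3] at h2
  rw [← h2, Fintype.card_subtype]
  refine Finset.card_equiv (Equiv.mulRight τ) fun σ => ?_
  simp only [Finset.mem_filter, Finset.mem_univ, true_and, Equiv.coe_mulRight]
  constructor
  · intro h
    rw [Equiv.Perm.coe_mul, ← Function.comp_assoc, h]
  · intro h
    rw [Equiv.Perm.coe_mul, ← Function.comp_assoc] at h
    exact τ.surjective.injective_comp_right h

theorem multiplicity_pos {n : ℕ} {f : α → ℕ} (hf : ∑ a, f a = n) :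
    0 < multiplicity (n := n) f := by
  refine Nat.pos_of_ne_zero fun h => ?_
  have := multiplicity_mul_prod_factorial hf
  rw [h, zero_mul] at this
  exact n.factorial_pos.ne this

end Multiplicity

end HeisenbergChain
end

noncomputable section

namespace HeisenbergChain

/-! ### Symmetric functions in terms of occupation numbers. -/

section Occupations

variable {α : Type*} [Fintype α] [DecidableEq α]

/-- The occupation numbers of `n` particles. -/
def occupations (α : Type*) [Fintype α] [DecidableEq α] (n : ℕ) : Finset (α → ℕ) :=
  Finset.univ.image (occ : (Fin n → α) → α → ℕ)

theorem mem_occupations {n : ℕ} {f : α → ℕ} : f ∈ occupations α n ↔ ∑ a, f a = n := by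
  rw [occupations, Finset.mem_image]
  constructor
  · rintro ⟨x, -, rfl⟩
    exact sum_occ x
  · intro h
    obtain ⟨x, hx⟩ := exists_occ_eq f h
    exact ⟨x, Finset.mem_univ _, hx⟩

/-- Move one particle from `a` to `b`. -/
def moveParticle (f : α → ℕ) (a b : α) : α → ℕ :=
  Function.update (Function.update f a (f a - 1)) b (f b + 1)

theorem occ_update {n : ℕ} (y : Fin n → α) (i : Fin n) {b : α} (hb : y i ≠ b) :
    occ (Function.update y i b) = moveParticle (occ y) (y i) b := by
  funext z
  simp only [occ, moveParticle]
  by_cases h1 : z = b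
  · subst h1
    rw [Function.update_self]
    have : (Finset.univ.filter fun j => Function.update y i z j = z) =
        insert i (Finset.univ.filter fun j => y j = z) := by
      ext j
      by_cases hj : j = i
      · subst hj; simp
      · simp [hj]
    rw [this, Finset.card_insert_of_notMem (by simp [hb])]
  · rw [Function.update_of_ne h1]
    by_cases h2 : z = y i
    · subst h2
      rw [Function.update_self]
      have : (Finset.univ.filter fun j => Function.update y i b j = y i) =
          (Finset.univ.filter fun j => y j = y i).erase i := by
        ext j
        by_cases hj : j = i
        · subst hj; simp [Ne.symm h1]
        · simp [hj]
      rw [this, Finset.card_erase_of_mem (by simp)]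
    · rw [Function.update_of_ne h2]
      congr 1
      ext j
      by_cases hj : j = i
      · subst hj; simp [Ne.symm h1, Ne.symm h2]
      · simp [hj]

/-- For occupation numbers `f`, there are `f (src e)` particles that can cross the edge `e`, all
with the same effect. -/
theorem tupleForm_occ {E : Type*} [Fintype E] {src tgt : E → α} (hne : ∀ e, src e ≠ tgt e) (n : ℕ)
    (Φ : (α → ℕ) → ℂ) :
    tupleForm src tgt (fun y : Fin n → α => Φ (occ y)) = ∑ e, ∑ f ∈ occupations α n,
      (multiplicity (n := n) f : ℝ) *
        (f (src e) * ‖Φ (moveParticle f (src e) (tgt e)) - Φ f‖ ^ 2) := by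
  rw [tupleForm, Finset.sum_comm]
  refine Finset.sum_congr rfl fun e _ => ?_
  rw [occupations, ← sum_tuple_eq (n := n) fun f =>
    f (src e) * ‖Φ (moveParticle f (src e) (tgt e)) - Φ f‖ ^ 2, Finset.sum_comm]
  refine Finset.sum_congr rfl fun y _ => ?_
  rw [← Finset.sum_filter, Finset.sum_congr rfl fun i hi => by
    rw [occ_update y i ((Finset.mem_filter.mp hi).2 ▸ hne e), (Finset.mem_filter.mp hi).2]]
  rw [Finset.sum_const, nsmul_eq_mul]
  rfl

theorem sum_comp_occ {n : ℕ} (x : Fin n → α) (μ : α → ℝ) :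
    ∑ i, μ (x i) = ∑ a, (occ x a : ℝ) * μ a := by
  rw [← Finset.sum_fiberwise_of_maps_to (g := x) (t := Finset.univ) fun i _ => Finset.mem_univ _]
  refine Finset.sum_congr rfl fun a _ => ?_
  rw [Finset.sum_congr rfl fun i hi => by rw [(Finset.mem_filter.mp hi).2], Finset.sum_const,
    nsmul_eq_mul]
  rfl

theorem cast_multiplicity_mul {n : ℕ} {f : α → ℕ} (hf : ∑ a, f a = n) :
    (multiplicity (n := n) f : ℝ) * ∏ a, ((f a).factorial : ℝ) = n.factorial := by
  exact_mod_cast multiplicity_mul_prod_factorial hf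

theorem multiplicity_eq_factorial {n : ℕ} {f : α → ℕ} (hf : ∑ a, f a = n) (h : ∀ a, f a ≤ 1) :
    multiplicity (n := n) f = n.factorial := by
  have := multiplicity_mul_prod_factorial hf
  rwa [Finset.prod_eq_one fun a _ => Nat.factorial_eq_one.mpr (h a), mul_one] at this

/-- The number `f a` is at most its factorial, which is one factor of the product in
`multiplicity_mul_prod_factorial`. -/
theorem multiplicity_mul_le {n : ℕ} {f : α → ℕ} (hf : ∑ a, f a = n) (a : α) :
    multiplicity (n := n) f * f a ≤ n.factorial := by
  rw [← multiplicity_mul_prod_factorial hf]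
  refine Nat.mul_le_mul_left _ ((Nat.self_le_factorial _).trans ?_)
  exact Nat.le_of_dvd (Finset.prod_pos fun b _ => Nat.factorial_pos _)
    (Finset.dvd_prod_of_mem (fun b => (f b).factorial) (Finset.mem_univ a))

end Occupations

/-! ### Hard-core configurations as occupations of the gaps between holes. -/

section Packing

variable {N m n : ℕ}

/-- Partial sums of occupation numbers. -/
def cumul (f : Fin (m + 1) → ℕ) (k : ℕ) : ℕ :=
  ∑ z : Fin (m + 1), if (z : ℕ) ≤ k then f z else 0

theorem cumul_succ (f : Fin (m + 1) → ℕ) {k : ℕ} (hk : k + 1 < m + 1) :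
    cumul f (k + 1) = cumul f k + f ⟨k + 1, hk⟩ := by
  have h : f ⟨k + 1, hk⟩ = ∑ z, if z = ⟨k + 1, hk⟩ then f z else 0 := by simp
  rw [cumul, cumul, h, ← Finset.sum_add_distrib]
  refine Finset.sum_congr rfl fun z _ => ?_
  by_cases h1 : (z : ℕ) ≤ k
  · have h2 : z ≠ ⟨k + 1, hk⟩ := fun h => by rw [h] at h1; simp at h1
    rw [if_pos h1, if_pos (by omega), if_neg h2, add_zero]
  · rw [if_neg h1, zero_add]
    by_cases h2 : z = ⟨k + 1, hk⟩
    · rw [if_pos h2, if_pos (by rw [h2])]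
    · rw [if_neg h2, if_neg fun h => h2 (Fin.ext (by simp; omega))]

theorem cumul_zero (f : Fin (m + 1) → ℕ) : cumul f 0 = f 0 := by
  rw [cumul, Finset.sum_eq_single 0]
  · simp
  · intro z _ hz
    rw [if_neg fun h => hz (Fin.ext (by simpa using h))]
  · simp

theorem cumul_mono (f : Fin (m + 1) → ℕ) : Monotone (cumul f) := by
  intro j k hjk
  refine Finset.sum_le_sum fun z _ => ?_
  by_cases h : (z : ℕ) ≤ j
  · rw [if_pos h, if_pos (h.trans hjk)]
  · rw [if_neg h]; exact Nat.zero_le _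

theorem cumul_of_le (f : Fin (m + 1) → ℕ) {k : ℕ} (hk : m ≤ k) : cumul f k = ∑ z, f z :=
  Finset.sum_congr rfl fun z _ => if_pos (by omega)

theorem cumul_le (f : Fin (m + 1) → ℕ) (k : ℕ) : cumul f k ≤ ∑ z, f z :=
  Finset.sum_le_sum fun z _ => by split_ifs <;> simp

theorem cumul_injective {f g : Fin (m + 1) → ℕ} (h : ∀ k ≤ m, cumul f k = cumul g k) : f = g := by
  funext z
  obtain ⟨k, hk⟩ := z
  cases k with
  | zero => have := h 0 (Nat.zero_le _); rwa [cumul_zero, cumul_zero] at this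
  | succ k =>
    have h1 := h (k + 1) (by omega)
    rw [cumul_succ f hk, cumul_succ g hk, h k (by omega)] at h1
    omega

/-- Only the partial sum up to the crossed edge loses a particle; accordingly only one hole moves.
-/
theorem cumul_move (f : Fin (m + 1) → ℕ) (e : Fin m) (he : 0 < f e.castSucc) (k : ℕ) :
    cumul (moveParticle f e.castSucc e.succ) k + (if k = e then 1 else 0) = cumul f k := by
  have hne : e.castSucc ≠ e.succ := Fin.castSucc_lt_succ.ne
  have h : ∀ z, moveParticle f e.castSucc e.succ z + (if z = e.castSucc then 1 else 0) =
      f z + (if z = e.succ then 1 else 0) := by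
    intro z
    rw [moveParticle]
    by_cases h1 : z = e.succ
    · subst h1
      rw [Function.update_self, if_neg hne.symm, if_pos rfl]
    · rw [Function.update_of_ne h1, if_neg h1]
      by_cases h2 : z = e.castSucc
      · subst h2
        rw [Function.update_self, if_pos rfl]
        omega
      · rw [Function.update_of_ne h2, if_neg h2]
  have h2 : ∀ a : Fin (m + 1), (∑ z : Fin (m + 1),
      if (z : ℕ) ≤ k then (if z = a then 1 else 0) else 0) = if (a : ℕ) ≤ k then 1 else 0 := by
    intro a
    rw [Finset.sum_eq_single a]
    · simp
    · intro b _ hb; simp [hb]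
    · simp
  have h3 : cumul (moveParticle f e.castSucc e.succ) k + (if (e.castSucc : ℕ) ≤ k then 1 else 0) =
      cumul f k + (if (e.succ : ℕ) ≤ k then 1 else 0) := by
    rw [← h2, ← h2, cumul, cumul, ← Finset.sum_add_distrib, ← Finset.sum_add_distrib]
    refine Finset.sum_congr rfl fun z _ => ?_
    by_cases h4 : (z : ℕ) ≤ k
    · simp only [if_pos h4]
      exact h z
    · simp only [if_neg h4]
  simp only [Fin.val_castSucc, Fin.val_succ] at h3
  split_ifs at h3 ⊢ <;> omega

theorem hole_strictMono (f : Fin (m + 1) → ℕ) : StrictMono fun z : ℕ => z + cumul f z :=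
  strictMono_id.add_monotone (cumul_mono f)

/-- The configuration of hard-core particles on `m + n` sites with `f z` particles between the
holes number `z - 1` and `z`. -/
def packed (N m n : ℕ) (f : Fin (m + 1) → ℕ) : Config N (m + n) := by
  classical
  exact fun x => if ∃ z < m, (x : ℕ) = z + cumul f z then 0 else 1

theorem val_one_of_pos (hN : 0 < N) : ((1 : Fin (N + 1)) : ℕ) = 1 := by
  rw [Fin.val_one', Nat.mod_eq_of_lt (by omega)]

theorem one_ne_zero_of_pos (hN : 0 < N) : (1 : Fin (N + 1)) ≠ 0 := by
  intro h
  have := congrArg Fin.val h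
  rw [val_one_of_pos hN] at this
  simp at this

theorem packed_eq_zero_iff (hN : 0 < N) (f : Fin (m + 1) → ℕ) (x : Fin (m + n)) :
    packed N m n f x = 0 ↔ ∃ z < m, (x : ℕ) = z + cumul f z := by
  rw [packed]
  split_ifs with h
  · simp [h]
  · simp [h, one_ne_zero_of_pos hN]

theorem packed_of_not (f : Fin (m + 1) → ℕ) (x : Fin (m + n))
    (h : ¬ ∃ z < m, (x : ℕ) = z + cumul f z) : packed N m n f x = 1 := if_neg h

theorem packed_of (f : Fin (m + 1) → ℕ) (x : Fin (m + n))
    (h : ∃ z < m, (x : ℕ) = z + cumul f z) : packed N m n f x = 0 := if_pos h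

/-- The holes form the range of the strictly increasing function `z + cumul f z`, and such a
function is determined by its range. -/
theorem packed_injOn (hN : 0 < N) :
    Set.InjOn (packed N m n) (occupations (Fin (m + 1)) n : Set (Fin (m + 1) → ℕ)) := by
  intro f hf g hg hfg
  have hf : ∑ z, f z = n := mem_occupations.mp hf
  have hg : ∑ z, g z = n := mem_occupations.mp hg
  have hsub : ∀ {f g : Fin (m + 1) → ℕ}, ∑ z, f z = n → packed N m n f = packed N m n g →
      Set.range (fun z : Fin m => (z : ℕ) + cumul f z) ⊆
        Set.range (fun z : Fin m => (z : ℕ) + cumul g z) := by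
    rintro f g hf hfg _ ⟨z, rfl⟩
    have hlt : (z : ℕ) + cumul f z < m + n := by
      have := cumul_le f z
      have := z.2
      omega
    have h1 : packed N m n f ⟨_, hlt⟩ = 0 := packed_of f _ ⟨z, z.2, rfl⟩
    rw [hfg, packed_eq_zero_iff hN] at h1
    obtain ⟨z', hz', h2⟩ := h1
    exact ⟨⟨z', hz'⟩, h2.symm⟩
  have hmono : ∀ f : Fin (m + 1) → ℕ, StrictMono fun z : Fin m => (z : ℕ) + cumul f z :=
    fun f a b h => hole_strictMono f h
  have h := (StrictMono.range_inj (hmono f) (hmono g)).mp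
    ((hsub hf hfg).antisymm (hsub hg hfg.symm))
  refine cumul_injective fun k hk => ?_
  rcases hk.lt_or_eq with hk | rfl
  · have := congrFun h ⟨k, hk⟩
    simpa using this
  · rw [cumul_of_le f le_rfl, cumul_of_le g le_rfl, hf, hg]

theorem cumul_pos (f : Fin (m + 1) → ℕ) {e : Fin m} (he : 0 < f e.castSucc) : 0 < cumul f e :=
  lt_of_lt_of_le he ((if_pos (le_refl (e : ℕ))).ge.trans (Finset.single_le_sum
    (f := fun z : Fin (m + 1) => if (z : ℕ) ≤ e then f z else 0)
    (fun _ _ => Nat.zero_le _) (Finset.mem_univ e.castSucc)))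

theorem cumul_lt (f : Fin (m + 1) → ℕ) {e : Fin m} (he : 0 < f e.castSucc) {z : ℕ} (hz : z < e) :
    cumul f z < cumul f e := by
  obtain ⟨k, hk⟩ : ∃ k, (e : ℕ) = k + 1 := ⟨e - 1, by omega⟩
  have h1 := cumul_succ f (k := k) (by omega)
  have h2 : (⟨k + 1, by omega⟩ : Fin (m + 1)) = e.castSucc := Fin.ext hk.symm
  rw [h2] at h1
  have h3 := cumul_mono f (show z ≤ k by omega)
  rw [hk]
  omega

theorem packed_left (f : Fin (m + 1) → ℕ) {e : Fin m} (he : 0 < f e.castSucc)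
    {x : Fin (m + n)} (hx : (x : ℕ) + 1 = e + cumul f e) : packed N m n f x = 1 := by
  refine packed_of_not f x ?_
  rintro ⟨z, -, hz⟩
  rcases lt_or_ge z e with h | h
  · have := cumul_lt f he h
    omega
  · have := cumul_mono f h
    omega

/-- Passing a particle from gap `e` to the next gap moves hole number `e` one site to the left,
exchanging it with the particle there. -/
theorem packed_move (f : Fin (m + 1) → ℕ) {e : Fin m} (he : 0 < f e.castSucc)
    {x y : Fin (m + n)} (hx : (x : ℕ) + 1 = e + cumul f e) (hy : (y : ℕ) = x + 1) :
    packed N m n (moveParticle f e.castSucc e.succ) = hop x y (packed N m n f) := by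
  have hxy : x ≠ y := fun h => by rw [h] at hy; omega
  have hc := cumul_move f e he
  have hce := hc e
  rw [if_pos rfl] at hce
  have hcn : ∀ z : ℕ, z ≠ e → cumul (moveParticle f e.castSucc e.succ) z = cumul f z := by
    intro z hz
    have := hc z
    rwa [if_neg hz, add_zero] at this
  funext v
  by_cases h1 : v = x
  · subst h1
    rw [hop_apply_left hxy, packed_left f he hx, sub_self]
    exact packed_of _ _ ⟨e, e.2, by omega⟩
  by_cases h2 : v = y
  · subst h2
    rw [hop_apply_right, packed_of f v ⟨e, e.2, by omega⟩, zero_add]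
    refine packed_of_not _ _ ?_
    rintro ⟨z, hz, h⟩
    by_cases hze : z = e
    · subst hze; omega
    · rw [hcn z hze] at h
      exact hze ((hole_strictMono f).injective (show z + cumul f z = e + cumul f e by omega))
  rw [hop_apply_of_ne h1 h2]
  have hv1 : (v : ℕ) ≠ x := fun h => h1 (Fin.ext h)
  have hv2 : (v : ℕ) ≠ y := fun h => h2 (Fin.ext h)
  have hiff : (∃ z < m, (v : ℕ) = z + cumul (moveParticle f e.castSucc e.succ) z) ↔
      ∃ z < m, (v : ℕ) = z + cumul f z := by
    refine exists_congr fun z => and_congr_right fun _ => ?_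
    by_cases hze : z = e
    · subst hze
      constructor <;> intro h <;> omega
    · rw [hcn z hze]
  rw [packed, packed]
  simp only [hiff]

/-- Let `f z` be the number of particles with exactly `z` holes to their left. Then every hole of
`s` is at a predicted position, and there are only `m` such positions. -/
theorem exists_packed_eq {s : Config N (m + n)} (h1 : ∀ x, (s x : ℕ) ≤ 1)
    (hs : ∑ x, (s x : ℕ) = n) : ∃ f ∈ occupations (Fin (m + 1)) n, packed N m n f = s := by
  classical
  have hval : ∀ x, s x ≠ 0 → (s x : ℕ) = 1 := by
    intro x hx
    have : (s x : ℕ) ≠ 0 := fun h => hx (Fin.ext h)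
    have := h1 x
    omega
  have hocc : (Finset.univ.filter fun x => s x ≠ 0).card = n := by
    rw [Finset.card_filter]
    refine Eq.trans (Finset.sum_congr rfl fun x _ => ?_) hs
    by_cases hx : s x = 0
    · simp [hx]
    · rw [if_pos hx, hval x hx]
  have hholes : (Finset.univ.filter fun x => s x = 0).card = m := by
    have := Finset.card_filter_add_card_filter_not (s := Finset.univ) (fun x => s x = 0)
    rw [Finset.card_univ, Fintype.card_fin] at this
    have h2 : (Finset.univ.filter fun x => ¬ s x = 0).card = n := hocc
    omega
  let hl : Fin (m + n) → Fin (m + 1) := fun x =>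
    ⟨(Finset.univ.filter fun x' => s x' = 0 ∧ x' < x).card, by
      refine Nat.lt_succ_iff.mpr (le_trans (Finset.card_le_card fun x' hx' => ?_) hholes.le)
      simp only [Finset.mem_filter, Finset.mem_univ, true_and] at hx' ⊢
      exact hx'.1⟩
  let f : Fin (m + 1) → ℕ := fun z => (Finset.univ.filter fun x => s x ≠ 0 ∧ hl x = z).card
  have hcum : ∀ k : ℕ, cumul f k = (Finset.univ.filter fun x => s x ≠ 0 ∧ (hl x : ℕ) ≤ k).card := by
    intro k
    rw [Finset.card_eq_sum_card_fiberwise (f := hl) (t := Finset.univ) fun _ _ => by simp, cumul]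
    refine Finset.sum_congr rfl fun z _ => ?_
    rw [Finset.filter_filter]
    split_ifs with hz
    · simp only [f]
      congr 1
      ext x
      simp only [Finset.mem_filter, Finset.mem_univ, true_and]
      constructor
      · rintro ⟨h, h'⟩; exact ⟨⟨h, by rwa [h']⟩, h'⟩
      · rintro ⟨⟨h, -⟩, h'⟩; exact ⟨h, h'⟩
    · symm
      rw [Finset.card_eq_zero, Finset.filter_eq_empty_iff]
      rintro x - ⟨⟨-, h⟩, h'⟩
      rw [h'] at h
      exact hz h
  have hf : ∑ z, f z = n := by
    rw [← cumul_of_le f le_rfl, hcum]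
    refine Eq.trans ?_ hocc
    congr 1
    ext x
    simp only [Finset.mem_filter, Finset.mem_univ, true_and, and_iff_left_iff_imp]
    intro _
    exact Nat.lt_succ_iff.mp (hl x).2
  have hsub : ∀ x, s x = 0 → ∃ z < m, (x : ℕ) = z + cumul f z := by
    intro x hx
    refine ⟨hl x, ?_, ?_⟩
    · change (Finset.univ.filter fun x' => s x' = 0 ∧ x' < x).card < m
      refine lt_of_lt_of_eq (Finset.card_lt_card (Finset.ssubset_iff_of_subset (fun x' hx' => by
        simp only [Finset.mem_filter, Finset.mem_univ, true_and] at hx' ⊢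
        exact hx'.1) |>.mpr ⟨x, by simp [hx], by simp⟩)) hholes
    · rw [hcum]
      have h2 : (Finset.univ.filter fun x' => s x' ≠ 0 ∧ (hl x' : ℕ) ≤ hl x) =
          Finset.univ.filter fun x' => ¬ s x' = 0 ∧ x' < x := by
        ext x'
        simp only [Finset.mem_filter, Finset.mem_univ, true_and]
        refine and_congr_right fun h0 => ⟨fun h => ?_, fun h => ?_⟩
        · by_contra hlt
          have hlt : x < x' := lt_of_le_of_ne (not_lt.mp hlt) fun h => h0 (h ▸ hx)
          refine absurd h (not_le.mpr ?_)
          change (Finset.univ.filter fun w => s w = 0 ∧ w < x).card <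
            (Finset.univ.filter fun w => s w = 0 ∧ w < x').card
          refine Finset.card_lt_card (Finset.ssubset_iff_of_subset (fun w hw => by
            simp only [Finset.mem_filter, Finset.mem_univ, true_and] at hw ⊢
            exact ⟨hw.1, hw.2.trans hlt⟩) |>.mpr ⟨x, by simp [hx, hlt], by simp⟩)
        · change (Finset.univ.filter fun w => s w = 0 ∧ w < x').card ≤
            (Finset.univ.filter fun w => s w = 0 ∧ w < x).card
          exact Finset.card_le_card fun w hw => by
            simp only [Finset.mem_filter, Finset.mem_univ, true_and] at hw ⊢
            exact ⟨hw.1, hw.2.trans h⟩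
      rw [h2]
      change (x : ℕ) = (Finset.univ.filter fun x' => s x' = 0 ∧ x' < x).card + _
      have h3 := Finset.card_filter_add_card_filter_not (s := Finset.univ.filter fun x' => x' < x)
        (fun x' => s x' = 0)
      rw [Finset.filter_filter, Finset.filter_filter] at h3
      have h4 : (Finset.univ.filter fun x' : Fin (m + n) => x' < x).card = x := by
        rw [Finset.filter_gt_eq_Iio, Fin.card_Iio]
      rw [h4] at h3
      simp only [and_comm] at h3 ⊢
      exact h3.symm
  refine ⟨f, mem_occupations.mpr hf, ?_⟩
  have hle : (Finset.univ.filter fun x : Fin (m + n) => ∃ z < m, (x : ℕ) = z + cumul f z).card ≤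
      m := by
    calc _ ≤ ((Finset.range m).image fun z => z + cumul f z).card := by
          refine Finset.card_le_card_of_injOn (fun x => (x : ℕ)) (fun x hx => ?_)
            fun x _ y _ h => Fin.ext h
          obtain ⟨z, hz, h⟩ := (Finset.mem_filter.mp hx).2
          exact Finset.mem_coe.mpr (Finset.mem_image.mpr ⟨z, Finset.mem_range.mpr hz, h.symm⟩)
      _ ≤ _ := Finset.card_image_le.trans (by simp)
  have heq := Finset.eq_of_subset_of_card_le (s := Finset.univ.filter fun x => s x = 0)
    (t := Finset.univ.filter fun x : Fin (m + n) => ∃ z < m, (x : ℕ) = z + cumul f z)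
    (fun x hx => by
      simp only [Finset.mem_filter, Finset.mem_univ, true_and] at hx ⊢
      exact hsub x hx) (by rw [hholes]; exact hle)
  funext x
  have hx := Finset.ext_iff.mp heq x
  simp only [Finset.mem_filter, Finset.mem_univ, true_and] at hx
  by_cases h : s x = 0
  · rw [h]; exact packed_of f x (hx.mp h)
  · rw [packed_of_not f x fun h' => h (hx.mpr h')]
    have h2 := hval x h
    refine Fin.ext ?_
    rw [h2]
    refine val_one_of_pos ?_
    have := (s x).2
    omega

/-- Two particles in one gap would occupy neighbouring sites, namely the last two sites of the gap.
-/
theorem le_one_of_isDilute_packed (hN : 0 < N) {f : Fin (m + 1) → ℕ} (hf : ∑ z, f z = n)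
    (h : IsDilute (packed N m n f)) (z : Fin (m + 1)) : f z ≤ 1 := by
  by_contra hz
  push Not at hz
  have hle := cumul_le f z
  have hcz : f z ≤ cumul f z := (if_pos (le_refl (z : ℕ))).ge.trans (Finset.single_le_sum
    (f := fun z' : Fin (m + 1) => if (z' : ℕ) ≤ z then f z' else 0)
    (fun _ _ => Nat.zero_le _) (Finset.mem_univ z))
  have hzm : (z : ℕ) ≤ m := Nat.lt_succ_iff.mp z.2
  have hlt : ∀ z' : ℕ, z' < z → cumul f z' + 2 ≤ cumul f z := by
    intro z' hz'
    obtain ⟨k, hk⟩ : ∃ k, (z : ℕ) = k + 1 := ⟨z - 1, by omega⟩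
    have h1 := cumul_succ f (k := k) (by omega)
    have h2 : (⟨k + 1, by omega⟩ : Fin (m + 1)) = z := Fin.ext hk.symm
    rw [h2] at h1
    have h3 := cumul_mono f (show z' ≤ k by omega)
    rw [hk]
    omega
  have hone : ∀ x : Fin (m + n), (x : ℕ) + 1 = z + cumul f z ∨ (x : ℕ) + 2 = z + cumul f z →
      packed N m n f x = 1 := by
    intro x hx
    refine packed_of_not f x ?_
    rintro ⟨z', -, h'⟩
    rcases lt_or_ge z' z with hzz | hzz
    · have := hlt z' hzz
      omega
    · have := cumul_mono f hzz
      omega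
  have hx1 := hone ⟨z + cumul f z - 2, by omega⟩ (Or.inr (by simp only; omega))
  have hx2 := hone ⟨z + cumul f z - 1, by omega⟩ (Or.inl (by simp only; omega))
  have := h.2 ⟨z + cumul f z - 2, by omega⟩ ⟨z + cumul f z - 1, by omega⟩ (by simp only; omega)
  rw [hx1, hx2, val_one_of_pos hN] at this
  omega

end Packing

end HeisenbergChain
end

noncomputable section

namespace HeisenbergChain

/-! ### Comparison of low-energy states with free bosons. -/

section Comparison

variable {N m n : ℕ}

/-- The hard-core part of the Dirichlet form of the chain. -/
def exclusionForm {N L : ℕ} (ψ : Config N L → ℂ) : ℝ :=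
  ∑ x : Fin (L - 1), ∑ s : Config N L,
    if s ⟨x, by omega⟩ = 1 ∧ s ⟨x + 1, by omega⟩ = 0 then
      ‖ψ (hop ⟨x, by omega⟩ ⟨x + 1, by omega⟩ s) - ψ s‖ ^ 2 else 0

/-- A single particle entering an empty site leaves the weight unchanged and has rate `N` times the
weight; all other terms are nonnegative. -/
theorem exclusionForm_le {N L : ℕ} (hN : 0 < N) (ψ : Config N L → ℂ) :
    N / 2 * exclusionForm ψ ≤ qf (hamiltonian N L) ψ := by
  rw [qf_hamiltonian, exclusionForm, Finset.mul_sum]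
  refine Finset.sum_le_sum fun x _ => ?_
  have hxy : (⟨x, by omega⟩ : Fin L) ≠ ⟨x + 1, by omega⟩ := left_ne_right _ _ _
  set a : Fin L := ⟨x, by omega⟩
  set b : Fin L := ⟨x + 1, by omega⟩
  rw [qf_bond hxy, Finset.mul_sum, Finset.mul_sum]
  refine Finset.sum_le_sum fun s _ => ?_
  split_ifs with h
  · have h1 : ((s a : ℕ) : ℝ) = 1 := by rw [h.1, val_one_of_pos hN]; simp
    have h2 : ((s b : ℕ) : ℝ) = 0 := by rw [h.2]; simp
    have h3 := rate_eq hxy s (by rw [h.1]; exact one_ne_zero_of_pos hN)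
      (by rw [h.2]; intro h'; have := congrArg Fin.val h'; simp at this; omega)
    have hN' : (0 : ℝ) < N := by exact_mod_cast hN
    have hw : weight (hop a b s) = weight s := by
      rw [rate, h1, h2] at h3
      have h4 : weight (hop a b s) * N = weight s * N := by linear_combination -h3
      exact mul_right_cancel₀ hN'.ne' h4
    have h5 : rate a b s * ‖relAmp ψ s - relAmp ψ (hop a b s)‖ ^ 2 =
        N * ‖ψ (hop a b s) - ψ s‖ ^ 2 := by
      rw [relAmp, relAmp, hw, ← sub_div, norm_div, div_pow, Complex.norm_real, Real.norm_eq_abs,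
        sq_abs, Real.sq_sqrt (weight_pos s).le, norm_sub_rev, rate, h1, h2]
      have := (weight_pos s).ne'
      field_simp
      ring
    rw [h5]
    exact le_of_eq (by ring)
  · rw [mul_zero]
    exact mul_nonneg (by norm_num) (mul_nonneg (rate_nonneg _ _ _) (sq_nonneg _))

/-- Boson moves correspond injectively to hops in the chain. From a gap with `f` particles only the
last one hops, but the multiplicity is smaller than `n!` by at least the factor `f`. -/
theorem packed_form_le (hN : 0 < N) (ψ : Config N (m + n) → ℂ) :
    ∑ e : Fin m, ∑ f ∈ occupations (Fin (m + 1)) n, (multiplicity (n := n) f : ℝ) *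
      (f e.castSucc * ‖ψ (packed N m n (moveParticle f e.castSucc e.succ)) -
        ψ (packed N m n f)‖ ^ 2) ≤ n.factorial * exclusionForm ψ := by
  classical
  let P : Finset (Fin m × (Fin (m + 1) → ℕ)) :=
    (Finset.univ ×ˢ occupations (Fin (m + 1)) n).filter fun p => 0 < p.2 p.1.castSucc
  have hP : ∀ p ∈ P, (p.1 : ℕ) + cumul p.2 p.1 - 1 < m + n - 1 ∧ 0 < cumul p.2 p.1 ∧
      p.2 ∈ occupations (Fin (m + 1)) n := by
    intro p hp
    obtain ⟨hp, he⟩ := Finset.mem_filter.mp hp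
    have hp := (Finset.mem_product.mp hp).2
    have h1 := cumul_pos p.2 he
    have h2 := cumul_le p.2 p.1
    rw [mem_occupations.mp hp] at h2
    have := p.1.2
    exact ⟨by omega, h1, hp⟩
  let G : Fin (m + n - 1) × Config N (m + n) → ℝ := fun q =>
    if q.2 ⟨q.1, by omega⟩ = 1 ∧ q.2 ⟨q.1 + 1, by omega⟩ = 0 then
      ‖ψ (hop ⟨q.1, by omega⟩ ⟨q.1 + 1, by omega⟩ q.2) - ψ q.2‖ ^ 2 else 0
  let i : (p : Fin m × (Fin (m + 1) → ℕ)) → p ∈ P → Fin (m + n - 1) × Config N (m + n) :=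
    fun p hp => (⟨p.1 + cumul p.2 p.1 - 1, (hP p hp).1⟩, packed N m n p.2)
  have hinj : ∀ p hp p' hp', i p hp = i p' hp' → p = p' := by
    intro p hp p' hp' h
    have h1 : p.2 = p'.2 := packed_injOn hN (hP p hp).2.2 (hP p' hp').2.2 (congrArg Prod.snd h)
    have h2 : (p.1 : ℕ) + cumul p.2 p.1 - 1 = p'.1 + cumul p'.2 p'.1 - 1 :=
      congrArg (fun q => (Prod.fst q : Fin _).val) h
    have h3 := (hP p hp).2.1
    have h4 := (hP p' hp').2.1
    rw [← h1] at h2 h4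
    exact Prod.ext (Fin.ext ((hole_strictMono p.2).injective
      (show (p.1 : ℕ) + cumul p.2 p.1 = p'.1 + cumul p.2 p'.1 by omega))) h1
  have hterm : ∀ e : Fin m, ∀ f ∈ occupations (Fin (m + 1)) n, (multiplicity (n := n) f : ℝ) *
      (f e.castSucc * ‖ψ (packed N m n (moveParticle f e.castSucc e.succ)) -
        ψ (packed N m n f)‖ ^ 2) ≤ if 0 < f e.castSucc then n.factorial *
        ‖ψ (packed N m n (moveParticle f e.castSucc e.succ)) - ψ (packed N m n f)‖ ^ 2 else 0 := by
    intro e f hf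
    split_ifs with h
    · rw [← mul_assoc]
      refine mul_le_mul_of_nonneg_right ?_ (sq_nonneg _)
      exact_mod_cast multiplicity_mul_le (mem_occupations.mp hf) _
    · have : f e.castSucc = 0 := by omega
      rw [this]; simp
  calc _ ≤ ∑ e : Fin m, ∑ f ∈ occupations (Fin (m + 1)) n, if 0 < f e.castSucc then n.factorial *
        ‖ψ (packed N m n (moveParticle f e.castSucc e.succ)) - ψ (packed N m n f)‖ ^ 2 else 0 :=
        Finset.sum_le_sum fun e _ => Finset.sum_le_sum fun f hf => hterm e f hf
    _ = n.factorial * ∑ p ∈ P, ‖ψ (packed N m n (moveParticle p.2 p.1.castSucc p.1.succ)) -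
        ψ (packed N m n p.2)‖ ^ 2 := by
      rw [Finset.mul_sum, Finset.sum_filter, Finset.sum_product]
    _ ≤ n.factorial * ∑ q, G q := by
      refine mul_le_mul_of_nonneg_left ?_ (Nat.cast_nonneg _)
      have hG0 : ∀ q, 0 ≤ G q := fun q => by simp only [G]; split_ifs <;> positivity
      calc _ = ∑ q ∈ P.attach.image fun p => i p.1 p.2, G q := by
            rw [Finset.sum_image fun p _ p' _ h => Subtype.ext (hinj p.1 p.2 p'.1 p'.2 h),
              ← Finset.sum_attach P]
            refine Finset.sum_congr rfl fun p _ => ?_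
            have h1 := hP p.1 p.2
            have he := (Finset.mem_filter.mp p.2).2
            have hx : ((p.1.1 : ℕ) + cumul p.1.2 p.1.1 - 1) + 1 = p.1.1 + cumul p.1.2 p.1.1 := by
              omega
            simp only [G, i]
            rw [if_pos, packed_move p.1.2 he (x := ⟨_, by omega⟩)
              (y := ⟨p.1.1 + cumul p.1.2 p.1.1 - 1 + 1, by omega⟩) hx rfl]
            refine ⟨packed_left p.1.2 he hx, packed_of _ _ ⟨p.1.1, p.1.1.2, hx⟩⟩
        _ ≤ _ := Finset.sum_le_sum_of_subset_of_nonneg (Finset.subset_univ _) fun q _ _ => hG0 q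
    _ = _ := by rw [Fintype.sum_prod_type]; rfl

-- In a dilute configuration no gap holds two particles, so the multiplicity is exactly `n!`; other
-- configurations only add to the right side.
open Classical in
theorem sum_isDilute_le (hN : 0 < N) {ψ : Config N (m + n) → ℂ} (hψ : HasParticles n ψ) :
    n.factorial * ∑ s ∈ Finset.univ.filter (fun s : Config N (m + n) => IsDilute s), ‖ψ s‖ ^ 2 ≤
      ∑ f ∈ occupations (Fin (m + 1)) n,
        (multiplicity (n := n) f : ℝ) * ‖ψ (packed N m n f)‖ ^ 2 := by
  let D : Finset (Fin (m + 1) → ℕ) := (occupations (Fin (m + 1)) n).filter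
    fun f => IsDilute (packed N m n f)
  have h1 : ∑ s ∈ Finset.univ.filter (fun s : Config N (m + n) => IsDilute s), ‖ψ s‖ ^ 2 ≤
      ∑ s ∈ D.image (packed N m n), ‖ψ s‖ ^ 2 := by
    rw [← Finset.sum_filter_ne_zero]
    refine Finset.sum_le_sum_of_subset_of_nonneg (fun s hs => ?_) fun _ _ _ => sq_nonneg _
    simp only [Finset.mem_filter, Finset.mem_univ, true_and] at hs
    have h0 : ψ s ≠ 0 := fun h => hs.2 (by rw [h]; simp)
    obtain ⟨f, hf, rfl⟩ := exists_packed_eq hs.1.1 (hψ s h0)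
    exact Finset.mem_image_of_mem _ (Finset.mem_filter.mpr ⟨hf, hs.1⟩)
  rw [Finset.sum_image ((packed_injOn hN).mono fun f hf => (Finset.mem_filter.mp hf).1)] at h1
  calc _ ≤ n.factorial * ∑ f ∈ D, ‖ψ (packed N m n f)‖ ^ 2 :=
        mul_le_mul_of_nonneg_left h1 (Nat.cast_nonneg _)
    _ = ∑ f ∈ D, (multiplicity (n := n) f : ℝ) * ‖ψ (packed N m n f)‖ ^ 2 := by
        rw [Finset.mul_sum]
        refine Finset.sum_congr rfl fun f hf => ?_
        obtain ⟨hf, hd⟩ := Finset.mem_filter.mp hf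
        have hf := mem_occupations.mp hf
        rw [multiplicity_eq_factorial hf (le_one_of_isDilute_packed hN hf hd)]
    _ ≤ _ := Finset.sum_le_sum_of_subset_of_nonneg (Finset.filter_subset _ _) fun f _ _ => by
        positivity

/-- Energy of free bosons with given occupation numbers of the modes of a path. -/
def bosonEnergy (N m : ℕ) (f : Fin (m + 1) → ℕ) : ℝ :=
  N / 2 * ∑ k, (f k : ℝ) * neumannEigenvalue m k

/-- The mode occupation amplitudes of a hard-core wave function. -/
theorem exists_mode_amplitudes (hN : 0 < N) (m n : ℕ) :
    ∃ J : (Config N (m + n) → ℂ) →ₗ[ℂ] (occupations (Fin (m + 1)) n → ℂ), ∀ ψ,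
      ∑ f, ‖J ψ f‖ ^ 2 = (n.factorial : ℝ)⁻¹ * ∑ f ∈ occupations (Fin (m + 1)) n,
        (multiplicity (n := n) f : ℝ) * ‖ψ (packed N m n f)‖ ^ 2 ∧
      ∑ f : occupations (Fin (m + 1)) n, bosonEnergy N m f * ‖J ψ f‖ ^ 2 ≤
        qf (hamiltonian N (m + n)) ψ := by
  obtain ⟨u, hu⟩ := exists_neumann_modes m
  have hrep : ∀ f : occupations (Fin (m + 1)) n, ∃ x : Fin n → Fin (m + 1), occ x = f := fun f =>
    exists_occ_eq _ (mem_occupations.mp f.2)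
  choose rep hrep using hrep
  have hn : (0 : ℝ) < n.factorial := by exact_mod_cast n.factorial_pos
  -- The coefficients are symmetric in the modes, so one representative tuple per occupation
  -- suffices; the square root accounts for the other tuples and for the factor `n!`.
  let J : (Config N (m + n) → ℂ) →ₗ[ℂ] (occupations (Fin (m + 1)) n → ℂ) :=
    { toFun := fun ψ f => (Real.sqrt (multiplicity (n := n) f.1 / n.factorial) : ℝ) *
        analyze u (fun y => ψ (packed N m n (occ y))) (rep f)
      map_add' := fun v w => by
        ext f
        simp only [analyze, Pi.add_apply, mul_add, Finset.sum_add_distrib]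
      map_smul' := fun c v => by
        ext f
        simp only [analyze, Pi.smul_apply, smul_eq_mul, RingHom.id_apply, Finset.mul_sum]
        exact Finset.sum_congr rfl fun _ _ => by ring }
  have hJ : ∀ ψ (E : (Fin (m + 1) → ℕ) → ℝ), ∑ f : occupations (Fin (m + 1)) n, E f * ‖J ψ f‖ ^ 2 =
      (n.factorial : ℝ)⁻¹ * ∑ k : Fin n → Fin (m + 1), E (occ k) *
        ‖analyze u (fun y => ψ (packed N m n (occ y))) k‖ ^ 2 := by
    intro ψ E
    set φ : (Fin n → Fin (m + 1)) → ℂ := fun y => ψ (packed N m n (occ y)) with hφ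
    have hsym : ∀ (σ : Equiv.Perm (Fin n)) y, φ (y ∘ σ) = φ y := fun σ y => by
      simp only [hφ, occ_comp_perm]
    let F : (Fin (m + 1) → ℕ) → ℝ := fun f => if h : f ∈ occupations (Fin (m + 1)) n then
      E f * ‖analyze u φ (rep ⟨f, h⟩)‖ ^ 2 else 0
    have h1 : ∀ k : Fin n → Fin (m + 1), E (occ k) * ‖analyze u φ k‖ ^ 2 = F (occ k) := by
      intro k
      have hk : occ k ∈ occupations (Fin (m + 1)) n := mem_occupations.mpr (sum_occ k)
      simp only [F]
      rw [dif_pos hk]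
      obtain ⟨σ, hσ⟩ := exists_perm_of_occ_eq (hrep ⟨occ k, hk⟩)
      have h2 : analyze u φ k = analyze u φ (rep ⟨occ k, hk⟩) := by
        conv_lhs => rw [hσ]
        exact analyze_comp φ hsym σ _
      rw [h2]
    rw [Finset.sum_congr rfl fun k _ => h1 k, sum_tuple_eq F]
    change _ = _ * ∑ f ∈ occupations (Fin (m + 1)) n, _
    rw [Finset.mul_sum]
    refine Eq.trans (Finset.sum_congr rfl fun f _ => ?_)
      (Finset.sum_coe_sort (occupations (Fin (m + 1)) n) _)
    simp only [F]
    rw [dif_pos f.2]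
    change E f * ‖((Real.sqrt (multiplicity (n := n) f.1 / n.factorial) : ℝ) : ℂ) *
      analyze u φ (rep f)‖ ^ 2 = _
    rw [norm_mul, mul_pow, Complex.norm_real, Real.norm_eq_abs, sq_abs,
      Real.sq_sqrt (by positivity)]
    ring
  refine ⟨J, fun ψ => ⟨?_, ?_⟩⟩
  · have h1 := hJ ψ fun _ => 1
    simp only [one_mul] at h1
    rw [h1, ← hu.sum_norm_sq_synth, hu.synth_analyze]
    congr 1
    exact sum_tuple_eq fun f => ‖ψ (packed N m n f)‖ ^ 2
  · have h2 := hu.tupleForm_synth (n := n) (analyze u fun y => ψ (packed N m n (occ y)))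
    rw [hu.synth_analyze, tupleForm_occ (fun e => Fin.castSucc_lt_succ.ne) n
      fun f => ψ (packed N m n f)] at h2
    have h3 := packed_form_le hN ψ
    rw [h2] at h3
    rw [hJ ψ (bosonEnergy N m)]
    refine le_trans ?_ (exclusionForm_le hN ψ)
    have h4 : ∑ k : Fin n → Fin (m + 1), bosonEnergy N m (occ k) *
        ‖analyze u (fun y => ψ (packed N m n (occ y))) k‖ ^ 2 = N / 2 *
        ∑ k : Fin n → Fin (m + 1), (∑ i, neumannEigenvalue m (k i)) *
        ‖analyze u (fun y => ψ (packed N m n (occ y))) k‖ ^ 2 := by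
      rw [Finset.mul_sum]
      refine Finset.sum_congr rfl fun k _ => ?_
      rw [bosonEnergy, sum_comp_occ k fun a => neumannEigenvalue m a]
      ring
    rw [h4, inv_mul_eq_div, div_le_iff₀ hn]
    calc _ ≤ (N : ℝ) / 2 * (n.factorial * exclusionForm ψ) :=
          mul_le_mul_of_nonneg_left h3 (by positivity)
      _ = _ := by ring

-- On this space the map of `exists_mode_amplitudes` keeps at least the fraction `θ` of the squared
-- norm and does not raise the energy, so `finrank_le_card_of_form_le` applies at level `t / θ`.
open Classical in
theorem finrank_lowParticleSpace_le_card (hN : 0 < N) {t θ : ℝ} (ht : 0 ≤ t) (hθ : 0 < θ)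
    (h : ∀ ψ ∈ lowParticleSpace N (m + n) n t, θ * sqNorm ψ ≤
      ∑ s ∈ Finset.univ.filter (fun s : Config N (m + n) => IsDilute s), ‖ψ s‖ ^ 2) :
    Module.finrank ℂ (lowParticleSpace N (m + n) n t) ≤
      ((occupations (Fin (m + 1)) n).filter fun f => bosonEnergy N m f ≤ t / θ).card := by
  obtain ⟨J, hJ⟩ := exists_mode_amplitudes hN m n
  have hn : (0 : ℝ) < n.factorial := by exact_mod_cast n.factorial_pos
  have key := finrank_le_card_of_form_le (fun f : occupations (Fin (m + 1)) n => bosonEnergy N m f)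
    (t / θ) (J.comp (lowParticleSpace N (m + n) n t).subtype) ?_
  · refine key.trans (le_of_eq ?_)
    rw [← Finset.card_map (Function.Embedding.subtype _)]
    congr 1
    ext f
    simp
    tauto
  · rintro ⟨ψ, hψ⟩ h0
    have h0' : ψ ≠ 0 := fun h' => h0 (Subtype.ext h')
    have h1 : θ * sqNorm ψ ≤ ∑ f, ‖J ψ f‖ ^ 2 := by
      rw [(hJ ψ).1, inv_mul_eq_div, le_div_iff₀ hn]
      refine le_trans ?_ (sum_isDilute_le hN hψ.2)
      rw [mul_comm]
      exact mul_le_mul_of_nonneg_left (h ψ hψ) hn.le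
    have h2 : 0 < θ * sqNorm ψ := mul_pos hθ (sqNorm_pos h0')
    refine ⟨fun h' => ?_, ?_⟩
    · change J ψ = 0 at h'
      rw [h'] at h1
      simp at h1
      linarith
    · change ∑ f : occupations (Fin (m + 1)) n, bosonEnergy N m f * ‖J ψ f‖ ^ 2 ≤
        t / θ * ∑ f, ‖J ψ f‖ ^ 2
      refine (hJ ψ).2.trans ((qf_le_of_mem_lowSpace _ hψ.1).trans ?_)
      calc t * sqNorm ψ = t / θ * (θ * sqNorm ψ) := by field_simp
        _ ≤ _ := mul_le_mul_of_nonneg_left h1 (div_nonneg ht hθ.le)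

end Comparison

end HeisenbergChain
end

noncomputable section

namespace HeisenbergChain

/-! ### Upper bounds for the partition function of a box. -/

section UpperBounds

variable {N L : ℕ}

theorem geom_sum_le_inv_one_sub {x : ℝ} (h0 : 0 ≤ x) (h1 : x < 1) (n : ℕ) :
    ∑ i ∈ Finset.range n, x ^ i ≤ (1 - x)⁻¹ := by
  rw [← one_div, le_div_iff₀ (by linarith), geom_sum_mul_neg]
  have := pow_nonneg h0 n
  linarith

theorem partitionFunction_eq_sum (N L : ℕ) (β : ℝ) : partitionFunction N L β =
    ∑ i, Real.exp (-(β * (hamiltonian_isHermitian N L).eigenvalues i)) :=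
  heatTrace_eq_sum β (hamiltonian_isHermitian N L)

theorem eigenvalues_hamiltonian_nonneg (i) : 0 ≤ (hamiltonian_isHermitian N L).eigenvalues i := by
  classical
  set hA := hamiltonian_isHermitian N L
  have h1 := qf_hamiltonian_nonneg (uncoord hA (Pi.single i 1))
  rw [qf_eq_sum hA, Finset.sum_eq_single i] at h1
  · simpa [coord_uncoord] using h1
  · intro j _ hj
    rw [coord_uncoord, Pi.single_eq_of_ne hj]
    simp
  · simp

/-- A bound on the partition function that is efficient for short chains. -/
theorem partitionFunction_le_of_short (hN : 0 < N) (hL : 0 < L) {β : ℝ} (hβ : 0 ≤ β)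
    (h : (L : ℝ) * Real.exp (-(β * (N / (8 * (L : ℝ) ^ 2)))) ≤ 1 / 2) :
    partitionFunction N L β ≤ 2 * (N * L + 1 : ℕ) := by
  have hN' : (0 : ℝ) < N := by exact_mod_cast hN
  have hL' : (0 : ℝ) < L := by exact_mod_cast hL
  set w : ℝ := N / (8 * (L : ℝ) ^ 2) with hw
  have hw0 : 0 < w := by positivity
  set hA := hamiltonian_isHermitian N L
  obtain ⟨E, hE⟩ : ∃ E : ℝ, ∀ i, hA.eigenvalues i ≤ E :=
    ⟨∑ j, hA.eigenvalues j, fun i => Finset.single_le_sum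
      (f := hA.eigenvalues) (fun j _ => eigenvalues_hamiltonian_nonneg j) (Finset.mem_univ i)⟩
  let I : ℕ := ⌊E / w⌋₊
  -- Comparison spectrum: at energy below `(k + 1) w`, sectors beyond `k` particles reduce to `k`,
  -- so each of the `N L + 1` sectors has dimension at most `L ^ k`. The resulting sum is geometric
  -- with ratio at most 1/2.
  let b : (Σ i : Fin (I + 1), Fin ((N * L + 1) * L ^ (i : ℕ))) → ℝ := fun p => (p.1 : ℕ) * w
  have hcount : ∀ t ≤ E, (Finset.univ.filter fun i => hA.eigenvalues i ≤ t).card ≤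
      (Finset.univ.filter fun j => b j ≤ t).card := by
    intro t ht
    rcases lt_or_ge t 0 with h0 | h0
    · rw [Finset.filter_false_of_mem fun i _ =>
        not_le.mpr (h0.trans_le (eigenvalues_hamiltonian_nonneg i))]
      simp
    · set k := ⌊t / w⌋₊ with hk
      have hkI : k < I + 1 := Nat.lt_succ_of_le (Nat.floor_le_floor (by gcongr))
      have hlt : 8 * (L : ℝ) ^ 2 * t < (k + 1 : ℕ) * N := by
        have h1 := Nat.lt_floor_add_one (t / w)
        rw [div_lt_iff₀ hw0, hw] at h1
        have h2 : ((k : ℝ) + 1) * (N / (8 * (L : ℝ) ^ 2)) = ((k + 1 : ℕ) * N) / (8 * (L : ℝ) ^ 2) := by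
          push_cast; ring
        rw [h2, lt_div_iff₀ (by positivity)] at h1
        linarith
      rw [← finrank_lowSpace hA]
      calc Module.finrank ℂ (lowSpace hA t)
          ≤ ∑ n : Fin (N * L + 1), Module.finrank ℂ (lowParticleSpace N L n t) :=
            finrank_lowSpace_le_sum t
        _ ≤ ∑ n : Fin (N * L + 1), L ^ k := by
            refine Finset.sum_le_sum fun n _ =>
              (finrank_lowParticleSpace_le_min hN hL hlt n).trans
                ((finrank_lowParticleSpace_le_pow _ t).trans ?_)
            exact Nat.pow_le_pow_right hL (min_le_right _ _)
        _ = (Finset.univ : Finset (Fin ((N * L + 1) * L ^ k))).card := by simp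
        _ ≤ _ := by
            refine Finset.card_le_card_of_injOn (fun r => ⟨⟨k, hkI⟩, r⟩) (fun r _ => ?_) ?_
            · simp only [Finset.coe_filter, Finset.mem_univ, true_and, Set.mem_ofPred_eq, b]
              have := Nat.floor_le (div_nonneg h0 hw0.le)
              rwa [le_div_iff₀ hw0] at this
            · intro r _ r' _ h
              simpa using h
  have key := sum_le_sum_of_card_le hA.eigenvalues b E _ (antitone_exp_neg hβ)
    (fun x => (Real.exp_pos _).le) hcount
  rw [Finset.filter_true_of_mem fun i _ => hE i] at key
  rw [partitionFunction_eq_sum]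
  refine key.trans ?_
  rw [Fintype.sum_sigma]
  set r : ℝ := L * Real.exp (-(β * w)) with hr
  have hr0 : 0 ≤ r := by positivity
  have hterm : ∀ i : Fin (I + 1), ∑ j : Fin ((N * L + 1) * L ^ (i : ℕ)),
      Real.exp (-(β * b ⟨i, j⟩)) = (N * L + 1 : ℕ) * r ^ (i : ℕ) := by
    intro i
    simp only [b, Finset.sum_const, Finset.card_univ, Fintype.card_fin, nsmul_eq_mul]
    rw [hr, mul_pow, ← Real.exp_nat_mul]
    push_cast
    rw [mul_assoc]
    congr 3
    ring
  rw [Finset.sum_congr rfl fun i _ => hterm i, ← Finset.mul_sum, mul_comm]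
  refine mul_le_mul_of_nonneg_right ?_ (Nat.cast_nonneg _)
  rw [Fin.sum_univ_eq_sum_range fun i => r ^ i]
  calc ∑ i ∈ Finset.range (I + 1), r ^ i ≤ (1 - r)⁻¹ :=
        geom_sum_le_inv_one_sub hr0 (by linarith) _
    _ ≤ 2 := by
        rw [inv_le_comm₀ (by linarith) two_pos]
        linarith

/-- The partition function of free bosons, with the zero mode left out. -/
def bosonProduct (N L : ℕ) (β : ℝ) : ℝ :=
  ∏ k ∈ Finset.range L, (1 - Real.exp (-(β * (N / 2 * neumannEigenvalue L (k + 1)))))⁻¹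

theorem neumannEigenvalue_pos {m k : ℕ} (hk : 0 < k) (hkm : k ≤ m) : 0 < neumannEigenvalue m k := by
  have hm : (0 : ℝ) < (m + 1 : ℕ) := by positivity
  have hk' : (0 : ℝ) < k := by exact_mod_cast hk
  have h1 : Real.pi * k / (m + 1 : ℕ) ≤ Real.pi := by
    rw [div_le_iff₀ hm]
    exact mul_le_mul_of_nonneg_left (by exact_mod_cast (by omega)) Real.pi_pos.le
  have h2 := Real.cos_lt_cos_of_nonneg_of_le_pi le_rfl h1 (by positivity)
  rw [Real.cos_zero] at h2
  rw [neumannEigenvalue]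
  linarith

theorem neumannEigenvalue_anti {m L k : ℕ} (hkm : k ≤ m) (hmL : m ≤ L) :
    neumannEigenvalue L k ≤ neumannEigenvalue m k := by
  have hm : (0 : ℝ) < (m + 1 : ℕ) := by positivity
  have h1 : Real.pi * k / (m + 1 : ℕ) ≤ Real.pi := by
    rw [div_le_iff₀ hm]
    exact mul_le_mul_of_nonneg_left (by exact_mod_cast (by omega)) Real.pi_pos.le
  have h2 : Real.pi * k / (L + 1 : ℕ) ≤ Real.pi * k / (m + 1 : ℕ) := by
    apply div_le_div_of_nonneg_left (by positivity) hm
    exact_mod_cast (by omega)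
  have := Real.cos_le_cos_of_nonneg_of_le_pi (by positivity) h1 h2
  rw [neumannEigenvalue, neumannEigenvalue]
  linarith

/-- The zero mode costs no energy and its occupation follows from the others; dropping the
constraint on these leaves a product of geometric series. A shorter path has larger eigenvalues, so
`L` may replace `m`. -/
theorem sum_exp_bosonEnergy_le (hN : 0 < N) {m n : ℕ} (hm : m ≤ L) {β : ℝ} (hβ : 0 < β) :
    ∑ f : occupations (Fin (m + 1)) n, Real.exp (-(β * bosonEnergy N m f)) ≤
      bosonProduct N L β := by
  have hN' : (0 : ℝ) < N := by exact_mod_cast hN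
  let x : ℕ → ℝ := fun k => Real.exp (-(β * (N / 2 * neumannEigenvalue m (k + 1))))
  let y : ℕ → ℝ := fun k => Real.exp (-(β * (N / 2 * neumannEigenvalue L (k + 1))))
  have hxy : ∀ k < m, x k ≤ y k := by
    intro k hk
    have := neumannEigenvalue_anti (k := k + 1) hk hm
    apply Real.exp_le_exp.mpr
    gcongr
  have hy : ∀ k < L, y k < 1 := by
    intro k hk
    have := neumannEigenvalue_pos k.succ_pos hk
    rw [Real.exp_lt_one_iff, neg_lt_zero]
    positivity
  have hx0 : ∀ k, 0 < x k := fun k => Real.exp_pos _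
  have hy0 : ∀ k, 0 < y k := fun k => Real.exp_pos _
  have hterm : ∀ f : occupations (Fin (m + 1)) n, Real.exp (-(β * bosonEnergy N m f)) =
      ∏ k : Fin m, x k ^ f.1 k.succ := by
    intro f
    have h0 : neumannEigenvalue m 0 = 0 := by simp [neumannEigenvalue]
    rw [bosonEnergy, Fin.sum_univ_succ, Fin.val_zero, h0, mul_zero, zero_add, Finset.mul_sum,
      Finset.mul_sum, ← Finset.sum_neg_distrib, Real.exp_sum]
    refine Finset.prod_congr rfl fun k _ => ?_
    simp only [x]
    rw [← Real.exp_nat_mul, Fin.val_succ]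
    congr 1
    ring
  have hle : ∀ f : occupations (Fin (m + 1)) n, ∀ k, f.1 k < n + 1 := by
    intro f k
    have h1 := mem_occupations.mp f.2
    have h2 := Finset.single_le_sum (f := f.1) (fun _ _ => Nat.zero_le _) (Finset.mem_univ k)
    omega
  let r : occupations (Fin (m + 1)) n → Fin m → Fin (n + 1) := fun f k => ⟨f.1 k.succ, hle f _⟩
  have hr : Function.Injective r := by
    intro f g h
    have h1 : ∀ k : Fin m, f.1 k.succ = g.1 k.succ := fun k => congrArg Fin.val (congrFun h k)
    have hf := mem_occupations.mp f.2
    have hg := mem_occupations.mp g.2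
    rw [Fin.sum_univ_succ] at hf hg
    rw [Finset.sum_congr rfl fun k _ => h1 k] at hf
    refine Subtype.ext (funext fun k => ?_)
    refine Fin.cases ?_ h1 k
    omega
  calc _ = ∑ f, ∏ k : Fin m, x k ^ (r f k : ℕ) := Finset.sum_congr rfl fun f _ => hterm f
    _ ≤ ∑ g : Fin m → Fin (n + 1), ∏ k : Fin m, x k ^ (g k : ℕ) := by
        rw [← Finset.sum_image (f := fun g : Fin m → Fin (n + 1) => ∏ k : Fin m, x k ^ (g k : ℕ))
          fun a _ b _ h => hr h]
        exact Finset.sum_le_sum_of_subset_of_nonneg (Finset.subset_univ _) fun g _ _ =>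
          Finset.prod_nonneg fun k _ => pow_nonneg (hx0 k).le _
    _ = ∏ k : Fin m, ∑ j : Fin (n + 1), x k ^ (j : ℕ) := by
        rw [Finset.prod_univ_sum, Fintype.piFinset_univ]
    _ ≤ ∏ k : Fin m, (1 - y k)⁻¹ := by
        refine Finset.prod_le_prod (fun k _ => Finset.sum_nonneg fun j _ =>
          pow_nonneg (hx0 k).le _) fun k _ => ?_
        rw [Fin.sum_univ_eq_sum_range fun i => x k ^ i]
        have h1 := hxy k k.2
        have h2 := hy k (by omega)
        refine (geom_sum_le_inv_one_sub (hx0 k).le (by linarith) _).trans ?_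
        exact inv_anti₀ (by linarith) (by linarith)
    _ = ∏ k ∈ Finset.range m, (1 - y k)⁻¹ := Fin.prod_univ_eq_prod_range (fun k => (1 - y k)⁻¹) m
    _ ≤ ∏ k ∈ Finset.range L, (1 - y k)⁻¹ := by
        refine Finset.prod_le_prod_of_subset_of_one_le (Finset.range_mono hm) (fun k hk => ?_)
          fun k hk _ => ?_
        · have := hy k ((Finset.mem_range.mp hk).trans_le hm)
          exact inv_nonneg.mpr (by linarith)
        · have := hy k (Finset.mem_range.mp hk)
          have := hy0 k
          exact (one_le_inv₀ (by linarith)).mpr (by linarith)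

-- The hypothesis `hθ` makes the close-pair estimate at most the fraction `1 - θ` of the squared
-- norm, uniformly in `n ≤ n₀` and in energies up to `E`.
open Classical in
theorem le_sum_isDilute (hN : 0 < N) {n n₀ d : ℕ} (hn : n ≤ n₀) {t E θ : ℝ} (htE : t ≤ E)
    (hd0 : 0 < d) (hd : 2 * d ≤ L)
    (hθ : 6 * (n₀ : ℝ) ^ 2 + 576 * (d : ℝ) ^ 3 * E ≤ (1 - θ) * d) {ψ : Config N L → ℂ}
    (hψ : ψ ∈ lowParticleSpace N L n t) :
    θ * sqNorm ψ ≤ ∑ s ∈ Finset.univ.filter (fun s : Config N L => IsDilute s), ‖ψ s‖ ^ 2 := by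
  have hd' : (0 : ℝ) < d := by exact_mod_cast hd0
  have h1 := sum_not_isDilute_le ψ
  have h2 := sum_not_isDilute_le_energy hN hψ.2 hd0 hd
  have h3 := qf_le_of_mem_lowSpace _ hψ.1
  have h4 := Finset.sum_filter_add_sum_filter_not Finset.univ
    (fun s : Config N L => IsDilute s) fun s => ‖ψ s‖ ^ 2
  have h5 : (n : ℝ) ≤ n₀ := by exact_mod_cast hn
  have h6 : (d : ℝ) * ∑ p ∈ closePairs N L, pairDensity (blobAmp ψ) p.1 p.2 ≤
      ((1 - θ) * d) * sqNorm ψ := by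
    refine h2.trans ((?_ : _ ≤ (6 * (n₀ : ℝ) ^ 2 + 576 * (d : ℝ) ^ 3 * E) * sqNorm ψ).trans
      (mul_le_mul_of_nonneg_right hθ (sqNorm_nonneg ψ)))
    have h7 : qf (hamiltonian N L) ψ ≤ E * sqNorm ψ :=
      h3.trans (mul_le_mul_of_nonneg_right htE (sqNorm_nonneg ψ))
    have h8 : 6 * (n : ℝ) ^ 2 * sqNorm ψ ≤ 6 * (n₀ : ℝ) ^ 2 * sqNorm ψ := by
      have := sqNorm_nonneg ψ
      gcongr
    have h9 : 576 * (d : ℝ) ^ 3 * qf (hamiltonian N L) ψ ≤ 576 * (d : ℝ) ^ 3 * (E * sqNorm ψ) :=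
      mul_le_mul_of_nonneg_left h7 (by positivity)
    linarith
  have h10 : ∑ p ∈ closePairs N L, pairDensity (blobAmp ψ) p.1 p.2 ≤ (1 - θ) * sqNorm ψ := by
    have : (d : ℝ) * ∑ p ∈ closePairs N L, pairDensity (blobAmp ψ) p.1 p.2 ≤
      d * ((1 - θ) * sqNorm ψ) := by linarith
    exact le_of_mul_le_mul_left this hd'
  have h11 : sqNorm ψ = ∑ s, ‖ψ s‖ ^ 2 := rfl
  rw [← h4] at h11
  linarith

/-- The comparison of the chain with free bosons. -/
theorem partitionFunction_le (hN : 0 < N) {n₀ d : ℕ} {E θ β : ℝ} (hβ : 0 < β) (hn₀ : n₀ ≤ L)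
    (hd0 : 0 < d) (hd : 2 * d ≤ L) (hθ0 : 0 < θ)
    (hθ : 6 * (n₀ : ℝ) ^ 2 + 576 * (d : ℝ) ^ 3 * E ≤ (1 - θ) * d)
    (hE : 8 * (L : ℝ) ^ 2 * E < (n₀ + 1 : ℕ) * N) :
    partitionFunction N L β ≤ (N * L + 1 : ℕ) * bosonProduct N L (β * θ) +
      Real.exp (-(β / 2 * E)) * partitionFunction N L (β / 2) := by
  classical
  set hA := hamiltonian_isHermitian N L
  have hL : 0 < L := by omega
  rw [partitionFunction_eq_sum, partitionFunction_eq_sum,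
    ← Finset.sum_filter_add_sum_filter_not Finset.univ (fun i => hA.eigenvalues i ≤ E)]
  refine add_le_add ?_ ?_
  -- Levels up to `E`: by `hE`, sectors with more than `n₀` particles are no larger than the one
  -- with `n₀`, which leaves at most `N L + 1` bosonic sums.
  · let ν : Fin (N * L + 1) → ℕ := fun n => min n n₀
    have hν : ∀ n, ν n ≤ n₀ := fun n => min_le_right _ _
    let b : (Σ n : Fin (N * L + 1), occupations (Fin (L - ν n + 1)) (ν n)) → ℝ := fun p =>
      θ * bosonEnergy N (L - ν p.1) p.2
    have hcount : ∀ t ≤ E, (Finset.univ.filter fun i => hA.eigenvalues i ≤ t).card ≤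
        (Finset.univ.filter fun j => b j ≤ t).card := by
      intro t ht
      rcases lt_or_ge t 0 with h0 | h0
      · rw [Finset.filter_false_of_mem fun i _ =>
          not_le.mpr (h0.trans_le (eigenvalues_hamiltonian_nonneg i))]
        simp
      · have hlt : 8 * (L : ℝ) ^ 2 * t < (n₀ + 1 : ℕ) * N :=
          lt_of_le_of_lt (mul_le_mul_of_nonneg_left ht (by positivity)) hE
        have hone : ∀ n ≤ n₀, ∀ m, m + n = L → Module.finrank ℂ (lowParticleSpace N L n t) ≤
            ((occupations (Fin (m + 1)) n).filter fun f => bosonEnergy N m f ≤ t / θ).card := by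
          rintro n hn m rfl
          exact finrank_lowParticleSpace_le_card hN h0 hθ0 fun ψ hψ =>
            le_sum_isDilute hN hn ht hd0 hd hθ hψ
        rw [← finrank_lowSpace hA]
        calc Module.finrank ℂ (lowSpace hA t)
            ≤ ∑ n : Fin (N * L + 1), Module.finrank ℂ (lowParticleSpace N L n t) :=
              finrank_lowSpace_le_sum t
          _ ≤ ∑ n : Fin (N * L + 1), ((occupations (Fin (L - ν n + 1)) (ν n)).filter
                fun f => bosonEnergy N (L - ν n) f ≤ t / θ).card :=
              Finset.sum_le_sum fun n _ => (finrank_lowParticleSpace_le_min hN hL hlt n).trans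
                (hone (ν n) (hν n) (L - ν n) (by have := hν n; omega))
          _ = _ := by
              rw [Finset.card_filter, Fintype.sum_sigma]
              refine Finset.sum_congr rfl fun n _ => ?_
              rw [Finset.card_filter, ← Finset.sum_coe_sort]
              refine Finset.sum_congr rfl fun f _ => ?_
              simp only [b, le_div_iff₀' hθ0]
    have key := sum_le_sum_of_card_le hA.eigenvalues b E _ (antitone_exp_neg hβ.le)
      (fun x => (Real.exp_pos _).le) hcount
    refine key.trans ?_
    rw [Fintype.sum_sigma]
    calc _ ≤ ∑ n : Fin (N * L + 1), bosonProduct N L (β * θ) := by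
          refine Finset.sum_le_sum fun n _ => ?_
          refine le_trans (le_of_eq ?_) (sum_exp_bosonEnergy_le hN (m := L - ν n) (n := ν n)
            (Nat.sub_le _ _) (mul_pos hβ hθ0))
          refine Finset.sum_congr rfl fun f _ => ?_
          simp only [b, mul_assoc]
      _ = _ := by simp
  -- Levels above `E`: one half of the exponent is estimated at `E`, the other is left to the
  -- partition function at `β / 2`.
  · rw [Finset.mul_sum]
    calc _ ≤ ∑ i ∈ Finset.univ.filter (fun i => ¬ hA.eigenvalues i ≤ E),
          Real.exp (-(β / 2 * E)) * Real.exp (-(β / 2 * hA.eigenvalues i)) := by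
          refine Finset.sum_le_sum fun i hi => ?_
          have hi := not_le.mp (Finset.mem_filter.mp hi).2
          rw [← Real.exp_add, Real.exp_le_exp]
          have : β / 2 * E ≤ β / 2 * hA.eigenvalues i :=
            mul_le_mul_of_nonneg_left hi.le (by positivity)
          linarith
      _ ≤ _ := Finset.sum_le_sum_of_subset_of_nonneg (Finset.filter_subset _ _) fun i _ _ => by
          positivity

end UpperBounds

end HeisenbergChain
end

noncomputable section

namespace HeisenbergChain

/-! ### Sums over bounded occupation numbers. -/

section ConfigSums

theorem pairwiseDisjoint_occupations {α : Type*} [Fintype α] [DecidableEq α] (T : Set ℕ) :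
    T.PairwiseDisjoint (occupations α) := by
  intro n _ n' _ hne
  refine Finset.disjoint_left.mpr fun f hf hf' => hne ?_
  rw [← mem_occupations.mp hf, ← mem_occupations.mp hf']

theorem sum_config_eq {J K M : ℕ} (hM : J * K ≤ M) (G : (Fin K → ℕ) → ℝ) :
    ∑ s : Config J K, G (fun k => (s k : ℕ)) = ∑ n ∈ Finset.range (M + 1),
      ∑ g ∈ occupations (Fin K) n, if ∀ k, g k ≤ J then G g else 0 := by
  classical
  rw [← Finset.sum_biUnion (pairwiseDisjoint_occupations _), ← Finset.sum_filter]
  refine Finset.sum_bij (fun s _ k => (s k : ℕ)) (fun s _ => ?_) (fun s _ t _ h => ?_)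
    (fun g hg => ?_) fun _ _ => rfl
  · refine Finset.mem_filter.mpr ⟨Finset.mem_biUnion.mpr ⟨_, ?_, mem_occupations.mpr rfl⟩,
      fun k => Nat.lt_succ_iff.mp (s k).2⟩
    rw [Finset.mem_range, Nat.lt_succ_iff]
    refine le_trans (Finset.sum_le_card_nsmul _ _ J fun k _ => Nat.lt_succ_iff.mp (s k).2) ?_
    simpa [mul_comm] using hM
  · exact funext fun k => Fin.ext (congrFun h k)
  · exact ⟨fun k => ⟨g k, Nat.lt_succ_iff.mpr ((Finset.mem_filter.mp hg).2 k)⟩,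
      Finset.mem_univ _, rfl⟩

end ConfigSums

/-! ### Bosonic trial functions. -/

section Trial

variable {α : Type*} [Fintype α] [DecidableEq α] {J K : ℕ}

/-- A function of boundedly many bosons as a function of occupation numbers. -/
def truncated (v : Config J K → ℂ) (g : Fin K → ℕ) : ℂ :=
  if h : ∀ k, g k ≤ J then v fun k => ⟨g k, Nat.lt_succ_iff.mpr (h k)⟩ else 0

theorem truncated_val (v : Config J K → ℂ) (s : Config J K) :
    truncated v (fun k => (s k : ℕ)) = v s := by
  rw [truncated, dif_pos fun k => Nat.lt_succ_iff.mp (s k).2]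

/-- Coefficients of a tuple wave function. -/
def tupleCoeff (v : Config J K → ℂ) (n : ℕ) (k : Fin n → Fin K) : ℂ :=
  ((Real.sqrt (multiplicity (n := n) (occ k)))⁻¹ : ℝ) * truncated v (occ k)

/-- The wave function of `n` bosons in given modes. -/
def tupleTrial (u : Fin K → α → ℝ) (v : Config J K → ℂ) (n : ℕ) (y : Fin n → α) : ℂ :=
  synth u (tupleCoeff v n) y

theorem tupleTrial_comp (u : Fin K → α → ℝ) (v : Config J K → ℂ) {n : ℕ} (y : Fin n → α)
    (σ : Equiv.Perm (Fin n)) : tupleTrial u v n (y ∘ σ) = tupleTrial u v n y := by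
  rw [tupleTrial, tupleTrial, synth, synth,
    ← Equiv.sum_comp (Equiv.arrowCongr σ.symm (Equiv.refl (Fin K)))]
  refine Finset.sum_congr rfl fun k _ => ?_
  have h1 : (Equiv.arrowCongr σ.symm (Equiv.refl (Fin K))) k = k ∘ σ := rfl
  have h2 : prodMode u (k ∘ σ) (y ∘ σ) = prodMode u k y :=
    Equiv.prod_comp σ fun i => u (k i) (y i)
  rw [h1, h2, tupleCoeff, tupleCoeff, occ_comp_perm]

/-- The wave function as a function of the occupation numbers of sites. -/
def occTrial (u : Fin K → α → ℝ) (v : Config J K → ℂ) (f : α → ℕ) : ℂ :=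
  tupleTrial u v (∑ a, f a) (exists_occ_eq f rfl).choose

/-- Permutation symmetry makes the value independent of the representative chosen in `occTrial`. -/
theorem tupleTrial_eq (u : Fin K → α → ℝ) (v : Config J K → ℂ) {n : ℕ} (y : Fin n → α) :
    tupleTrial u v n y = occTrial u v (occ y) := by
  have key : ∀ {n' : ℕ} (x : Fin n' → α), occ x = occ y →
      tupleTrial u v n y = tupleTrial u v n' x := by
    intro n' x h
    have hn : n' = n := by rw [← sum_occ x, h, sum_occ]
    subst hn
    obtain ⟨σ, rfl⟩ := exists_perm_of_occ_eq h
    exact tupleTrial_comp u v x σ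
  exact key _ (exists_occ_eq (occ y) rfl).choose_spec

/-- The inverse square root of the multiplicity compensates for the number of tuples with the same
occupation, so the passage from `v` to all its sectors is isometric. -/
theorem sum_tupleCoeff {M : ℕ} (hM : J * K ≤ M) (v : Config J K → ℂ) (E : (Fin K → ℕ) → ℝ) :
    ∑ n ∈ Finset.range (M + 1), ∑ k : Fin n → Fin K, E (occ k) * ‖tupleCoeff v n k‖ ^ 2 =
      ∑ s : Config J K, E (fun k => (s k : ℕ)) * ‖v s‖ ^ 2 := by
  have h1 := sum_config_eq hM fun g => E g * ‖truncated v g‖ ^ 2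
  simp only [truncated_val] at h1
  rw [h1]
  refine Finset.sum_congr rfl fun n _ => ?_
  have h2 : ∀ k : Fin n → Fin K, E (occ k) * ‖tupleCoeff v n k‖ ^ 2 =
      E (occ k) * ((multiplicity (n := n) (occ k) : ℝ)⁻¹ * ‖truncated v (occ k)‖ ^ 2) := by
    intro k
    rw [tupleCoeff, norm_mul, mul_pow, Complex.norm_real, Real.norm_eq_abs, sq_abs, inv_pow,
      Real.sq_sqrt (Nat.cast_nonneg _)]
  rw [Finset.sum_congr rfl fun k _ => h2 k, sum_tuple_eq fun g =>
    E g * ((multiplicity (n := n) g : ℝ)⁻¹ * ‖truncated v g‖ ^ 2)]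
  refine Finset.sum_congr rfl fun g hg => ?_
  have h3 : (multiplicity (n := n) g : ℝ) ≠ 0 := by
    exact_mod_cast (multiplicity_pos (mem_occupations.mp hg)).ne'
  split_ifs with h
  · field_simp
  · rw [truncated, dif_neg h]; simp

theorem tupleCoeff_eq_zero (v : Config J K → ℂ) {n : ℕ} (hn : J * K < n) (k : Fin n → Fin K) :
    tupleCoeff v n k = 0 := by
  rw [tupleCoeff, truncated, dif_neg, mul_zero]
  intro h
  have h1 := Finset.sum_le_card_nsmul Finset.univ (occ k) J fun a _ => h a
  rw [sum_occ] at h1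
  simp [mul_comm] at h1
  omega

theorem occ_le_one_iff {n : ℕ} (y : Fin n → α) : (∀ a, occ y a ≤ 1) ↔ Function.Injective y := by
  constructor
  · intro h i j hij
    exact Finset.card_le_one.mp (h (y i)) i (by simp) j (by simp [hij])
  · intro h a
    exact Finset.card_le_one.mpr fun i hi j hj => h (by
      rw [(Finset.mem_filter.mp hi).2, (Finset.mem_filter.mp hj).2])

/-- With `ℓ` sites, there are at least `(ℓ - n) ^ n` injective tuples when `n ≤ ℓ`, and Bernoulli's
inequality applies. For `n > ℓ` the right side is at least the number of all tuples. -/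
theorem card_not_injective_le (n : ℕ) [Nonempty α] [DecidablePred fun y : Fin n → α => Function.Injective y] :
    ((Finset.univ.filter fun y : Fin n → α => ¬ Function.Injective y).card : ℝ) ≤
      (n : ℝ) ^ 2 / Fintype.card α * (Fintype.card α : ℝ) ^ n := by
  have hpos : (0 : ℝ) < Fintype.card α := by exact_mod_cast Fintype.card_pos
  have h1 := Finset.card_filter_add_card_filter_not (s := Finset.univ)
    (fun y : Fin n → α => Function.Injective y)
  rw [Finset.card_univ, Fintype.card_fun, Fintype.card_fin] at h1
  have h2 : (Finset.univ.filter fun y : Fin n → α => Function.Injective y).card =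
      (Fintype.card α).descFactorial n := by
    rw [← Fintype.card_subtype, Fintype.card_congr (Equiv.subtypeInjectiveEquivEmbedding (Fin n) α),
      Fintype.card_embedding_eq, Fintype.card_fin]
  have h1' : ((Finset.univ.filter fun y : Fin n → α => Function.Injective y).card : ℝ) +
      (Finset.univ.filter fun y : Fin n → α => ¬ Function.Injective y).card =
        (Fintype.card α : ℝ) ^ n := by exact_mod_cast h1
  rw [h2] at h1'
  set ℓ := Fintype.card α
  by_cases hn : n ≤ ℓ
  · have h3 : ((ℓ : ℝ) - n) ^ n ≤ (ℓ.descFactorial n : ℝ) := by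
      have h4 := Nat.pow_sub_le_descFactorial ℓ n
      have h5 : ((ℓ - n : ℕ) : ℝ) ^ n ≤ ((ℓ.descFactorial n : ℕ) : ℝ) := by
        exact_mod_cast (Nat.pow_le_pow_left (by omega) n).trans h4
      rwa [Nat.cast_sub hn] at h5
    have h6 : 1 + (n : ℝ) * (-(n / ℓ)) ≤ (1 + -(n / ℓ)) ^ n := by
      apply one_add_mul_le_pow
      have : (n : ℝ) / ℓ ≤ 1 := by rw [div_le_one hpos]; exact_mod_cast hn
      linarith
    have h7 : ((ℓ : ℝ) - n) ^ n = (1 + -((n : ℝ) / ℓ)) ^ n * (ℓ : ℝ) ^ n := by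
      rw [← mul_pow]
      congr 1
      field_simp
      ring
    have h8 := mul_le_mul_of_nonneg_right h6 (pow_nonneg hpos.le n)
    have h9 : (1 + (n : ℝ) * (-(n / ℓ))) * (ℓ : ℝ) ^ n = (ℓ : ℝ) ^ n - n ^ 2 / ℓ * (ℓ : ℝ) ^ n := by
      ring
    linarith
  · have h3 : (1 : ℝ) ≤ (n : ℝ) ^ 2 / ℓ := by
      rw [le_div_iff₀ hpos, one_mul]
      have : (ℓ : ℝ) ≤ n := by exact_mod_cast (not_le.mp hn).le
      have h4 : (1 : ℝ) ≤ n := by exact_mod_cast (Nat.one_le_iff_ne_zero.mpr (by omega))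
      nlinarith
    have h4 := le_mul_of_one_le_left (pow_nonneg hpos.le n) h3
    have h5 : (0 : ℝ) ≤ (ℓ.descFactorial n : ℝ) := Nat.cast_nonneg _
    linarith

/-- Cauchy–Schwarz and the pointwise bound on the modes. Tuples with a coincidence are few, and by
this bound each carries little norm. -/
theorem norm_sq_synth_le {n : ℕ} {u : Fin K → α → ℝ} {C : ℝ} (hC : ∀ k a, u k a ^ 2 ≤ C)
    (c : (Fin n → Fin K) → ℂ) (y : Fin n → α) :
    ‖synth u c y‖ ^ 2 ≤ (K * C) ^ n * ∑ k, ‖c k‖ ^ 2 := by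
  have h1 : ‖synth u c y‖ ≤ ∑ k, ‖c k‖ * |prodMode u k y| := by
    refine (norm_sum_le _ _).trans (le_of_eq (Finset.sum_congr rfl fun k _ => ?_))
    rw [norm_mul, Complex.norm_real, Real.norm_eq_abs]
  have h2 : ∑ k, |prodMode u k y| ^ 2 ≤ (K * C) ^ n := by
    calc ∑ k, |prodMode u k y| ^ 2 ≤ ∑ k : Fin n → Fin K, C ^ n := by
          refine Finset.sum_le_sum fun k _ => ?_
          rw [sq_abs, prodMode, ← Finset.prod_pow]
          calc ∏ i, u (k i) (y i) ^ 2 ≤ ∏ _i : Fin n, C :=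
                Finset.prod_le_prod (fun _ _ => sq_nonneg _) fun i _ => hC _ _
            _ = _ := by simp
      _ = _ := by simp [mul_pow]
  calc ‖synth u c y‖ ^ 2 ≤ (∑ k, ‖c k‖ * |prodMode u k y|) ^ 2 := by gcongr
    _ ≤ (∑ k, ‖c k‖ ^ 2) * ∑ k, |prodMode u k y| ^ 2 := Finset.sum_mul_sq_le_sq_mul_sq _ _ _
    _ ≤ (∑ k, ‖c k‖ ^ 2) * (K * C) ^ n :=
        mul_le_mul_of_nonneg_left h2 (Finset.sum_nonneg fun _ _ => sq_nonneg _)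
    _ = _ := mul_comm _ _

open Classical in
/-- The norm of a superposition is carried by tuples of distinct sites. -/
theorem IsModeSystem.le_sum_injective {E : Type*} [Fintype E] [Nonempty α] {src tgt : E → α}
    {u : Fin K → α → ℝ} {μ : Fin K → ℝ} (hu : IsModeSystem src tgt u μ) {C R : ℝ}
    (hC : ∀ k a, u k a ^ 2 ≤ C) (hC0 : 0 ≤ C) (hR : 1 ≤ R) (hCR : Fintype.card α * (K * C) ≤ R)
    {n n₀ : ℕ} (hn : n ≤ n₀) (c : (Fin n → Fin K) → ℂ) :
    (1 - (n₀ : ℝ) ^ 2 * R ^ n₀ / Fintype.card α) * ∑ k, ‖c k‖ ^ 2 ≤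
      ∑ y, if Function.Injective y then ‖synth u c y‖ ^ 2 else 0 := by
  have hpos : (0 : ℝ) < Fintype.card α := by exact_mod_cast Fintype.card_pos
  have h0 : 0 ≤ ∑ k, ‖c k‖ ^ 2 := Finset.sum_nonneg fun _ _ => sq_nonneg _
  have h1 := Finset.sum_filter_add_sum_filter_not Finset.univ
    (fun y : Fin n → α => Function.Injective y) fun y => ‖synth u c y‖ ^ 2
  rw [hu.sum_norm_sq_synth] at h1
  have h2 : ∑ y ∈ Finset.univ.filter (fun y : Fin n → α => ¬ Function.Injective y),
      ‖synth u c y‖ ^ 2 ≤ (n₀ : ℝ) ^ 2 * R ^ n₀ / Fintype.card α * ∑ k, ‖c k‖ ^ 2 := by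
    calc _ ≤ ∑ y ∈ Finset.univ.filter (fun y : Fin n → α => ¬ Function.Injective y),
          (K * C) ^ n * ∑ k, ‖c k‖ ^ 2 := Finset.sum_le_sum fun y _ => norm_sq_synth_le hC c y
      _ = ((Finset.univ.filter fun y : Fin n → α => ¬ Function.Injective y).card : ℝ) *
          ((K * C) ^ n * ∑ k, ‖c k‖ ^ 2) := by rw [Finset.sum_const, nsmul_eq_mul]
      _ ≤ ((n : ℝ) ^ 2 / Fintype.card α * (Fintype.card α : ℝ) ^ n) *
          ((K * C) ^ n * ∑ k, ‖c k‖ ^ 2) :=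
          mul_le_mul_of_nonneg_right (card_not_injective_le n) (by positivity)
      _ = (n : ℝ) ^ 2 * (Fintype.card α * (K * C)) ^ n / Fintype.card α * ∑ k, ‖c k‖ ^ 2 := by
          rw [mul_pow]; ring
      _ ≤ (n₀ : ℝ) ^ 2 * R ^ n₀ / Fintype.card α * ∑ k, ‖c k‖ ^ 2 := by
          have h3 : (Fintype.card α * (K * C)) ^ n ≤ R ^ n₀ :=
            (pow_le_pow_left₀ (by positivity) hCR n).trans (pow_le_pow_right₀ hR hn)
          have h4 : (n : ℝ) ≤ n₀ := by exact_mod_cast hn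
          gcongr
  rw [← Finset.sum_filter]
  linarith

end Trial

/-! ### Trial states of the chain and the lower bound for a box. -/

section ChainTrial

variable {N L J K : ℕ}

/-- At each site `C(N, k) k! ≤ N ^ k`, and `n!` is the multiplicity times the product of factorials.
-/
theorem weight_mul_factorial_le {n : ℕ} (s : Config N L) (hs : ∑ x, (s x : ℕ) = n) :
    weight s * n.factorial ≤ (N : ℝ) ^ n * multiplicity (n := n) fun x => (s x : ℕ) := by
  have h1 := cast_multiplicity_mul (f := fun x => (s x : ℕ)) hs
  rw [← h1, weight, mul_comm ((multiplicity (n := n) fun x => (s x : ℕ)) : ℝ), ← mul_assoc,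
    ← Finset.prod_mul_distrib, ← hs, ← Finset.prod_pow_eq_pow_sum]
  refine mul_le_mul_of_nonneg_right (Finset.prod_le_prod (fun x _ => by positivity) fun x _ => ?_)
    (Nat.cast_nonneg _)
  rw [mul_comm]
  have := Nat.descFactorial_eq_factorial_mul_choose N (s x)
  have h2 := Nat.descFactorial_le_pow N (s x)
  rw [this] at h2
  exact_mod_cast h2

theorem weight_of_le_one {n : ℕ} (s : Config N L) (hs : ∑ x, (s x : ℕ) = n)
    (h : ∀ x, (s x : ℕ) ≤ 1) : weight s = (N : ℝ) ^ n := by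
  rw [weight, ← hs, ← Finset.prod_pow_eq_pow_sum]
  refine Finset.prod_congr rfl fun x _ => ?_
  have := h x
  interval_cases hx : (s x : ℕ) <;> simp

/-- A trial wave function of the chain. -/
def chainTrial (N : ℕ) (u : Fin K → Fin L → ℝ) (v : Config J K → ℂ) (s : Config N L) : ℂ :=
  (Real.sqrt (weight s * (∑ x, (s x : ℕ)).factorial / (N : ℝ) ^ (∑ x, (s x : ℕ))) : ℝ) *
    occTrial u v fun x => (s x : ℕ)

theorem norm_sq_chainTrial (u : Fin K → Fin L → ℝ) (v : Config J K → ℂ) (s : Config N L) :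
    ‖chainTrial N u v s‖ ^ 2 = weight s * (∑ x, (s x : ℕ)).factorial /
      (N : ℝ) ^ (∑ x, (s x : ℕ)) * ‖occTrial u v fun x => (s x : ℕ)‖ ^ 2 := by
  have := (weight_pos s).le
  rw [chainTrial, norm_mul, mul_pow, Complex.norm_real, Real.norm_eq_abs, sq_abs,
    Real.sq_sqrt (by positivity)]

theorem val_hop {x y : Fin L} (hxy : x ≠ y) {s : Config N L} (hx : s x ≠ 0)
    (hy : s y ≠ Fin.last N) :
    (fun z => (hop x y s z : ℕ)) = moveParticle (fun z => (s z : ℕ)) x y := by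
  funext z
  rw [moveParticle]
  by_cases h1 : z = y
  · subst h1
    rw [hop_apply_right, Function.update_self,
      Fin.val_add_one_of_lt (lt_of_le_of_ne (Fin.le_last _) hy)]
  · by_cases h2 : z = x
    · subst h2
      rw [hop_apply_left hxy, Function.update_of_ne h1, Function.update_self,
        Fin.val_sub_one_of_ne_zero hx]
    · rw [hop_apply_of_ne h2 h1, Function.update_of_ne h1, Function.update_of_ne h2]

/-- After division by `√weight`, the prefactor of `chainTrial` depends only on the particle number,
which a hop preserves. Then `N - s y ≤ N` and `weight_mul_factorial_le` both estimate in the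
direction of free bosons. -/
theorem rate_mul_chainTrial_le {x y : Fin L} (hxy : x ≠ y) (hN : 0 < N) (u : Fin K → Fin L → ℝ)
    (v : Config J K → ℂ) (s : Config N L) :
    rate x y s * ‖relAmp (chainTrial N u v) s - relAmp (chainTrial N u v) (hop x y s)‖ ^ 2 ≤
      N * (multiplicity (n := ∑ x, (s x : ℕ)) (fun z => (s z : ℕ)) * ((s x : ℕ) *
        ‖occTrial u v (moveParticle (fun z => (s z : ℕ)) x y) -
          occTrial u v (fun z => (s z : ℕ))‖ ^ 2)) := by
  have hN' : (0 : ℝ) < N := by exact_mod_cast hN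
  have hrhs : 0 ≤ (N : ℝ) * (multiplicity (n := ∑ x, (s x : ℕ)) (fun z => (s z : ℕ)) * ((s x : ℕ) *
        ‖occTrial u v (moveParticle (fun z => (s z : ℕ)) x y) -
          occTrial u v (fun z => (s z : ℕ))‖ ^ 2)) := by positivity
  by_cases hx : s x = 0
  · have : rate x y s = 0 := by simp [rate, hx]
    rwa [this, zero_mul]
  by_cases hy : s y = Fin.last N
  · have : rate x y s = 0 := by simp [rate, hy]
    rwa [this, zero_mul]
  have hn : ∑ z, (hop x y s z : ℕ) = ∑ z, (s z : ℕ) := sum_hop hxy s hx hy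
  have hrel : ∀ t : Config N L, relAmp (chainTrial N u v) t =
      (Real.sqrt ((∑ x, (t x : ℕ)).factorial / (N : ℝ) ^ (∑ x, (t x : ℕ))) : ℝ) *
        occTrial u v fun x => (t x : ℕ) := by
    intro t
    have hw : ((Real.sqrt (weight t) : ℝ) : ℂ) ≠ 0 := by
      exact_mod_cast (Real.sqrt_pos.mpr (weight_pos t)).ne'
    rw [relAmp, chainTrial, mul_div_assoc (weight t), Real.sqrt_mul (weight_pos t).le]
    push_cast
    field_simp
  rw [hrel, hrel, hn, val_hop hxy hx hy, ← mul_sub, norm_mul, mul_pow, Complex.norm_real,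
    Real.norm_eq_abs, sq_abs, Real.sq_sqrt (by positivity), norm_sub_rev]
  set n := ∑ z, (s z : ℕ)
  set D := ‖occTrial u v (moveParticle (fun z => (s z : ℕ)) x y) -
    occTrial u v fun z => (s z : ℕ)‖ ^ 2
  have h1 : rate x y s ≤ weight s * ((s x : ℕ) * N) := by
    refine mul_le_mul_of_nonneg_left ?_ (weight_pos s).le
    refine mul_le_mul_of_nonneg_left ?_ (Nat.cast_nonneg _)
    have : (0 : ℝ) ≤ (s y : ℕ) := Nat.cast_nonneg _
    linarith
  have h2 := weight_mul_factorial_le (n := n) s rfl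
  have h3 : weight s * n.factorial / (N : ℝ) ^ n ≤ multiplicity (n := n) fun x => (s x : ℕ) := by
    rw [div_le_iff₀ (by positivity), mul_comm ((multiplicity (n := n) fun x => (s x : ℕ)) : ℝ)]
    exact h2
  calc rate x y s * (n.factorial / (N : ℝ) ^ n * D)
      ≤ weight s * ((s x : ℕ) * N) * (n.factorial / (N : ℝ) ^ n * D) :=
        mul_le_mul_of_nonneg_right h1 (by positivity)
    _ = N * ((weight s * n.factorial / (N : ℝ) ^ n) * ((s x : ℕ) * D)) := by ring
    _ ≤ _ := by gcongr

theorem qf_chainTrial_le {m : ℕ} (hN : 0 < N) {u : Fin K → Fin (m + 1) → ℝ} {μ : Fin K → ℝ}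
    (hu : IsModeSystem (Fin.castSucc : Fin m → Fin (m + 1)) Fin.succ u μ) (v : Config J K → ℂ) :
    qf (hamiltonian N (m + 1)) (chainTrial N u v) ≤
      ∑ s : Config J K, (N / 2 * ∑ k, (s k : ℕ) * μ k) * ‖v s‖ ^ 2 := by
  have hN' : (0 : ℝ) < N := by exact_mod_cast hN
  -- Large enough for the particle numbers of mode configurations and of site configurations.
  set M := J * K + N * (m + 1) with hM
  have h1 : ∀ e : Fin m, qf (bond N (m + 1) e.castSucc e.succ) (chainTrial N u v) ≤
      N / 2 * ∑ n ∈ Finset.range (M + 1), ∑ f ∈ occupations (Fin (m + 1)) n,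
        (multiplicity (n := n) f : ℝ) * (f e.castSucc *
          ‖occTrial u v (moveParticle f e.castSucc e.succ) - occTrial u v f‖ ^ 2) := by
    intro e
    have hne : e.castSucc ≠ e.succ := Fin.castSucc_lt_succ.ne
    rw [qf_bond hne]
    let G : (Fin (m + 1) → ℕ) → ℝ := fun f => N * (multiplicity (n := ∑ x, f x) f * (f e.castSucc *
      ‖occTrial u v (moveParticle f e.castSucc e.succ) - occTrial u v f‖ ^ 2))
    have h2 : ∑ s, rate e.castSucc e.succ s * ‖relAmp (chainTrial N u v) s -
        relAmp (chainTrial N u v) (hop e.castSucc e.succ s)‖ ^ 2 ≤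
        ∑ s : Config N (m + 1), G fun x => (s x : ℕ) :=
      Finset.sum_le_sum fun s _ => rate_mul_chainTrial_le hne hN u v s
    rw [sum_config_eq (M := M) (by omega) G] at h2
    have h3 : ∑ n ∈ Finset.range (M + 1), ∑ f ∈ occupations (Fin (m + 1)) n,
        (if ∀ x, f x ≤ N then G f else 0) ≤ N * ∑ n ∈ Finset.range (M + 1),
        ∑ f ∈ occupations (Fin (m + 1)) n, (multiplicity (n := n) f : ℝ) * (f e.castSucc *
          ‖occTrial u v (moveParticle f e.castSucc e.succ) - occTrial u v f‖ ^ 2) := by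
      rw [Finset.mul_sum]
      refine Finset.sum_le_sum fun n _ => ?_
      rw [Finset.mul_sum]
      refine Finset.sum_le_sum fun f hf => ?_
      have hf := mem_occupations.mp hf
      subst hf
      split_ifs
      · exact le_rfl
      · positivity
    linarith
  have h4 : ∀ n, ∑ e : Fin m, ∑ f ∈ occupations (Fin (m + 1)) n,
      (multiplicity (n := n) f : ℝ) * (f e.castSucc *
        ‖occTrial u v (moveParticle f e.castSucc e.succ) - occTrial u v f‖ ^ 2) =
      ∑ k : Fin n → Fin K, (∑ a, (occ k a : ℝ) * μ a) * ‖tupleCoeff v n k‖ ^ 2 := by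
    intro n
    rw [← tupleForm_occ (fun e : Fin m => Fin.castSucc_lt_succ.ne) n (occTrial u v)]
    have h5 : (fun y : Fin n → Fin (m + 1) => occTrial u v (occ y)) =
        synth u (tupleCoeff v n) := funext fun y => (tupleTrial_eq u v y).symm
    rw [h5, hu.tupleForm_synth]
    simp only [sum_comp_occ]
  rw [qf_hamiltonian]
  calc _ ≤ ∑ e : Fin m, N / 2 * ∑ n ∈ Finset.range (M + 1), ∑ f ∈ occupations (Fin (m + 1)) n,
        (multiplicity (n := n) f : ℝ) * (f e.castSucc *
          ‖occTrial u v (moveParticle f e.castSucc e.succ) - occTrial u v f‖ ^ 2) :=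
        Finset.sum_le_sum fun e _ => h1 e
    _ = N / 2 * ∑ n ∈ Finset.range (M + 1), ∑ k : Fin n → Fin K,
        (∑ a, (occ k a : ℝ) * μ a) * ‖tupleCoeff v n k‖ ^ 2 := by
        rw [← Finset.mul_sum, Finset.sum_comm]
        simp only [h4]
    _ = _ := by
        rw [sum_tupleCoeff (M := M) (by omega) v fun g => ∑ a, (g a : ℝ) * μ a, Finset.mul_sum]
        exact Finset.sum_congr rfl fun s _ => by ring

/-- Keep only configurations without multiple occupation, where weight and multiplicity match
exactly, and bound the loss by `le_sum_injective`. -/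
theorem le_sqNorm_chainTrial {E : Type*} [Fintype E] [NeZero L] (hN : 0 < N)
    {src tgt : E → Fin L} {u : Fin K → Fin L → ℝ} {μ : Fin K → ℝ}
    (hu : IsModeSystem src tgt u μ) {C R : ℝ} (hC : ∀ k a, u k a ^ 2 ≤ C) (hC0 : 0 ≤ C)
    (hR : 1 ≤ R) (hCR : L * (K * C) ≤ R) (v : Config J K → ℂ) :
    (1 - ((J * K : ℕ) : ℝ) ^ 2 * R ^ (J * K) / L) * sqNorm v ≤ sqNorm (chainTrial N u v) := by
  classical
  have hN' : (0 : ℝ) < N := by exact_mod_cast hN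
  set M := J * K + N * L with hM
  have h1 : ∑ s : Config N L, (if ∀ x, (s x : ℕ) ≤ 1 then
      (multiplicity (n := ∑ x, (s x : ℕ)) (fun x => (s x : ℕ)) : ℝ) *
        ‖occTrial u v fun x => (s x : ℕ)‖ ^ 2 else 0) ≤ sqNorm (chainTrial N u v) := by
    refine Finset.sum_le_sum fun s _ => ?_
    split_ifs with h
    · rw [norm_sq_chainTrial, multiplicity_eq_factorial rfl h, weight_of_le_one s rfl h,
        mul_div_cancel_left₀ _ (pow_pos hN' _).ne']
    · positivity
  refine le_trans ?_ h1
  rw [sum_config_eq (M := M) (by omega) fun f => if ∀ x, f x ≤ 1 then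
      (multiplicity (n := ∑ x, f x) f : ℝ) * ‖occTrial u v f‖ ^ 2 else 0]
  have h2 := sum_tupleCoeff (M := M) (by omega) v fun _ => 1
  simp only [one_mul] at h2
  rw [sqNorm, ← h2, Finset.mul_sum]
  refine Finset.sum_le_sum fun n _ => ?_
  have h3 : ∑ f ∈ occupations (Fin L) n, (if ∀ x, f x ≤ N then if ∀ x, f x ≤ 1 then
      (multiplicity (n := ∑ x, f x) f : ℝ) * ‖occTrial u v f‖ ^ 2 else 0 else 0) =
      ∑ y : Fin n → Fin L, if Function.Injective y then ‖tupleTrial u v n y‖ ^ 2 else 0 := by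
    have h4 := sum_tuple_eq (n := n) (α := Fin L) fun f =>
      if ∀ x, f x ≤ 1 then ‖occTrial u v f‖ ^ 2 else 0
    simp only [occ_le_one_iff] at h4
    simp only [tupleTrial_eq]
    rw [h4]
    refine Finset.sum_congr rfl fun f hf => ?_
    have hf := mem_occupations.mp hf
    subst hf
    by_cases h : ∀ x, f x ≤ 1
    · rw [if_pos h, if_pos h, if_pos fun x => (h x).trans hN]
    · rw [if_neg h, if_neg h, mul_zero, ite_self]
  rw [h3]
  by_cases hn : n ≤ J * K
  · have := hu.le_sum_injective hC hC0 hR (by rwa [Fintype.card_fin]) hn (tupleCoeff v n)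
    rwa [Fintype.card_fin] at this
  · rw [Finset.sum_eq_zero fun k _ => by rw [tupleCoeff_eq_zero v (not_le.mp hn)]; simp, mul_zero]
    exact Finset.sum_nonneg fun y _ => by split_ifs <;> positivity

/-- A product of modes with a particle at `a` contains a factor zero. Sine modes therefore yield
states with empty ends. -/
theorem occTrial_eq_zero {u : Fin K → Fin L → ℝ} {a : Fin L} (ha : ∀ k, u k a = 0)
    (v : Config J K → ℂ) {f : Fin L → ℕ} (hf : f a ≠ 0) : occTrial u v f = 0 := by
  set x := (exists_occ_eq f rfl).choose with hx
  have hocc : occ x = f := (exists_occ_eq f rfl).choose_spec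
  obtain ⟨i, hi⟩ : ∃ i, x i = a := by
    by_contra h
    push Not at h
    refine hf ?_
    rw [← hocc, occ, Finset.card_eq_zero, Finset.filter_eq_empty_iff]
    exact fun i _ => h i
  change synth u (tupleCoeff v _) x = 0
  refine Finset.sum_eq_zero fun k _ => ?_
  have : prodMode u k x = 0 := Finset.prod_eq_zero (Finset.mem_univ i) (by rw [hi, ha])
  rw [this]
  simp

theorem occTrial_add (u : Fin K → Fin L → ℝ) (v w : Config J K → ℂ) (f : Fin L → ℕ) :
    occTrial u (v + w) f = occTrial u v f + occTrial u w f := by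
  rw [occTrial, occTrial, occTrial, tupleTrial, tupleTrial, tupleTrial, synth, synth, synth,
    ← Finset.sum_add_distrib]
  refine Finset.sum_congr rfl fun k _ => ?_
  rw [tupleCoeff, tupleCoeff, tupleCoeff, truncated, truncated, truncated]
  split_ifs
  · rw [Pi.add_apply]; ring
  · ring

theorem occTrial_smul (u : Fin K → Fin L → ℝ) (c : ℂ) (v : Config J K → ℂ) (f : Fin L → ℕ) :
    occTrial u (c • v) f = c * occTrial u v f := by
  rw [occTrial, occTrial, tupleTrial, tupleTrial, synth, synth, Finset.mul_sum]
  refine Finset.sum_congr rfl fun k _ => ?_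
  rw [tupleCoeff, tupleCoeff, truncated, truncated]
  split_ifs
  · rw [Pi.smul_apply, smul_eq_mul]; ring
  · ring

/-- Modes that vanish at an end of the path are small if their energy is small. -/
theorem IsModeSystem.sq_le {m : ℕ} {K : Type*} [Fintype K] [DecidableEq K]
    {u : K → Fin (m + 1) → ℝ} {μ : K → ℝ}
    (hu : IsModeSystem (Fin.castSucc : Fin m → Fin (m + 1)) Fin.succ u μ) (h0 : ∀ k, u k 0 = 0)
    (k : K) (a : Fin (m + 1)) : u k a ^ 2 ≤ 2 * Real.sqrt (μ k) := by
  have hform := hu.form k k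
  have hnorm := hu.orthonormal k k
  rw [if_pos rfl] at hform hnorm
  have h1 : u k a ^ 2 ≤ ∑ e : Fin m, |u k e.succ ^ 2 - u k e.castSucc ^ 2| := by
    let W : ℕ → ℝ := fun j => if h : j < m + 1 then u k ⟨j, h⟩ ^ 2 else 0
    have hW : ∀ b : Fin (m + 1), u k b ^ 2 = W b := fun b => by
      change u k b ^ 2 = if h : (b : ℕ) < m + 1 then u k ⟨b, h⟩ ^ 2 else 0
      rw [dif_pos b.2]
    have hW0 : W 0 = 0 := by
      have := hW 0
      rw [h0] at this
      simpa using this.symm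
    have h2 : u k a ^ 2 = ∑ j ∈ Finset.range a, (W (j + 1) - W j) := by
      rw [Finset.sum_range_sub, hW0, sub_zero, hW]
    have h3 : ∑ e : Fin m, |u k e.succ ^ 2 - u k e.castSucc ^ 2| =
        ∑ j ∈ Finset.range m, |W (j + 1) - W j| := by
      rw [Finset.sum_range]
      refine Finset.sum_congr rfl fun e _ => ?_
      rw [hW, hW]
      rfl
    rw [h2, h3]
    refine (Finset.sum_le_sum fun j _ => le_abs_self _).trans ?_
    exact Finset.sum_le_sum_of_subset_of_nonneg (Finset.range_mono (Nat.lt_succ_iff.mp a.2))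
      fun _ _ _ => abs_nonneg _
  have h2 : ∑ e : Fin m, |u k e.succ ^ 2 - u k e.castSucc ^ 2| =
      ∑ e : Fin m, |u k e.succ - u k e.castSucc| * |u k e.succ + u k e.castSucc| := by
    refine Finset.sum_congr rfl fun e _ => ?_
    rw [← abs_mul]
    congr 1
    ring
  have h3 := Finset.sum_mul_sq_le_sq_mul_sq Finset.univ
    (fun e : Fin m => |u k e.succ - u k e.castSucc|) fun e => |u k e.succ + u k e.castSucc|
  have h4 : ∑ e : Fin m, |u k e.succ - u k e.castSucc| ^ 2 = μ k := by
    rw [← hform]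
    exact Finset.sum_congr rfl fun e _ => by rw [sq_abs, sq]
  have h5 : ∑ e : Fin m, |u k e.succ + u k e.castSucc| ^ 2 ≤ 4 := by
    have h6 : ∑ e : Fin m, u k e.succ ^ 2 ≤ 1 := by
      rw [← hnorm, Fin.sum_univ_succ]
      simp only [sq]
      linarith [mul_self_nonneg (u k 0)]
    have h7 : ∑ e : Fin m, u k e.castSucc ^ 2 ≤ 1 := by
      rw [← hnorm, Fin.sum_univ_castSucc]
      simp only [sq]
      linarith [mul_self_nonneg (u k (Fin.last m))]
    calc _ ≤ ∑ e : Fin m, (2 * u k e.succ ^ 2 + 2 * u k e.castSucc ^ 2) := by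
          refine Finset.sum_le_sum fun e _ => ?_
          rw [sq_abs]
          nlinarith [sq_nonneg (u k e.succ - u k e.castSucc)]
      _ ≤ 4 := by
          rw [Finset.sum_add_distrib, ← Finset.mul_sum, ← Finset.mul_sum]
          linarith
  have hμ : 0 ≤ μ k := by rw [← h4]; exact Finset.sum_nonneg fun _ _ => sq_nonneg _
  refine h1.trans ?_
  rw [h2]
  refine le_of_sq_le_sq ?_ (by positivity)
  rw [mul_pow, Real.sq_sqrt hμ]
  refine h3.trans ?_
  rw [h4]
  nlinarith

theorem neumannEigenvalue_le (m k : ℕ) :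
    neumannEigenvalue m k ≤ (Real.pi * k / (m + 1 : ℕ)) ^ 2 := by
  have := Real.one_sub_sq_div_two_le_cos (x := Real.pi * k / (m + 1 : ℕ))
  rw [neumannEigenvalue]
  linarith

/-- By `neumannEigenvalue_le` the eigenvalues are at most `(π K / (m + 1))²`. The order `1 / m` is
that of a mode spread over the whole path. -/
theorem dirichlet_mode_le {m K : ℕ} {u : Fin K → Fin (m + 2) → ℝ}
    (hu : IsModeSystem (Fin.castSucc : Fin (m + 1) → Fin (m + 2)) Fin.succ u
      fun k => neumannEigenvalue m (k + 1)) (h0 : ∀ k, u k 0 = 0) (k : Fin K) (a : Fin (m + 2)) :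
    u k a ^ 2 ≤ 2 * (Real.pi * K / (m + 1 : ℕ)) := by
  refine (hu.sq_le h0 k a).trans ?_
  refine mul_le_mul_of_nonneg_left ?_ two_pos.le
  refine Real.sqrt_le_iff.mpr ⟨by positivity, (neumannEigenvalue_le m _).trans ?_⟩
  have : ((k + 1 : ℕ) : ℝ) ≤ K := by exact_mod_cast k.2
  gcongr

/-- The relative error of the trial states. -/
def trialError (J K m : ℕ) : ℝ :=
  ((J * K : ℕ) : ℝ) ^ 2 * (4 * Real.pi * (K : ℝ) ^ 2 + 1) ^ (J * K) / (m + 2 : ℕ)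

/-- The trial space consists of all occupations of `K` modes by at most `J` bosons each. Energies
add over the modes, so the sum factorises; the loss of norm only rescales the energies. -/
theorem le_heatTrace_dirichlet (hN : 0 < N) {m J K : ℕ} (hK : K ≤ m) (hθ : trialError J K m < 1)
    {β : ℝ} (hβ : 0 ≤ β) :
    ∏ k : Fin K, ∑ j : Fin (J + 1), Real.exp (-(β * (N / 2 * neumannEigenvalue m (k + 1)) /
      (1 - trialError J K m))) ^ (j : ℕ) ≤ heatTrace β (dirichletHamiltonian N (m + 2)) := by
  obtain ⟨u, hu, hu0, hu1⟩ := exists_dirichlet_modes m K hK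
  have hm : (0 : ℝ) < (m + 1 : ℕ) := by positivity
  have hθ' : 0 < 1 - trialError J K m := by linarith
  let T : (Config J K → ℂ) →ₗ[ℂ] (EmptyEnds N (m + 2) → ℂ) :=
    { toFun := fun v s => chainTrial N u v s.1
      map_add' := fun v w => by
        ext s
        simp only [chainTrial, Pi.add_apply, occTrial_add, mul_add]
      map_smul' := fun c v => by
        ext s
        simp only [chainTrial, Pi.smul_apply, occTrial_smul, smul_eq_mul, RingHom.id_apply]
        ring }
  have hext : ∀ v, Function.extend Subtype.val (T v) 0 = chainTrial N u v := by
    intro v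
    funext s
    by_cases h : ∀ x : Fin (m + 2), (x : ℕ) = 0 ∨ (x : ℕ) + 1 = m + 2 → s x = 0
    · exact Subtype.val_injective.extend_apply (T v) 0 (⟨s, h⟩ : EmptyEnds N (m + 2))
    · rw [Function.extend_apply' _ _ _ fun ⟨a, ha⟩ => h (ha ▸ a.2)]
      push Not at h
      obtain ⟨x, hx, hsx⟩ := h
      have h2 : ∀ k, u k x = 0 := by
        intro k
        rcases hx with hx | hx
        · have : x = 0 := Fin.ext hx
          rw [this, hu0]
        · have : x = Fin.last _ := Fin.ext (by simp; omega)
          rw [this, hu1]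
      rw [chainTrial, occTrial_eq_zero h2 v fun h => hsx (Fin.ext h), mul_zero, Pi.zero_apply]
  have hJ : ∀ v, (1 - trialError J K m) * sqNorm v ≤ sqNorm (T v) := by
    intro v
    rw [← sqNorm_extend Subtype.val_injective, hext]
    refine le_sqNorm_chainTrial hN hu (dirichlet_mode_le hu hu0) (by positivity)
      (by nlinarith [Real.pi_pos, sq_nonneg (K : ℝ)]) ?_ v
    -- This ratio is what doubles `2 π K²` to the `4 π K²` in `trialError`.
    have h1 : ((m + 2 : ℕ) : ℝ) / (m + 1 : ℕ) ≤ 2 := by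
      rw [div_le_iff₀ hm]
      push_cast
      linarith [(Nat.cast_nonneg m : (0 : ℝ) ≤ m)]
    calc ((m + 2 : ℕ) : ℝ) * (K * (2 * (Real.pi * K / (m + 1 : ℕ))))
        = 2 * Real.pi * (K : ℝ) ^ 2 * (((m + 2 : ℕ) : ℝ) / (m + 1 : ℕ)) := by ring
      _ ≤ 2 * Real.pi * (K : ℝ) ^ 2 * 2 := mul_le_mul_of_nonneg_left h1 (by positivity)
      _ ≤ _ := by linarith
  have hq : ∀ v, qf (dirichletHamiltonian N (m + 2)) (T v) ≤ ∑ s : Config J K,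
      (N / 2 * ∑ k, (s k : ℕ) * neumannEigenvalue m (k + 1)) * ‖v s‖ ^ 2 := by
    intro v
    have h1 := mulVec_extend (hamiltonian N (m + 2))
      (f := (Subtype.val : EmptyEnds N (m + 2) → Config N (m + 2))) Subtype.val_injective (T v)
    rw [hext] at h1
    exact h1 ▸ qf_chainTrial_le hN hu v
  have hμ : ∀ k : Fin K, 0 ≤ neumannEigenvalue m (k + 1) := fun k =>
    (neumannEigenvalue_pos k.1.succ_pos (by omega)).le
  refine le_trans (le_of_eq ?_) (sum_exp_le_heatTrace hβ (dirichletHamiltonian_isHermitian N (m + 2))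
    (fun s : Config J K => N / 2 * ∑ k, (s k : ℕ) * neumannEigenvalue m (k + 1))
    (fun s => mul_nonneg (by positivity) (Finset.sum_nonneg fun k _ =>
      mul_nonneg (Nat.cast_nonneg _) (hμ k))) hθ' T hJ hq)
  rw [Finset.prod_univ_sum, Fintype.piFinset_univ]
  refine Finset.sum_congr rfl fun s _ => ?_
  rw [Finset.mul_sum, Finset.sum_div, Finset.mul_sum, ← Finset.sum_neg_distrib, Real.exp_sum]
  refine Finset.prod_congr rfl fun k _ => ?_
  rw [← Real.exp_nat_mul]
  congr 1
  ring

end ChainTrial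

end HeisenbergChain
end

noncomputable section

namespace HeisenbergChain

/-! ### The Bose integral, its zeta value and its Riemann sums. -/

section BoseIntegral

/-- The logarithm of the partition function of a bosonic mode. -/
def bose (x : ℝ) : ℝ := -Real.log (1 - Real.exp (-x))

theorem one_sub_exp_neg_pos {x : ℝ} (hx : 0 < x) : 0 < 1 - Real.exp (-x) := by
  have : Real.exp (-x) < 1 := Real.exp_lt_one_iff.mpr (neg_lt_zero.mpr hx)
  linarith

theorem bose_nonneg {x : ℝ} (hx : 0 < x) : 0 ≤ bose x := by
  have h1 := one_sub_exp_neg_pos hx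
  have h2 := Real.exp_pos (-x)
  exact neg_nonneg.mpr (Real.log_nonpos h1.le (by linarith))

theorem bose_anti {x y : ℝ} (hx : 0 < x) (hxy : x ≤ y) : bose y ≤ bose x := by
  have h1 := one_sub_exp_neg_pos hx
  have h2 : Real.exp (-y) ≤ Real.exp (-x) := Real.exp_le_exp.mpr (by linarith)
  exact neg_le_neg (Real.log_le_log h1 (by linarith))

theorem bose_le {x : ℝ} (hx : 1 ≤ x) : bose x ≤ 2 * Real.exp (-x) := by
  have h1 := one_sub_exp_neg_pos (by linarith : 0 < x)
  have h2 : Real.exp (-x) ≤ 1 / 2 := by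
    have h3 := Real.add_one_le_exp x
    rw [Real.exp_neg, one_div]
    exact inv_anti₀ two_pos (by linarith)
  have h4 := Real.one_sub_inv_le_log_of_pos h1
  have h5 : (1 - Real.exp (-x))⁻¹ ≤ 1 + 2 * Real.exp (-x) := by
    rw [inv_le_iff_one_le_mul₀ h1]
    nlinarith [Real.exp_pos (-x)]
  rw [bose]
  linarith

theorem tsum_exp_neg_sq_eq_bose (p : ℝ) :
    ∑' n : ℕ, Real.exp (-((n : ℝ) + 1) * p ^ 2) / (n + 1) = bose (p ^ 2) := by
  have hterm : ∀ n : ℕ, Real.exp (-((n : ℝ) + 1) * p ^ 2) / (n + 1) =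
      Real.exp (-p ^ 2) ^ (n + 1) / ((n : ℝ) + 1) := by
    intro n
    rw [← Real.exp_nat_mul]
    congr 2
    push_cast
    ring
  simp only [hterm]
  -- At `p = 0` both sides are 0 by convention: the harmonic series is not summable, and `Real.log 0
  -- = 0`.
  by_cases hp : p = 0
  · subst hp
    have : ¬ Summable fun n : ℕ => 1 / ((n : ℝ) + 1) := by
      have := Real.not_summable_one_div_natCast
      rw [← summable_nat_add_iff 1] at this
      simpa using this
    simp only [bose, ne_eq, OfNat.ofNat_ne_zero, not_false_eq_true, zero_pow, neg_zero,
      Real.exp_zero, one_pow, sub_self, Real.log_zero]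
    exact tsum_eq_zero_of_not_summable this
  · have h1 : Real.exp (-p ^ 2) < 1 := Real.exp_lt_one_iff.mpr (by
      have : 0 < p ^ 2 := by positivity
      linarith)
    have := Real.hasSum_pow_div_log_of_abs_lt_one (x := Real.exp (-p ^ 2))
      (by rw [abs_of_pos (Real.exp_pos _)]; exact h1)
    exact this.tsum_eq

theorem sqrt_pi_div_div (n : ℕ) : Real.sqrt (Real.pi / ((n : ℝ) + 1)) / (n + 1) =
    Real.sqrt Real.pi * (1 / ((n : ℝ) + 1) ^ (3 / 2 : ℝ)) := by
  have hn : (0 : ℝ) < (n : ℝ) + 1 := by positivity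
  have h1 : ((n : ℝ) + 1) ^ (3 / 2 : ℝ) = Real.sqrt ((n : ℝ) + 1) * (n + 1) := by
    rw [Real.sqrt_eq_rpow, ← Real.rpow_add_one hn.ne']
    norm_num
  rw [h1, Real.sqrt_div Real.pi_pos.le, div_div, mul_one_div]

theorem summable_three_halves : Summable fun n : ℕ => 1 / ((n : ℝ) + 1) ^ (3 / 2 : ℝ) := by
  have h := (Real.summable_one_div_nat_rpow (p := 3 / 2)).mpr (by norm_num)
  rw [← summable_nat_add_iff 1] at h
  simpa using h

/-- Expand the logarithm and integrate the Gaussians term by term; convergence of `∑ n^(-3/2)`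
justifies the exchange. -/
theorem hasSum_integral_bose :
    HasSum (fun n : ℕ => Real.sqrt Real.pi * (1 / ((n : ℝ) + 1) ^ (3 / 2 : ℝ)))
      (∫ p : ℝ, bose (p ^ 2)) := by
  have hint : ∀ n : ℕ, ∫ p : ℝ, Real.exp (-((n : ℝ) + 1) * p ^ 2) / (n + 1) =
      Real.sqrt Real.pi * (1 / ((n : ℝ) + 1) ^ (3 / 2 : ℝ)) := by
    intro n
    rw [integral_div, integral_gaussian, sqrt_pi_div_div]
  have h := hasSum_integral_of_summable_integral_norm
    (F := fun (n : ℕ) (p : ℝ) => Real.exp (-((n : ℝ) + 1) * p ^ 2) / (n + 1)) (μ := volume)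
    (fun n => (integrable_exp_neg_mul_sq (by positivity)).div_const _) (by
      have hnorm : ∀ (n : ℕ) (p : ℝ), ‖Real.exp (-((n : ℝ) + 1) * p ^ 2) / (n + 1)‖ =
          Real.exp (-((n : ℝ) + 1) * p ^ 2) / (n + 1) := fun n p =>
        Real.norm_of_nonneg (by positivity)
      simp only [hnorm, hint]
      exact summable_three_halves.mul_left _)
  simp only [hint, tsum_exp_neg_sq_eq_bose] at h
  exact h

theorem integral_bose_pos : 0 < ∫ p : ℝ, bose (p ^ 2) := by
  rw [← hasSum_integral_bose.tsum_eq]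
  exact hasSum_integral_bose.summable.tsum_pos (fun n => by positivity) 0 (by
    have := Real.pi_pos
    positivity)

/-- The integral of a function that is not integrable is 0 by convention, whereas this one is
positive. -/
theorem integrable_bose : Integrable fun p : ℝ => bose (p ^ 2) := by
  by_contra h
  exact integral_bose_pos.ne' (integral_undef h)

theorem integrable_log : Integrable fun p : ℝ => Real.log (1 - Real.exp (-p ^ 2)) := by
  have h := integrable_bose.neg
  refine h.congr (Filter.Eventually.of_forall fun p => ?_)
  simp [bose]

theorem C₁_eq_integral_bose : C₁ = -(1 / (2 * Real.pi) * ∫ p : ℝ, bose (p ^ 2)) := by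
  have h : ∫ p : ℝ, bose (p ^ 2) = -∫ p : ℝ, Real.log (1 - Real.exp (-p ^ 2)) := by
    rw [← integral_neg]
    rfl
  rw [h, C₁]
  ring

theorem C₁_eq_zeta : (C₁ : ℂ) = -riemannZeta (3 / 2) / (2 * ((Real.sqrt Real.pi : ℝ) : ℂ)) := by
  have h1 : riemannZeta (3 / 2) = ((∑' n : ℕ, 1 / ((n : ℝ) + 1) ^ (3 / 2 : ℝ) : ℝ) : ℂ) := by
    rw [zeta_eq_tsum_one_div_nat_add_one_cpow (by norm_num), Complex.ofReal_tsum]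
    refine tsum_congr fun n => ?_
    push_cast
    rw [Complex.ofReal_cpow (by positivity)]
    push_cast
    rfl
  have hs : 0 < Real.sqrt Real.pi := Real.sqrt_pos.mpr Real.pi_pos
  have h2 : C₁ = -(∑' n : ℕ, 1 / ((n : ℝ) + 1) ^ (3 / 2 : ℝ)) / (2 * Real.sqrt Real.pi) := by
    rw [C₁_eq_integral_bose, ← hasSum_integral_bose.tsum_eq, tsum_mul_left]
    have h3 : Real.pi = Real.sqrt Real.pi * Real.sqrt Real.pi :=
      (Real.mul_self_sqrt Real.pi_pos.le).symm
    set T := ∑' n : ℕ, 1 / ((n : ℝ) + 1) ^ (3 / 2 : ℝ)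
    set r := Real.sqrt Real.pi
    rw [h3]
    field_simp
  rw [h2, h1]
  push_cast
  rfl

theorem C₁_neg : C₁ < 0 := by
  rw [C₁_eq_integral_bose]
  have := integral_bose_pos
  have := Real.pi_pos
  rw [neg_lt_zero]
  positivity

theorem integrableOn_bose {c : ℝ} (hc : 0 < c) :
    IntegrableOn (fun q : ℝ => bose (c * q ^ 2)) (Set.Ioi 0) := by
  have h := integrable_bose.comp_mul_left' (R := Real.sqrt c) (Real.sqrt_pos.mpr hc).ne'
  refine (h.congr (Filter.Eventually.of_forall fun p => ?_)).integrableOn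
  simp only [mul_pow, Real.sq_sqrt hc.le]

theorem integral_bose_Ioi {c : ℝ} (hc : 0 < c) :
    ∫ q in Set.Ioi (0 : ℝ), bose (c * q ^ 2) = Real.pi * (-C₁) / Real.sqrt c := by
  have hs := Real.sqrt_pos.mpr hc
  have h1 := integral_comp_mul_left_Ioi (fun q => bose (q ^ 2)) 0 hs
  have h2 := integral_comp_abs (f := fun q => bose (q ^ 2))
  simp only [sq_abs] at h2
  simp only [mul_pow, Real.sq_sqrt hc.le, mul_zero, smul_eq_mul] at h1
  rw [h1, C₁_eq_integral_bose, h2]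
  have := Real.pi_pos
  field_simp

theorem sum_le_integral_Ioi {f : ℝ → ℝ} (hf : ∀ x y, 0 < x → x ≤ y → f y ≤ f x)
    (h0 : ∀ x, 0 < x → 0 ≤ f x) (hint : IntegrableOn f (Set.Ioi 0)) (n : ℕ) :
    ∑ k ∈ Finset.range n, f ((k : ℝ) + 1) ≤ ∫ x in Set.Ioi (0 : ℝ), f x := by
  have hsub : ∀ {a b : ℝ}, 0 ≤ a → Set.Ioc a b ⊆ Set.Ioi 0 := fun ha x hx => lt_of_le_of_lt ha hx.1
  have h1 : ∑ k ∈ Finset.range n, f ((k : ℝ) + 1) ≤ ∫ x in Set.Ioc (0 : ℝ) n, f x := by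
    induction n with
    | zero => simp
    | succ n ih =>
      have hn : (0 : ℝ) ≤ n := Nat.cast_nonneg n
      have hu : Set.Ioc (0 : ℝ) (n + 1 : ℕ) = Set.Ioc (0 : ℝ) n ∪ Set.Ioc (n : ℝ) (n + 1) := by
        rw [Set.Ioc_union_Ioc_eq_Ioc hn (by linarith)]
        push_cast
        rfl
      rw [hu, setIntegral_union (Set.Ioc_disjoint_Ioc_of_le le_rfl) measurableSet_Ioc
        (hint.mono_set (hsub le_rfl)) (hint.mono_set (hsub hn)), Finset.sum_range_succ]
      refine add_le_add ih ?_
      have h2 : ∫ _ in Set.Ioc (n : ℝ) (n + 1), f ((n : ℝ) + 1) = f ((n : ℝ) + 1) := by simp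
      rw [← h2]
      refine setIntegral_mono_on (integrableOn_const (by simp)) (hint.mono_set (hsub hn))
        measurableSet_Ioc fun x hx => hf _ _ (lt_of_le_of_lt hn hx.1) hx.2
  refine h1.trans (setIntegral_mono_set hint ?_ (Filter.Eventually.of_forall (hsub le_rfl)))
  exact (ae_restrict_iff' measurableSet_Ioi).mpr (Filter.Eventually.of_forall fun x hx => h0 x hx)

theorem sum_bose_le {c : ℝ} (hc : 0 < c) (n : ℕ) :
    ∑ k ∈ Finset.range n, bose (c * ((k : ℝ) + 1) ^ 2) ≤ Real.pi * (-C₁) / Real.sqrt c := by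
  rw [← integral_bose_Ioi hc]
  refine sum_le_integral_Ioi (f := fun q => bose (c * q ^ 2)) (fun x y hx hxy => ?_)
    (fun x hx => bose_nonneg (by positivity)) (integrableOn_bose hc) n
  exact bose_anti (by positivity) (by gcongr)

/-- Riemann sums for the integral of `bose` from below. -/
theorem exists_lt_riemann_sum {c : ℝ} (hc : 0 < c) {b : ℝ}
    (hb : b < Real.pi * (-C₁) / Real.sqrt c) : ∃ A : ℕ, 0 < A ∧
      b < 1 / A * ∑ k ∈ Finset.range (A ^ 2), bose (c / (A : ℝ) ^ 2 * ((k : ℝ) + 1) ^ 2) := by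
  set f : ℝ → ℝ := fun q => bose (c * q ^ 2) with hf
  have hint := integrableOn_bose hc
  have hanti : ∀ x y, 0 < x → x ≤ y → f y ≤ f x := fun x y hx hxy =>
    bose_anti (by positivity) (by gcongr)
  -- Left endpoint sums at `1/A, 2/A, …, A` with mesh `1/A`; the `A²` cells fill `[1/A, A + 1/A]`,
  -- which exhausts the half line as `A` grows.
  have hlow : ∀ A : ℕ, 0 < A → ∫ x in (1 / A : ℝ)..((A : ℝ) + 1 / A), f x ≤
      1 / A * ∑ k ∈ Finset.range (A ^ 2), bose (c / (A : ℝ) ^ 2 * ((k : ℝ) + 1) ^ 2) := by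
    intro A hA
    have hA' : (0 : ℝ) < A := by exact_mod_cast hA
    have h1 := AntitoneOn.integral_le_sum (x₀ := 1) (a := A ^ 2)
      (f := fun u => bose (c / (A : ℝ) ^ 2 * u ^ 2)) (fun x hx y hy hxy => by
        have : (0 : ℝ) < x := lt_of_lt_of_le one_pos hx.1
        exact bose_anti (by positivity) (by gcongr))
    have h2 := intervalIntegral.integral_comp_mul_left (a := 1) (b := 1 + (A ^ 2 : ℕ)) f
      (c := 1 / (A : ℝ)) (by positivity)
    have h3 : ∀ u : ℝ, f (1 / (A : ℝ) * u) = bose (c / (A : ℝ) ^ 2 * u ^ 2) := by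
      intro u
      simp only [hf]
      congr 1
      ring
    simp only [h3] at h2
    rw [h2] at h1
    have e1 : (1 / (A : ℝ)) * (1 + (A ^ 2 : ℕ)) = A + 1 / A := by
      push_cast
      field_simp
      ring
    rw [e1, mul_one, smul_eq_mul, one_div, inv_inv] at h1
    rw [one_div, ← div_eq_inv_mul, le_div_iff₀ hA', mul_comm]
    refine h1.trans (le_of_eq (Finset.sum_congr rfl fun k _ => ?_))
    rw [add_comm (1 : ℝ)]
  have hii : ∀ x : ℝ, 0 ≤ x → IntervalIntegrable f volume 0 x := fun x hx =>
    (intervalIntegrable_iff_integrableOn_Ioc_of_le hx).mpr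
      (hint.mono_set fun y hy => hy.1)
  have hlim : Tendsto (fun A : ℕ => ∫ x in (1 / A : ℝ)..((A : ℝ) + 1 / A), f x) atTop
      (𝓝 (∫ q in Set.Ioi (0 : ℝ), f q)) := by
    have hinv : Tendsto (fun A : ℕ => (1 / A : ℝ)) atTop (𝓝 0) := tendsto_one_div_atTop_nhds_zero_nat
    have h1 : Tendsto (fun A : ℕ => ∫ x in (0 : ℝ)..((A : ℝ) + 1 / A), f x) atTop
        (𝓝 (∫ q in Set.Ioi (0 : ℝ), f q)) :=
      intervalIntegral_tendsto_integral_Ioi 0 hint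
        (tendsto_atTop_mono (fun A => le_add_of_nonneg_right (by positivity))
          tendsto_natCast_atTop_atTop)
    have h2 : Tendsto (fun A : ℕ => ∫ x in (0 : ℝ)..(1 / A : ℝ), f x) atTop (𝓝 0) := by
      have hfi : Integrable f := by
        have h := integrable_bose.comp_mul_left' (R := Real.sqrt c) (Real.sqrt_pos.mpr hc).ne'
        refine h.congr (Filter.Eventually.of_forall fun p => ?_)
        simp only [mul_pow, Real.sq_sqrt hc.le, hf]
      have h3 := (intervalIntegral.continuous_primitive
        (fun a b => hfi.intervalIntegrable (a := a) (b := b)) 0).tendsto 0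
      rw [intervalIntegral.integral_same] at h3
      exact h3.comp hinv
    have h4 := h1.sub h2
    rw [sub_zero] at h4
    refine h4.congr fun A => ?_
    exact intervalIntegral.integral_interval_sub_left (hii _ (by positivity)) (hii _ (by positivity))
  rw [← integral_bose_Ioi hc] at hb
  obtain ⟨A, hA, hA0⟩ := ((hlim.eventually (lt_mem_nhds hb)).and (eventually_gt_atTop 0)).exists
  exact ⟨A, hA0, hA.trans_le (hlow A hA0)⟩

end BoseIntegral

end HeisenbergChain
end

noncomputable section

namespace HeisenbergChain

/-! ### Lower bound for the pressure at low temperature. -/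

section LowerBound

variable {N : ℕ}

theorem sum_log_le_pressure (hN : 0 < N) {m J K : ℕ} (hK : K ≤ m) (hθ : trialError J K m < 1)
    {β : ℝ} (hβ : 0 ≤ β) :
    (∑ k ∈ Finset.range K, Real.log (∑ j ∈ Finset.range (J + 1),
      Real.exp (-(β * (N / 2 * neumannEigenvalue m (k + 1)) / (1 - trialError J K m))) ^ j)) /
        (m + 2 : ℕ) ≤ pressure N β := by
  refine le_trans ?_ (le_pressure hβ (m + 1))
  refine div_le_div_of_nonneg_right ?_ (Nat.cast_nonneg _)
  have h := le_heatTrace_dirichlet hN hK hθ hβ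
  have hpos : ∀ k : ℕ, 0 < ∑ j ∈ Finset.range (J + 1),
      Real.exp (-(β * (N / 2 * neumannEigenvalue m (k + 1)) / (1 - trialError J K m))) ^ j :=
    fun k => Finset.sum_pos (fun j _ => by positivity) ⟨0, by simp⟩
  rw [← Real.log_prod fun k _ => (hpos k).ne']
  refine Real.log_le_log (Finset.prod_pos fun k _ => hpos k) (le_trans (le_of_eq ?_) h)
  rw [← Fin.prod_univ_eq_prod_range fun k => ∑ j ∈ Finset.range (J + 1),
      Real.exp (-(β * (N / 2 * neumannEigenvalue m (k + 1)) / (1 - trialError J K m))) ^ j]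
  refine Finset.prod_congr rfl fun k _ => ?_
  rw [Fin.sum_univ_eq_sum_range fun j => Real.exp (-(β * (N / 2 * neumannEigenvalue m (k + 1)) /
    (1 - trialError J K m))) ^ j]

theorem tendsto_trialError (J K : ℕ) : Tendsto (trialError J K) atTop (𝓝 0) := by
  unfold trialError
  refine Tendsto.div_atTop tendsto_const_nhds ?_
  exact tendsto_natCast_atTop_atTop.comp (tendsto_add_atTop_nat 2)

theorem tendsto_log_truncated {x : ℝ} (hx : 0 < x) :
    Tendsto (fun J : ℕ => Real.log (∑ j ∈ Finset.range (J + 1), Real.exp (-x) ^ j)) atTop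
      (𝓝 (bose x)) := by
  have h1 : Real.exp (-x) < 1 := Real.exp_lt_one_iff.mpr (neg_lt_zero.mpr hx)
  have h2 := (hasSum_geometric_of_lt_one (Real.exp_pos (-x)).le h1).tendsto_sum_nat
  have h3 := h2.comp (tendsto_add_atTop_nat 1)
  have h4 := one_sub_exp_neg_pos hx
  have h5 := (Real.continuousAt_log (inv_pos.mpr h4).ne').tendsto.comp h3
  rw [Real.log_inv] at h5
  exact h5

/-- Order of choices: `A` fixes mesh and cutoff of the Riemann sum, `K = A ^ 2` is the number of
modes, then comes the truncation `J`, and finally `β → ∞`. With `J` and `K` fixed the trial error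
tends to 0. -/
theorem eventually_lt_pressure (hN : 0 < N) {b : ℝ}
    (hb : b < -C₁ / Real.sqrt ((N : ℝ) / 2)) :
    ∀ᶠ β in atTop, b < Real.sqrt β * pressure N β := by
  have hN' : (0 : ℝ) < N := by exact_mod_cast hN
  have hpi := Real.pi_pos
  set c : ℝ := N / 2 * Real.pi ^ 2 with hc
  have hc0 : 0 < c := by positivity
  have hbc : b < Real.pi * (-C₁) / Real.sqrt c := by
    rw [hc, Real.sqrt_mul (by positivity), Real.sqrt_sq hpi.le]
    refine lt_of_lt_of_eq hb ?_
    have : 0 < Real.sqrt ((N : ℝ) / 2) := Real.sqrt_pos.mpr (by positivity)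
    field_simp
  obtain ⟨A, hA, hbA⟩ := exists_lt_riemann_sum hc0 hbc
  have hA' : (0 : ℝ) < A := by exact_mod_cast hA
  set K := A ^ 2 with hK
  have hJ : ∃ J : ℕ, b < 1 / A * ∑ k ∈ Finset.range K, Real.log (∑ j ∈ Finset.range (J + 1),
      Real.exp (-(c / (A : ℝ) ^ 2 * ((k : ℝ) + 1) ^ 2)) ^ j) := by
    have h1 : Tendsto (fun J : ℕ => 1 / A * ∑ k ∈ Finset.range K,
        Real.log (∑ j ∈ Finset.range (J + 1),
          Real.exp (-(c / (A : ℝ) ^ 2 * ((k : ℝ) + 1) ^ 2)) ^ j)) atTop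
        (𝓝 (1 / A * ∑ k ∈ Finset.range K, bose (c / (A : ℝ) ^ 2 * ((k : ℝ) + 1) ^ 2))) :=
      (tendsto_finsetSum _ fun k _ => tendsto_log_truncated (by positivity)).const_mul _
    exact (h1.eventually (lt_mem_nhds hbA)).exists
  obtain ⟨J, hJ⟩ := hJ
  -- In a box of length about `A √β`, `β` times the energy of mode `k + 1` is about `c (k + 1)² /
  -- A²`, and dividing by the length leaves the mesh `1 / A`.
  let m : ℝ → ℕ := fun β => ⌊A * Real.sqrt β⌋₊
  have hm : Tendsto m atTop atTop :=
    tendsto_nat_floor_atTop.comp (Real.tendsto_sqrt_atTop.const_mul_atTop hA')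
  have herr : Tendsto (fun β => trialError J K (m β)) atTop (𝓝 0) := (tendsto_trialError J K).comp hm
  have hratio : Tendsto (fun β => Real.sqrt β / (m β + 2 : ℕ)) atTop (𝓝 (1 / A)) := by
    have h1 : Tendsto (fun y : ℝ => (⌊A * y⌋₊ : ℝ) / y) atTop (𝓝 A) :=
      tendsto_nat_floor_mul_div_atTop hA'.le
    have h2 : Tendsto (fun y : ℝ => 2 / y) atTop (𝓝 0) := tendsto_const_nhds.div_atTop tendsto_id
    have h3 := ((h1.add h2).inv₀ (by simpa using hA'.ne')).comp Real.tendsto_sqrt_atTop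
    rw [add_zero, ← one_div] at h3
    refine h3.congr fun β => ?_
    simp only [Function.comp_apply, m]
    rw [← add_div, inv_div]
    push_cast
    rfl
  have hlim : Tendsto (fun β => Real.sqrt β / (m β + 2 : ℕ) * ∑ k ∈ Finset.range K,
      Real.log (∑ j ∈ Finset.range (J + 1), Real.exp (-(c / (A : ℝ) ^ 2 * ((k : ℝ) + 1) ^ 2 /
        (1 - trialError J K (m β)))) ^ j)) atTop
      (𝓝 (1 / A * ∑ k ∈ Finset.range K, Real.log (∑ j ∈ Finset.range (J + 1),
        Real.exp (-(c / (A : ℝ) ^ 2 * ((k : ℝ) + 1) ^ 2)) ^ j))) := by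
    refine hratio.mul (tendsto_finsetSum _ fun k _ => ?_)
    have hpos : 0 < ∑ j ∈ Finset.range (J + 1),
        Real.exp (-(c / (A : ℝ) ^ 2 * ((k : ℝ) + 1) ^ 2)) ^ j :=
      Finset.sum_pos (fun j _ => by positivity) ⟨0, by simp⟩
    refine (Real.continuousAt_log hpos.ne').tendsto.comp (tendsto_finsetSum _ fun j _ => ?_)
    refine ((Real.continuous_exp.tendsto _).comp (Tendsto.neg ?_)).pow j
    have h1 : Tendsto (fun β => 1 - trialError J K (m β)) atTop (𝓝 1) := by
      simpa using herr.const_sub 1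
    have h2 := (tendsto_const_nhds (x := c / (A : ℝ) ^ 2 * ((k : ℝ) + 1) ^ 2)).div h1 one_ne_zero
    rw [div_one] at h2
    exact h2
  filter_upwards [hlim.eventually (lt_mem_nhds hJ), hm.eventually_ge_atTop K,
    herr.eventually (gt_mem_nhds one_pos), eventually_gt_atTop 0] with β h1 h2 h3 h4
  refine h1.trans_le ?_
  have h5 := sum_log_le_pressure hN h2 h3 h4.le
  refine le_trans (le_of_eq_of_le (div_mul_eq_mul_div _ _ _) ?_)
    (mul_le_mul_of_nonneg_left h5 (Real.sqrt_nonneg β))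
  rw [mul_div_assoc]
  refine mul_le_mul_of_nonneg_left ?_ (Real.sqrt_nonneg β)
  refine div_le_div_of_nonneg_right ?_ (Nat.cast_nonneg _)
  refine Finset.sum_le_sum fun k _ => Real.log_le_log
    (Finset.sum_pos (fun j _ => by positivity) ⟨0, by simp⟩) ?_
  refine Finset.sum_le_sum fun j _ => pow_le_pow_left₀ (Real.exp_pos _).le ?_ j
  rw [Real.exp_le_exp, neg_le_neg_iff]
  refine div_le_div_of_nonneg_right ?_ (by linarith)
  have h6 : (A : ℝ) * Real.sqrt β ≤ (m β + 1 : ℕ) := by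
    push_cast
    exact (Nat.lt_floor_add_one _).le
  have h7 := neumannEigenvalue_le (m β) (k + 1)
  have h8 : (Real.pi * (k + 1 : ℕ) / (m β + 1 : ℕ)) ^ 2 ≤
      (Real.pi * (k + 1 : ℕ) / (A * Real.sqrt β)) ^ 2 := by
    have : 0 < A * Real.sqrt β := mul_pos hA' (Real.sqrt_pos.mpr h4)
    gcongr
  calc β * (N / 2 * neumannEigenvalue (m β) (k + 1))
      ≤ β * (N / 2 * (Real.pi * (k + 1 : ℕ) / (A * Real.sqrt β)) ^ 2) := by
        have := h7.trans h8
        gcongr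
    _ = _ := by
        rw [div_pow, mul_pow, mul_pow, Real.sq_sqrt h4.le, hc]
        push_cast
        field_simp

end LowerBound

/-! ### Upper bound for the pressure at low temperature. -/

section UpperBound

variable {N : ℕ}

/-- For `φ² ≤ η` use the Taylor bound for the cosine, otherwise `cos φ ≤ 1 - 2 φ² / π²` on `[0, π]`.
-/
theorem le_neumannEigenvalue {η : ℝ} (h0 : 0 < η) (h1 : η < 1) {m k : ℕ} (hk : k ≤ m) :
    (1 - η) * (Real.pi * k / (m + 1 : ℕ)) ^ 2 ≤ neumannEigenvalue m k ∨
      4 / Real.pi ^ 2 * η ≤ neumannEigenvalue m k := by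
  set φ := Real.pi * k / (m + 1 : ℕ) with hφ
  have hm : (0 : ℝ) < (m + 1 : ℕ) := by positivity
  have hφ0 : 0 ≤ φ := by positivity
  have hφπ : φ ≤ Real.pi := by
    rw [hφ, div_le_iff₀ hm]
    exact mul_le_mul_of_nonneg_left (by exact_mod_cast (by omega)) Real.pi_pos.le
  have hdef : neumannEigenvalue m k = 2 * (1 - Real.cos φ) := rfl
  rcases le_or_gt (φ ^ 2) η with h | h
  · left
    have h2 : |φ| ≤ 1 := by
      rw [abs_of_nonneg hφ0]
      nlinarith
    have h3 := (abs_le.mp (Real.cos_bound h2)).2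
    rw [abs_of_nonneg hφ0] at h3
    have h4 : φ ^ 4 ≤ η * φ ^ 2 := by
      have : φ ^ 4 = φ ^ 2 * φ ^ 2 := by ring
      rw [this]
      exact mul_le_mul_of_nonneg_right h (sq_nonneg _)
    have h5 : 0 ≤ η * φ ^ 2 := by positivity
    rw [hdef]
    linarith
  · right
    have h2 := Real.cos_le_one_sub_mul_cos_sq (x := φ) (by rwa [abs_of_nonneg hφ0])
    have h3 : 4 / Real.pi ^ 2 * η ≤ 4 / Real.pi ^ 2 * φ ^ 2 := by gcongr
    have h4 : 4 / Real.pi ^ 2 * φ ^ 2 = 2 * (2 / Real.pi ^ 2 * φ ^ 2) := by ring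
    rw [hdef]
    linarith

theorem log_bosonProduct (N L : ℕ) {β : ℝ} (hN : 0 < N) (hβ : 0 < β) :
    Real.log (bosonProduct N L β) =
      ∑ k ∈ Finset.range L, bose (β * (N / 2 * neumannEigenvalue L (k + 1))) := by
  have hN' : (0 : ℝ) < N := by exact_mod_cast hN
  rw [bosonProduct, Real.log_prod]
  · exact Finset.sum_congr rfl fun k _ => by rw [Real.log_inv, bose]
  · intro k hk
    have := neumannEigenvalue_pos k.succ_pos (Finset.mem_range.mp hk)
    exact (inv_pos.mpr (one_sub_exp_neg_pos (by positivity))).ne'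

theorem one_le_bosonProduct (N L : ℕ) {β : ℝ} (hN : 0 < N) (hβ : 0 < β) :
    1 ≤ bosonProduct N L β := by
  have hN' : (0 : ℝ) < N := by exact_mod_cast hN
  refine Finset.one_le_prod fun k hk => ?_
  have := neumannEigenvalue_pos k.succ_pos (Finset.mem_range.mp hk)
  have := one_sub_exp_neg_pos (x := β * (N / 2 * neumannEigenvalue L (k + 1))) (by positivity)
  have := Real.exp_pos (-(β * (N / 2 * neumannEigenvalue L (k + 1))))
  exact (one_le_inv₀ (by linarith)).mpr (by linarith)

/-- Small momenta have nearly quadratic dispersion, and their sum is below the integral by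
`sum_bose_le`. At other momenta the energy is bounded below, so the second term is exponentially
small in `β`. -/
theorem log_bosonProduct_le {η : ℝ} (h0 : 0 < η) (h1 : η < 1) (hN : 0 < N) (L : ℕ) {β : ℝ}
    (hβ : 0 < β) : Real.log (bosonProduct N L β) ≤
      (L + 1) * (-C₁) / Real.sqrt (β * (N / 2 * (1 - η))) +
        L * bose (β * (N / 2 * (4 / Real.pi ^ 2 * η))) := by
  have hN' : (0 : ℝ) < N := by exact_mod_cast hN
  have hpi := Real.pi_pos
  have h1' : 0 < 1 - η := by linarith
  rw [log_bosonProduct N L hN hβ]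
  set a := β * (N / 2 * (1 - η)) with ha
  have ha0 : 0 < a := by positivity
  set c := a * (Real.pi / (L + 1)) ^ 2 with hc
  set r := β * (N / 2 * (4 / Real.pi ^ 2 * η)) with hr
  have hr0 : 0 < r := by positivity
  have hterm : ∀ k ∈ Finset.range L, bose (β * (N / 2 * neumannEigenvalue L (k + 1))) ≤
      bose (c * ((k : ℝ) + 1) ^ 2) + bose r := by
    intro k hk
    rcases le_neumannEigenvalue h0 h1 (Finset.mem_range.mp hk) with h | h
    · refine le_trans (bose_anti (by positivity) ?_) (le_add_of_nonneg_right (bose_nonneg hr0))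
      calc c * ((k : ℝ) + 1) ^ 2 =
            β * (N / 2 * ((1 - η) * (Real.pi * (k + 1 : ℕ) / (L + 1 : ℕ)) ^ 2)) := by
            rw [hc, ha]
            push_cast
            ring
        _ ≤ _ := by gcongr
    · refine le_trans (bose_anti hr0 ?_) (le_add_of_nonneg_left (bose_nonneg (by positivity)))
      exact mul_le_mul_of_nonneg_left (mul_le_mul_of_nonneg_left h (by positivity)) hβ.le
  refine (Finset.sum_le_sum hterm).trans ?_
  rw [Finset.sum_add_distrib, Finset.sum_const, Finset.card_range, nsmul_eq_mul]
  refine add_le_add ((sum_bose_le (by positivity) L).trans (le_of_eq ?_)) le_rfl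
  have hs := Real.sqrt_pos.mpr ha0
  rw [hc, Real.sqrt_mul ha0.le, Real.sqrt_sq (by positivity)]
  field_simp

/-- The upper bound on the pressure in terms of the parameters of the comparison. -/
theorem pressure_le_of_scales (hN : 0 < N) {l k n₀ d : ℕ} {β E η : ℝ} (hβ : 0 < β)
    (h0 : 0 < η) (h1 : η < 1) (hl : 0 < l) (hk : 0 < k)
    (hshort : (l : ℝ) * Real.exp (-(β / 2 * (N / (8 * (l : ℝ) ^ 2)))) ≤ 1 / 2)
    (hlong : (2 * (N * l + 1 : ℕ) : ℝ) ^ k ≤ Real.exp (β / 2 * E))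
    (hn₀ : n₀ ≤ k * l) (hd0 : 0 < d) (hd : 2 * d ≤ k * l)
    (hη : 6 * (n₀ : ℝ) ^ 2 + 576 * (d : ℝ) ^ 3 * E ≤ η * d)
    (hE : 8 * ((k * l : ℕ) : ℝ) ^ 2 * E < (n₀ + 1 : ℕ) * N) :
    pressure N β ≤ Real.log (N * (k * l : ℕ) + 2) / (k * l : ℕ) +
      (1 + 1 / (k * l : ℕ)) * ((-C₁) / Real.sqrt (β * (1 - η) * (N / 2 * (1 - η)))) +
        bose (β * (1 - η) * (N / 2 * (4 / Real.pi ^ 2 * η))) := by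
  set L := k * l with hL
  have hL0 : 0 < L := Nat.mul_pos hk hl
  have hL' : (0 : ℝ) < L := by exact_mod_cast hL0
  have h1' : 0 < 1 - η := by linarith
  have hβη : 0 < β * (1 - η) := mul_pos hβ h1'
  have hZ := partitionFunction_le hN (L := L) (θ := 1 - η) hβ hn₀ hd0 hd h1' (by
    rwa [sub_sub_cancel]) hE
  -- Cut the chain into `k` blocks of length `l`, short enough for the crude bound at `β / 2`; by
  -- `hlong` the factor from the cutoff `E` pays for all blocks.
  have hrest : Real.exp (-(β / 2 * E)) * partitionFunction N L (β / 2) ≤ 1 := by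
    have h2 := partitionFunction_mul_le (N := N) (half_pos hβ).le l k
    have h3 := partitionFunction_le_of_short hN hl (half_pos hβ).le hshort
    have h4 : 0 ≤ partitionFunction N l (β / 2) := by
      rw [partitionFunction_eq_sum]
      exact Finset.sum_nonneg fun _ _ => (Real.exp_pos _).le
    have h5 : partitionFunction N L (β / 2) ≤ Real.exp (β / 2 * E) :=
      h2.trans ((pow_le_pow_left₀ h4 h3 k).trans hlong)
    rw [Real.exp_neg, inv_mul_le_iff₀ (Real.exp_pos _), mul_one]
    exact h5
  set P := bosonProduct N L (β * (1 - η)) with hP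
  have hP1 : 1 ≤ P := one_le_bosonProduct N L hN hβη
  have hZ2 : partitionFunction N L β ≤ (N * L + 2) * P := by
    push_cast at hZ
    linarith
  have hZ0 : 0 < partitionFunction N L β := by
    rw [partitionFunction_eq_sum]
    exact Finset.sum_pos (fun _ _ => Real.exp_pos _) Finset.univ_nonempty
  have hlog : Real.log (partitionFunction N L β) ≤ Real.log (N * L + 2) + Real.log P := by
    rw [← Real.log_mul (by positivity) (by linarith)]
    exact Real.log_le_log hZ0 hZ2
  have hlogP := log_bosonProduct_le h0 h1 hN L hβη
  refine (pressure_le hβ.le hL0.ne').trans ?_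
  rw [div_le_iff₀ hL']
  refine (hlog.trans (add_le_add le_rfl hlogP)).trans (le_of_eq ?_)
  field_simp
  ring

theorem half_le_floor {y : ℝ} (hy : 2 ≤ y) : y / 2 ≤ (⌊y⌋₊ : ℝ) := by
  have := Nat.lt_floor_add_one y
  linarith

/-- A choice of scales for the comparison at inverse temperature `x ^ 28`. -/
theorem eventually_pressure_le (hN : 0 < N) {η : ℝ} (h0 : 0 < η) (h1 : η < 1) :
    ∀ᶠ x : ℝ in atTop, Real.sqrt (x ^ 28) * pressure N (x ^ 28) ≤
      4 / x * (Real.log (N + 2) + 15 * Real.log x) +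
        (1 + 4 / x ^ 15) * ((-C₁) / ((1 - η) * Real.sqrt (N / 2))) +
        Real.sqrt (x ^ 28) * bose (x ^ 28 * (1 - η) * (N / 2 * (4 / Real.pi ^ 2 * η))) := by
  have hN' : (1 : ℝ) ≤ N := by exact_mod_cast hN
  have h1' : 0 < 1 - η := by linarith
  have e1 : ∀ᶠ x : ℝ in atTop, x ^ (13 : ℝ) * Real.exp (-(1 / 16) * x) < 1 / 2 :=
    (tendsto_rpow_mul_exp_neg_mul_atTop_nhds_zero 13 (1 / 16) (by norm_num)).eventually
      (gt_mem_nhds (by norm_num))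
  have e2 : ∀ᶠ x : ℝ in atTop, x ^ (13 : ℝ) * Real.exp (-1 * x) < (2 * N + 2 : ℝ)⁻¹ :=
    (tendsto_rpow_mul_exp_neg_mul_atTop_nhds_zero 13 1 one_pos).eventually
      (gt_mem_nhds (by positivity))
  filter_upwards [e1, e2, eventually_ge_atTop 2, eventually_ge_atTop (5376 / η)] with x e1 e2 hx hxη
  have hx1 : 1 ≤ x := by linarith
  have hx0 : 0 < x := by linarith
  rw [show (13 : ℝ) = ((13 : ℕ) : ℝ) by norm_num, Real.rpow_natCast] at e1 e2
  have hge : ∀ j : ℕ, j ≠ 0 → 2 ≤ x ^ j := fun j hj => hx.trans (le_self_pow₀ hx1 hj)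
  -- With `√β = x ^ 14`: blocks `l ≈ x ^ 13` are shorter, so `β / l² ≈ x²` beats `log l`, and `k l ≈
  -- x ^ 15` is longer, so `log L / L` is negligible. The cutoff is `E = 2 / x ^ 25`: `β E / 2 = x ^
  -- 3` covers `k` factors of at most `e ^ x`, and `8 L² E ≤ 16 x ^ 5` sets `n₀`. With `d ≈ x ^ 11`,
  -- both `n₀² ≈ x ^ 10` and `d³ E ≈ x ^ 8` are small against `d`.
  set l := ⌊x ^ 13⌋₊ with hl
  set k := ⌊x ^ 2⌋₊ with hk
  set n₀ := ⌊16 * x ^ 5⌋₊ with hn₀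
  set d := ⌊x ^ 11⌋₊ with hd
  have l1 : x ^ 13 / 2 ≤ l := half_le_floor (hge 13 (by norm_num))
  have l2 : (l : ℝ) ≤ x ^ 13 := Nat.floor_le (by positivity)
  have k1 : x ^ 2 / 2 ≤ k := half_le_floor (hge 2 (by norm_num))
  have k2 : (k : ℝ) ≤ x ^ 2 := Nat.floor_le (by positivity)
  have d1 : x ^ 11 / 2 ≤ d := half_le_floor (hge 11 (by norm_num))
  have d2 : (d : ℝ) ≤ x ^ 11 := Nat.floor_le (by positivity)
  have n1 : (n₀ : ℝ) ≤ 16 * x ^ 5 := Nat.floor_le (by positivity)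
  have n2 : 16 * x ^ 5 < n₀ + 1 := Nat.lt_floor_add_one _
  have hl0 : (0 : ℝ) < l := lt_of_lt_of_le (by positivity) l1
  have hk0 : (0 : ℝ) < k := lt_of_lt_of_le (by positivity) k1
  have hd0 : (0 : ℝ) < d := lt_of_lt_of_le (by positivity) d1
  have L1 : x ^ 15 / 4 ≤ ((k * l : ℕ) : ℝ) := by
    push_cast
    calc x ^ 15 / 4 = x ^ 2 / 2 * (x ^ 13 / 2) := by ring
      _ ≤ _ := by gcongr
  have L2 : ((k * l : ℕ) : ℝ) ≤ x ^ 15 := by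
    push_cast
    calc (k : ℝ) * l ≤ x ^ 2 * x ^ 13 := by gcongr
      _ = _ := by ring
  have hx4 : (16 : ℝ) ≤ x ^ 4 := by
    calc (16 : ℝ) = 2 ^ 4 := by norm_num
      _ ≤ _ := by gcongr
  have hx10 : (64 : ℝ) ≤ x ^ 10 := by
    calc (64 : ℝ) ≤ 2 ^ 10 := by norm_num
      _ ≤ _ := by gcongr
  have hshort : (l : ℝ) * Real.exp (-(x ^ 28 / 2 * (N / (8 * (l : ℝ) ^ 2)))) ≤ 1 / 2 := by
    refine le_trans ?_ e1.le
    refine mul_le_mul l2 (Real.exp_le_exp.mpr ?_) (Real.exp_pos _).le (by positivity)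
    rw [neg_mul, neg_le_neg_iff]
    calc 1 / 16 * x ≤ 1 / 16 * x ^ 2 := by
          have := le_self_pow₀ hx1 (two_ne_zero)
          linarith
      _ = x ^ 28 / 2 * (1 / (8 * (x ^ 13) ^ 2)) := by field_simp; norm_num
      _ ≤ _ := by gcongr
  have hlong : (2 * (N * l + 1 : ℕ) : ℝ) ^ k ≤ Real.exp (x ^ 28 / 2 * (2 / x ^ 25)) := by
    have h2 : (2 * (N * l + 1 : ℕ) : ℝ) ≤ Real.exp x := by
      have h3 : (1 : ℝ) ≤ x ^ 13 := one_le_pow₀ hx1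
      have h4 : (2 * N + 2 : ℝ) * x ^ 13 ≤ Real.exp x := by
        rw [neg_mul, one_mul, Real.exp_neg, ← div_eq_mul_inv, div_lt_iff₀ (Real.exp_pos _),
          inv_mul_eq_div, lt_div_iff₀ (by positivity)] at e2
        linarith
      push_cast
      calc 2 * ((N : ℝ) * l + 1) ≤ 2 * (N * x ^ 13 + x ^ 13) := by gcongr
        _ = (2 * N + 2 : ℝ) * x ^ 13 := by ring
        _ ≤ _ := h4
    calc (2 * (N * l + 1 : ℕ) : ℝ) ^ k ≤ Real.exp x ^ k := by gcongr
      _ = Real.exp (k * x) := (Real.exp_nat_mul x k).symm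
      _ ≤ _ := by
          rw [Real.exp_le_exp]
          calc (k : ℝ) * x ≤ x ^ 2 * x := by gcongr
            _ = _ := by field_simp
  have hn₀' : n₀ ≤ k * l := by
    have : (n₀ : ℝ) ≤ ((k * l : ℕ) : ℝ) := by
      refine n1.trans (le_trans ?_ L1)
      calc 16 * x ^ 5 = 64 * x ^ 5 / 4 := by ring
        _ ≤ x ^ 10 * x ^ 5 / 4 := by gcongr
        _ = _ := by ring
    exact_mod_cast this
  have hd' : 2 * d ≤ k * l := by
    have : ((2 * d : ℕ) : ℝ) ≤ ((k * l : ℕ) : ℝ) := by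
      refine le_trans ?_ L1
      push_cast
      calc 2 * (d : ℝ) ≤ 2 * x ^ 11 := by gcongr
        _ = 8 * x ^ 11 / 4 := by ring
        _ ≤ x ^ 4 * x ^ 11 / 4 := by gcongr; linarith
        _ = _ := by ring
    exact_mod_cast this
  have hη : 6 * (n₀ : ℝ) ^ 2 + 576 * (d : ℝ) ^ 3 * (2 / x ^ 25) ≤ η * d := by
    calc 6 * (n₀ : ℝ) ^ 2 + 576 * (d : ℝ) ^ 3 * (2 / x ^ 25)
        ≤ 6 * (16 * x ^ 5) ^ 2 + 576 * (x ^ 11) ^ 3 * (2 / x ^ 25) := by gcongr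
      _ = 1536 * x ^ 10 + 1152 * x ^ 8 := by field_simp; ring
      _ ≤ 1536 * x ^ 10 + 1152 * x ^ 10 := by
          have : x ^ 8 ≤ x ^ 10 := pow_le_pow_right₀ hx1 (by norm_num)
          linarith
      _ = 5376 * (x ^ 10 / 2) := by ring
      _ ≤ (η * x) * (x ^ 10 / 2) := by
          rw [div_le_iff₀ h0] at hxη
          gcongr
          linarith
      _ = η * (x ^ 11 / 2) := by ring
      _ ≤ _ := by gcongr
  have hE : 8 * ((k * l : ℕ) : ℝ) ^ 2 * (2 / x ^ 25) < (n₀ + 1 : ℕ) * N := by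
    calc 8 * ((k * l : ℕ) : ℝ) ^ 2 * (2 / x ^ 25) ≤ 8 * (x ^ 15) ^ 2 * (2 / x ^ 25) := by gcongr
      _ = 16 * x ^ 5 := by field_simp; ring
      _ < (n₀ + 1 : ℕ) := by push_cast; exact n2
      _ ≤ _ := le_mul_of_one_le_right (Nat.cast_nonneg _) hN'
  have key := pressure_le_of_scales hN (β := x ^ 28) (by positivity) h0 h1 (by exact_mod_cast hl0)
    (by exact_mod_cast hk0) hshort hlong hn₀' (by exact_mod_cast hd0) hd' hη hE
  have hsq : Real.sqrt (x ^ 28) = x ^ 14 := by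
    rw [show x ^ 28 = (x ^ 14) ^ 2 by ring, Real.sqrt_sq (by positivity)]
  have hsq2 : Real.sqrt (x ^ 28 * (1 - η) * (N / 2 * (1 - η))) =
      x ^ 14 * ((1 - η) * Real.sqrt (N / 2)) := by
    rw [show x ^ 28 * (1 - η) * ((N : ℝ) / 2 * (1 - η)) = (x ^ 14 * (1 - η)) ^ 2 * (N / 2) by ring,
      Real.sqrt_mul (by positivity), Real.sqrt_sq (by positivity), mul_assoc]
  set L : ℝ := ((k * l : ℕ) : ℝ) with hL
  have hL0 : 0 < L := lt_of_lt_of_le (by positivity) L1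
  rw [hsq2] at key
  rw [hsq]
  set Q := (-C₁) / ((1 - η) * Real.sqrt (N / 2)) with hQ
  have hs2 : 0 < Real.sqrt ((N : ℝ) / 2) := Real.sqrt_pos.mpr (by positivity)
  have hQ0 : 0 ≤ Q := div_nonneg (neg_nonneg.mpr C₁_neg.le) (by positivity)
  have hQ2 : (-C₁) / (x ^ 14 * ((1 - η) * Real.sqrt (N / 2))) = Q / x ^ 14 := by
    rw [hQ, div_div, mul_comm (x ^ 14)]
  rw [hQ2] at key
  have t1 : Real.log (N * L + 2) ≤ Real.log (N + 2) + 15 * Real.log x := by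
    have h3 : (1 : ℝ) ≤ x ^ 15 := one_le_pow₀ hx1
    rw [show 15 * Real.log x = ((15 : ℕ) : ℝ) * Real.log x by norm_num, ← Real.log_pow,
      ← Real.log_mul (by positivity) (by positivity)]
    refine Real.log_le_log (by positivity) ?_
    calc (N : ℝ) * L + 2 ≤ N * x ^ 15 + 2 * x ^ 15 := by
          have : (N : ℝ) * L ≤ N * x ^ 15 := by gcongr
          linarith
      _ = _ := by ring
  have t0 : 0 ≤ Real.log (N + 2) + 15 * Real.log x := by
    have h4 := Real.log_nonneg (by linarith : (1 : ℝ) ≤ N + 2)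
    have h5 := Real.log_nonneg hx1
    linarith
  have t2 : x ^ 14 / L ≤ 4 / x := by
    rw [div_le_div_iff₀ hL0 hx0]
    calc x ^ 14 * x = 4 * (x ^ 15 / 4) := by ring
      _ ≤ _ := by gcongr
  have t3 : 1 / L ≤ 4 / x ^ 15 := by
    rw [div_le_div_iff₀ hL0 (by positivity)]
    linarith
  have hx14 : 0 < x ^ 14 := by positivity
  calc x ^ 14 * pressure N (x ^ 28)
      ≤ x ^ 14 * (Real.log (N * L + 2) / L + (1 + 1 / L) * (Q / x ^ 14) +
        bose (x ^ 28 * (1 - η) * (N / 2 * (4 / Real.pi ^ 2 * η)))) :=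
        mul_le_mul_of_nonneg_left key hx14.le
    _ = x ^ 14 / L * Real.log (N * L + 2) + (1 + 1 / L) * Q +
        x ^ 14 * bose (x ^ 28 * (1 - η) * (N / 2 * (4 / Real.pi ^ 2 * η))) := by
        field_simp
    _ ≤ _ := by
        refine add_le_add (add_le_add ?_ (mul_le_mul_of_nonneg_right (by linarith) hQ0)) le_rfl
        exact (mul_le_mul_of_nonneg_left t1 (by positivity)).trans
          (mul_le_mul_of_nonneg_right t2 t0)

/-- In `eventually_pressure_le` only the middle term survives as `x = β^(1/28) → ∞`; `η` is fixed
beforehand so small that its limit stays below `b`. -/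
theorem eventually_pressure_lt (hN : 0 < N) {b : ℝ}
    (hb : -C₁ / Real.sqrt ((N : ℝ) / 2) < b) :
    ∀ᶠ β in atTop, Real.sqrt β * pressure N β < b := by
  have hN' : (0 : ℝ) < N := by exact_mod_cast hN
  have hs : 0 < Real.sqrt ((N : ℝ) / 2) := Real.sqrt_pos.mpr (by positivity)
  have hη : ∃ η : ℝ, 0 < η ∧ η < 1 ∧ (-C₁) / ((1 - η) * Real.sqrt (N / 2)) < b := by
    have h1 : Tendsto (fun η : ℝ => (-C₁) / ((1 - η) * Real.sqrt (N / 2))) (𝓝[>] 0)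
        (𝓝 ((-C₁) / ((1 - 0) * Real.sqrt (N / 2)))) := by
      refine Tendsto.mono_left ?_ nhdsWithin_le_nhds
      refine ContinuousAt.tendsto (f := fun η : ℝ => (-C₁) / ((1 - η) * Real.sqrt (N / 2))) ?_
      have : (1 - (0 : ℝ)) * Real.sqrt (N / 2) ≠ 0 := by simpa using hs.ne'
      fun_prop (disch := assumption)
    rw [sub_zero, one_mul] at h1
    obtain ⟨η, h2, h3⟩ := ((h1.eventually (gt_mem_nhds hb)).and
      (Ioo_mem_nhdsGT one_pos)).exists
    exact ⟨η, h3.1, h3.2, h2⟩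
  obtain ⟨η, h0, h1, hη⟩ := hη
  have h1' : 0 < 1 - η := by linarith
  set r := (1 - η) * ((N : ℝ) / 2 * (4 / Real.pi ^ 2 * η)) with hr
  have hr0 : 0 < r := by
    have := Real.pi_pos
    positivity
  have hbose : Tendsto (fun β => Real.sqrt β * bose (β * r)) atTop (𝓝 0) := by
    have h2 := (tendsto_rpow_mul_exp_neg_mul_atTop_nhds_zero (1 / 2) r hr0).const_mul 2
    rw [mul_zero] at h2
    refine squeeze_zero' ?_ ?_ h2
    · filter_upwards [eventually_gt_atTop 0] with β hβ
      exact mul_nonneg (Real.sqrt_nonneg _) (bose_nonneg (mul_pos hβ hr0))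
    · filter_upwards [eventually_ge_atTop (1 / r)] with β hβ
      rw [div_le_iff₀ hr0] at hβ
      rw [← Real.sqrt_eq_rpow]
      calc _ ≤ Real.sqrt β * (2 * Real.exp (-(β * r))) :=
            mul_le_mul_of_nonneg_left (bose_le hβ) (Real.sqrt_nonneg _)
        _ = _ := by
            rw [show -r * β = -(β * r) by ring]
            ring
  have hpow : Tendsto (fun x : ℝ => x ^ 28) atTop atTop := tendsto_pow_atTop (by norm_num)
  have hlog : Tendsto (fun x : ℝ => 4 / x * (Real.log (N + 2) + 15 * Real.log x)) atTop (𝓝 0) := by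
    have h2 : Tendsto (fun x : ℝ => Real.log x / x) atTop (𝓝 0) := by
      simpa using Real.isLittleO_log_id_atTop.tendsto_div_nhds_zero
    have h3 : Tendsto (fun x : ℝ => 4 * Real.log (N + 2) / x) atTop (𝓝 0) :=
      tendsto_const_nhds.div_atTop tendsto_id
    have h4 := h3.add (h2.const_mul 60)
    rw [mul_zero, add_zero] at h4
    refine h4.congr fun x => ?_
    ring
  have hinv : Tendsto (fun x : ℝ => 4 / x ^ 15) atTop (𝓝 0) :=
    tendsto_const_nhds.div_atTop (tendsto_pow_atTop (by norm_num))
  have hlim := (hlog.add ((hinv.const_add 1).mul_const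
    ((-C₁) / ((1 - η) * Real.sqrt (N / 2))))).add (hbose.comp hpow)
  rw [add_zero, add_zero, one_mul, zero_add] at hlim
  have hx : ∀ᶠ x : ℝ in atTop, Real.sqrt (x ^ 28) * pressure N (x ^ 28) < b := by
    filter_upwards [eventually_pressure_le hN h0 h1, hlim.eventually (gt_mem_nhds hη)] with x h2 h3
    refine lt_of_le_of_lt (h2.trans (le_of_eq ?_)) h3
    simp only [Function.comp_apply, hr, mul_assoc]
  have hroot : Tendsto (fun β : ℝ => β ^ (1 / 28 : ℝ)) atTop atTop :=
    tendsto_rpow_atTop (by norm_num)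
  filter_upwards [hroot.eventually hx, eventually_gt_atTop 0] with β h2 hβ
  have h3 : (β ^ (1 / 28 : ℝ)) ^ 28 = β := by
    rw [← Real.rpow_natCast, ← Real.rpow_mul hβ.le]
    norm_num
  rwa [h3] at h2

theorem tendsto_sqrt_mul_pressure (hN : 0 < N) :
    Tendsto (fun β => Real.sqrt β * pressure N β) atTop
      (𝓝 (-C₁ / Real.sqrt ((N : ℝ) / 2))) :=
  tendsto_order.mpr ⟨fun _ hb => eventually_lt_pressure hN hb,
    fun _ hb => eventually_pressure_lt hN hb⟩

end UpperBound

end HeisenbergChain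
end

theorem theorem1 (S : ℝ) (hS : 1 / 2 ≤ S) (N : ℕ) (hN : (N : ℝ) = 2 * S) :
    (∀ β : ℝ, 0 < β →
      Tendsto (fun L : ℕ => HeisenbergChain.finiteFreeEnergy N L β) atTop
        (𝓝 (HeisenbergChain.freeEnergy N β))) ∧
    Tendsto (fun β : ℝ => HeisenbergChain.freeEnergy N β * S ^ (1 / 2 : ℝ) * β ^ (3 / 2 : ℝ))
      atTop (𝓝 HeisenbergChain.C₁) ∧
    Integrable (fun p : ℝ => Real.log (1 - Real.exp (-p ^ 2))) ∧
    (HeisenbergChain.C₁ : ℂ) =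
      -riemannZeta (3 / 2) / (2 * ((Real.sqrt Real.pi : ℝ) : ℂ)) := by
  have hN0 : 0 < N := by
    have : (0 : ℝ) < N := by linarith
    exact_mod_cast this
  have hS0 : 0 < S := by linarith
  refine ⟨fun β hβ => ?_, ?_, HeisenbergChain.integrable_log, HeisenbergChain.C₁_eq_zeta⟩
  · rw [HeisenbergChain.freeEnergy_eq hβ]
    exact HeisenbergChain.tendsto_finiteFreeEnergy hβ
  -- Since the free energy is `-pressure / β`, the quantity in question is `√β · pressure` times
  -- `-√S`.
  · have h := (HeisenbergChain.tendsto_sqrt_mul_pressure hN0).mul_const (-Real.sqrt S)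
    have hNS : (N : ℝ) / 2 = S := by linarith
    have hs := Real.sqrt_pos.mpr hS0
    rw [hNS, neg_div, neg_mul_neg, div_mul_cancel₀ _ hs.ne'] at h
    refine h.congr' ?_
    filter_upwards [eventually_gt_atTop 0] with β hβ
    have h3 : β ^ (3 / 2 : ℝ) = Real.sqrt β * β := by
      rw [Real.sqrt_eq_rpow, ← Real.rpow_add_one hβ.ne']
      norm_num
    rw [HeisenbergChain.freeEnergy_eq hβ, h3, ← Real.sqrt_eq_rpow]
    field_simp
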